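/- **Setting.** Let $\mathcal X\subset\mathbb R^{d_x}$, $\mathcal Y\subset\mathbb R^{d_y}$ be nonempty, convex and compact, let $\zeta$ be a random variable with law $D$, and consider $\min_{x\in\mathcal X}\max_{y\in\mathcal Y} g(x,y)$ with $g(x,y)=\mathbb E_{\zeta\sim D}[G(x,y,\zeta)]$, where $g(x,\cdot)$ is concave on $\mathcal Y$ for every $x\in\mathcal X$. For every $\zeta$, $G(\cdot,\cdot,\zeta)$ is differentiable in $x$ and in $y$ on a product $U\times V$ of open sets $U\supseteq\mathcal X$, $V\supseteq\mathcal Y$, with $\nabla_xG$ Lipschitz in $x$ and $\nabla_yG$ Lipschitz in $y$ there (with some constant uniform in $\zeta$), and $G(x,y,\cdot)$ is measurable and integrable for $(x,y)\in U\times V$. Assume: 1. there is $l>0$ such that for all $\zeta$, $x,x_1,x_2\in\mathcal X$, $y,y_1,y_2\in\mathcal Y$: $\|\nabla_xG(x_1,y,\zeta)-\nabla_xG(x_2,y,\zeta)\|$ and $\|\nabla_yG(x_1,y,\zeta)-\nabla_yG(x_2,y,\zeta)\|$ are at most $l\|x_1-x_2\|$, and $\|\nabla_xG(x,y_1,\zeta)-\nabla_xG(x,y_2,\zeta)\|$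 and $\|\nabla_yG(x,y_1,\zeta)-\nabla_yG(x,y_2,\zeta)\|$ are at most $l\|y_1-y_2\|$; 2. there is $\delta>0$ such that $\mathbb E\|\nabla_xG(x,y,\zeta)-\nabla_xg(x,y)\|^2\le\delta^2$ and $\mathbb E\|\nabla_yG(x,y,\zeta)-\nabla_yg(x,y)\|^2\le\delta^2$ for all $x\in\mathcal X$, $y\in\mathcal Y$. **Parameters.** Let $b\ge1$ be an integer and let $$\eta_k=\frac1{(k+2)^{5/13}},\quad \alpha_k=\frac{a_4}{(k+2)^{4/13}},\quad \rho_k=\frac{L}{(k+1)^{2/13}},\quad \gamma_k=\frac{a_5}{(k+2)^{12/13}},\quad \theta_k=\frac{a_6}{(k+2)^{8/13}},$$ $$D^{(1)}_k=a_1(k+2)^{3/13},\quad D^{(2)}_k=a_2(k+2)^{3/13},$$ where $L=l+\rho_1$ (that is, $L=l/(1-2^{-2/13})$), $0<\beta\le\frac1{6L}$, $0<a_4\le\min\{\frac1{8L},\frac{\beta}{8\sqrt5}\}$, $0<a_1,a_2\le\min\{\frac{b}{32a_4L^2},\frac{ba_4}{2L\beta}\}$, $a_5\ge\frac{4a_4}{a_1}+\frac{12}{13}$,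 $a_6\ge\frac{80a_4}{a_2}+\frac{12}{13}$, and $\gamma_k\le1$, $\theta_k\le1$ for all $k\ge1$. Let $0<d_1\le\min\{\frac18,L\beta,\frac{a_1a_5}{4a_4},\frac{a_2a_6}{4a_4}\}$. Put $g_k(x,y)=g(x,y)-\frac{\rho_k}2\|y\|^2$, $\tilde G_k(x,y;\zeta)=G(x,y,\zeta)-\frac{\rho_k}2\|y\|^2$, and let $\mathcal P_{\mathcal X},\mathcal P_{\mathcal Y}$ be the Euclidean projections. **Algorithm (FORMDA).** Let $I_k=\{\zeta^k_1,\dots,\zeta^k_b\}$, $k\ge1$, where all the $\zeta^k_j$ are independent with law $D$, and write $\nabla\tilde G_k(x,y;I)$ for the average of $\nabla\tilde G_k(x,y;\zeta)$ over the mini-batch $I$. Start from deterministic $x_1\in\mathcal X$, $y_1\in\mathcal Y$ with $v_1=\nabla_x\tilde G_1(x_1,y_1;I_1)$, $w_1=\nabla_y\tilde G_1(x_1,y_1;I_1)$, and for $k\ge1$ set $$x_{k+1}=x_k+\eta_k\big(\mathcal P_{\mathcal X}(x_k-\alpha_kv_k)-x_k\big),\qquad y_{k+1}=y_k+\eta_k\big(\mathcal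 P_{\mathcal Y}(y_k+\beta w_k)-y_k\big),$$ $$v_{k+1}=\nabla_x\tilde G_{k+1}(x_{k+1},y_{k+1};I_{k+1})+(1-\gamma_k)\big[v_k-\nabla_x\tilde G_k(x_k,y_k;I_{k+1})\big],$$ $$w_{k+1}=\nabla_y\tilde G_{k+1}(x_{k+1},y_{k+1};I_{k+1})+(1-\theta_k)\big[w_k-\nabla_y\tilde G_k(x_k,y_k;I_{k+1})\big].$$ **Stationarity and constants.** Let $$\nabla\mathcal G^{\alpha,\beta}(x,y)=\begin{pmatrix}\frac1\alpha\big(x-\mathcal P_{\mathcal X}(x-\alpha\nabla_xg(x,y))\big)\\ \frac1\beta\big(y-\mathcal P_{\mathcal Y}(y+\beta\nabla_yg(x,y))\big)\end{pmatrix},\qquad T(\varepsilon)=\min\{k\ge1:\ \mathbb E\|\nabla\mathcal G^{\alpha_k,\beta}(x_k,y_k)\|\le\varepsilon\}.$$ Let $\sigma_y=\max_{y\in\mathcal Y}\|y\|$, $\Phi_k(x)=\max_{y\in\mathcal Y}g_k(x,y)$ and $y_k^*(x)=\arg\max_{y\in\mathcal Y}g_k(x,y)$. For $k\ge0$ and random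 vectors $\xi$ with values in $\mathcal X$ and $\upsilon$ with values in $\mathcal Y$ let $$\begin{aligned}S_{k+1}(\xi,\upsilon)={}&\mathbb E[\Phi_{k+1}(\xi)]+D^{(1)}_k\,\mathbb E\|\nabla_xg_{k+1}(\xi,\upsilon)-v_{k+1}\|^2+\frac{8\alpha_kL^2}{\beta\rho_{k+1}}\mathbb E\|\upsilon-y_{k+1}^*(\xi)\|^2\\&+D^{(2)}_k\,\mathbb E\|\nabla_yg_{k+1}(\xi,\upsilon)-w_{k+1}\|^2-\frac{40\alpha_{k+1}L^2(\rho_{k+1}-\rho_{k+2})}{\eta_{k+1}\beta^2\rho_{k+2}^3}\mathbb E\|y_{k+1}^*(\xi)\|^2+\frac{4D^{(2)}_{k+1}\rho_{k+1}^2\sigma_y^2}{b},\end{aligned}$$ let $\underline S$ be the infimum of $S_k(\xi,\upsilon)$ over $k\ge1$ and over all such $\xi,\upsilon$, and let $$C_1=S_1(x_1,y_1)-\underline S+\frac{\rho_1}2\sigma_y^2+\frac{40\alpha_1L^2\rho_1}{\eta_1\beta^2\rho_2^3}\sigma_y^2,\qquad C_2=\frac{2\delta^2(a_5^2a_1+a_6^2a_2)}b+\frac{12a_2L^2\sigma_y^2}{13b}.$$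 **Theorem.** For every $\varepsilon>0$, $T(\varepsilon)$ is finite, and there is an integer $\tilde T(\varepsilon)\ge1$ with $$T(\varepsilon)\le\max\Big\{\tilde T(\varepsilon),\Big(\frac{2L\sigma_y}\varepsilon\Big)^{13/2}-1\Big\}$$ such that, unless $\tilde T(\varepsilon)=1$, $$\frac{\varepsilon^2}4\le\frac{C_1+C_2\ln(\tilde T(\varepsilon)+2)}{d_1a_4\big(\frac{13}4(\tilde T(\varepsilon)+3)^{4/13}-\frac{13\cdot3^{4/13}}4\big)}.$$ Consequently $T(\varepsilon)=\tilde{\mathcal O}(\varepsilon^{-6.5})$: there is a constant $K$ depending only on $L\sigma_y$, $C_1$, $C_2$ and $d_1a_4$ such that $T(\varepsilon)\le K\,\varepsilon^{-13/2}\,(\ln(1/\varepsilon))^{13/4}$ for all $0<\varepsilon\le\frac12$. -/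

import Mathlib

open MeasureTheory ProbabilityTheory

noncomputable section

namespace Formda

/-- Euclidean space `ℝᵈ`. -/
abbrev Vec (d : ℕ) := EuclideanSpace ℝ (Fin d)

/-- Data of `min_{x ∈ X} max_{y ∈ Y} g(x,y)`, `g(x,y) = 𝔼_{ζ ∼ D}[G(x,y,ζ)]`. -/
structure MinimaxProblem (dx dy : ℕ) (Ξ : Type*) [MeasurableSpace Ξ] where
  /-- feasible set of the minimization variable -/
  X : Set (Vec dx)
  /-- feasible set of the maximization variable -/
  Y : Set (Vec dy)
  /-- stochastic objective -/
  G : Vec dx → Vec dy → Ξ → ℝ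
  /-- distribution of the random variable `ζ` -/
  D : Measure Ξ

/-- Partial gradient in `x`. -/
def gradX {dx dy : ℕ} (f : Vec dx → Vec dy → ℝ) (x : Vec dx) (y : Vec dy) : Vec dx :=
  gradient (fun x' => f x' y) x

/-- Partial gradient in `y`. -/
def gradY {dx dy : ℕ} (f : Vec dx → Vec dy → ℝ) (x : Vec dx) (y : Vec dy) : Vec dy :=
  gradient (fun y' => f x y') y

/-- `f(x,y) - (ρ/2)‖y‖²`. -/
def regularize {dx dy : ℕ} (ρ : ℝ) (f : Vec dx → Vec dy → ℝ) (x : Vec dx) (y : Vec dy) : ℝ :=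
  f x y - ρ / 2 * ‖y‖ ^ 2

/-- Euclidean projection onto `K`: a point of `K` nearest to `x`
(it exists and is unique when `K` is nonempty, closed and convex). -/
def proj {d : ℕ} (K : Set (Vec d)) (x : Vec d) : Vec d :=
  Classical.epsilon fun z => z ∈ K ∧ ∀ u ∈ K, ‖x - z‖ ≤ ‖x - u‖

/-! ### Step sizes and parameters -/

/-- The numerical parameters of the method and of its analysis. -/
structure Params where
  /-- Lipschitz constant of the stochastic gradients -/
  l : ℝ
  /-- `L = l + ρ₁` -/
  L : ℝ
  /-- step size in `y` -/
  β : ℝ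
  /-- mini-batch size -/
  b : ℕ
  a₁ : ℝ
  a₂ : ℝ
  a₄ : ℝ
  a₅ : ℝ
  a₆ : ℝ
  d₁ : ℝ
  /-- standard deviation bound of the stochastic gradients -/
  δ : ℝ

namespace Params

variable (p : Params)

def η (_ : Params) (k : ℕ) : ℝ := 1 / ((k : ℝ) + 2) ^ ((5 : ℝ) / 13)

def α (k : ℕ) : ℝ := p.a₄ / ((k : ℝ) + 2) ^ ((4 : ℝ) / 13)

def ρ (k : ℕ) : ℝ := p.L / ((k : ℝ) + 1) ^ ((2 : ℝ) / 13)

def γ (k : ℕ) : ℝ := p.a₅ / ((k : ℝ) + 2) ^ ((12 : ℝ) / 13)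

def θ (k : ℕ) : ℝ := p.a₆ / ((k : ℝ) + 2) ^ ((8 : ℝ) / 13)

def D1 (k : ℕ) : ℝ := p.a₁ * ((k : ℝ) + 2) ^ ((3 : ℝ) / 13)

def D2 (k : ℕ) : ℝ := p.a₂ * ((k : ℝ) + 2) ^ ((3 : ℝ) / 13)

/-- The admissible choices of the parameters. -/
structure Valid : Prop where
  l_pos : 0 < p.l
  L_eq : p.L = p.l + p.ρ 1
  δ_pos : 0 < p.δ
  b_pos : 0 < p.b
  β_pos : 0 < p.β
  β_le : p.β ≤ 1 / (6 * p.L)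
  a₄_pos : 0 < p.a₄
  a₄_le : p.a₄ ≤ min (1 / (8 * p.L)) (p.β / (8 * √5))
  a₁_pos : 0 < p.a₁
  a₁_le : p.a₁ ≤ min (p.b / (32 * p.a₄ * p.L ^ 2)) (p.b * p.a₄ / (2 * p.L * p.β))
  a₂_pos : 0 < p.a₂
  a₂_le : p.a₂ ≤ min (p.b / (32 * p.a₄ * p.L ^ 2)) (p.b * p.a₄ / (2 * p.L * p.β))
  a₅_ge : 4 * p.a₄ / p.a₁ + 12 / 13 ≤ p.a₅
  a₆_ge : 80 * p.a₄ / p.a₂ + 12 / 13 ≤ p.a₆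
  γ_le : ∀ k : ℕ, 1 ≤ k → p.γ k ≤ 1
  θ_le : ∀ k : ℕ, 1 ≤ k → p.θ k ≤ 1
  d₁_pos : 0 < p.d₁
  d₁_le : p.d₁ ≤ min (min (1 / 8) (p.L * p.β))
    (min (p.a₁ * p.a₅ / (4 * p.a₄)) (p.a₂ * p.a₆ / (4 * p.a₄)))

end Params

namespace MinimaxProblem

variable {dx dy : ℕ} {Ξ : Type*} [MeasurableSpace Ξ] (P : MinimaxProblem dx dy Ξ)

/-- `g(x,y) = 𝔼[G(x,y,ζ)]`. -/
def g (x : Vec dx) (y : Vec dy) : ℝ := ∫ ζ, P.G x y ζ ∂P.D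

/-- The sample function `G(·,·,ζ)`. -/
def sample (ζ : Ξ) (x : Vec dx) (y : Vec dy) : ℝ := P.G x y ζ

/-- The standing assumptions on the problem. -/
structure IsStandard : Prop where
  X_nonempty : P.X.Nonempty
  X_convex : Convex ℝ P.X
  X_compact : IsCompact P.X
  Y_nonempty : P.Y.Nonempty
  Y_convex : Convex ℝ P.Y
  Y_compact : IsCompact P.Y
  isProbability : IsProbabilityMeasure P.D
  /-- `G` is smooth with Lipschitz gradients (uniformly in `ζ`, with some constant `M`) near
  `X × Y`, and its expectation is defined there. -/
  smooth : ∃ (U : Set (Vec dx)) (V : Set (Vec dy)) (M : ℝ),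
    IsOpen U ∧ P.X ⊆ U ∧ IsOpen V ∧ P.Y ⊆ V ∧
    (∀ x ∈ U, ∀ y ∈ V, Measurable (P.G x y) ∧ Integrable (P.G x y) P.D) ∧
    (∀ ζ, ∀ x ∈ U, ∀ y ∈ V, DifferentiableAt ℝ (fun x' => P.G x' y ζ) x ∧
      DifferentiableAt ℝ (fun y' => P.G x y' ζ) y) ∧
    (∀ ζ, ∀ x₁ ∈ U, ∀ x₂ ∈ U, ∀ y ∈ V,
      ‖gradX (P.sample ζ) x₁ y - gradX (P.sample ζ) x₂ y‖ ≤ M * ‖x₁ - x₂‖) ∧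
    (∀ ζ, ∀ x ∈ U, ∀ y₁ ∈ V, ∀ y₂ ∈ V,
      ‖gradY (P.sample ζ) x y₁ - gradY (P.sample ζ) x y₂‖ ≤ M * ‖y₁ - y₂‖)
  concave : ∀ x ∈ P.X, ConcaveOn ℝ P.Y (P.g x)

/-- The stochastic gradients are `l`-Lipschitz on `X × Y`. -/
structure LipschitzGradients (l : ℝ) : Prop where
  xx : ∀ ζ, ∀ x₁ ∈ P.X, ∀ x₂ ∈ P.X, ∀ y ∈ P.Y,
    ‖gradX (P.sample ζ) x₁ y - gradX (P.sample ζ) x₂ y‖ ≤ l * ‖x₁ - x₂‖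
  xy : ∀ ζ, ∀ x ∈ P.X, ∀ y₁ ∈ P.Y, ∀ y₂ ∈ P.Y,
    ‖gradX (P.sample ζ) x y₁ - gradX (P.sample ζ) x y₂‖ ≤ l * ‖y₁ - y₂‖
  yy : ∀ ζ, ∀ x ∈ P.X, ∀ y₁ ∈ P.Y, ∀ y₂ ∈ P.Y,
    ‖gradY (P.sample ζ) x y₁ - gradY (P.sample ζ) x y₂‖ ≤ l * ‖y₁ - y₂‖
  yx : ∀ ζ, ∀ x₁ ∈ P.X, ∀ x₂ ∈ P.X, ∀ y ∈ P.Y,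
    ‖gradY (P.sample ζ) x₁ y - gradY (P.sample ζ) x₂ y‖ ≤ l * ‖x₁ - x₂‖

/-- The stochastic gradients have variance at most `δ²` on `X × Y`. -/
structure BoundedVariance (δ : ℝ) : Prop where
  x_integrable : ∀ x ∈ P.X, ∀ y ∈ P.Y,
    Integrable (fun ζ => ‖gradX (P.sample ζ) x y - gradX P.g x y‖ ^ 2) P.D
  x_le : ∀ x ∈ P.X, ∀ y ∈ P.Y,
    ∫ ζ, ‖gradX (P.sample ζ) x y - gradX P.g x y‖ ^ 2 ∂P.D ≤ δ ^ 2
  y_integrable : ∀ x ∈ P.X, ∀ y ∈ P.Y,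
    Integrable (fun ζ => ‖gradY (P.sample ζ) x y - gradY P.g x y‖ ^ 2) P.D
  y_le : ∀ x ∈ P.X, ∀ y ∈ P.Y,
    ∫ ζ, ‖gradY (P.sample ζ) x y - gradY P.g x y‖ ^ 2 ∂P.D ≤ δ ^ 2

/-- `σ_y = max {‖y‖ : y ∈ Y}`. -/
def σy : ℝ := sSup ((fun y => ‖y‖) '' P.Y)

/-- Mini-batch gradient in `x` of the regularized sample functions. -/
def batchGradX {b : ℕ} (ρ : ℝ) (I : Fin b → Ξ) (x : Vec dx) (y : Vec dy) : Vec dx :=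
  (1 / (b : ℝ)) • ∑ j, gradX (regularize ρ (P.sample (I j))) x y

/-- Mini-batch gradient in `y` of the regularized sample functions. -/
def batchGradY {b : ℕ} (ρ : ℝ) (I : Fin b → Ξ) (x : Vec dx) (y : Vec dy) : Vec dy :=
  (1 / (b : ℝ)) • ∑ j, gradY (regularize ρ (P.sample (I j))) x y

/-- The stationarity gap `∇𝒢^{α,β}(x,y)`, a vector of `ℝ^{dx} × ℝ^{dy}` with the Euclidean norm. -/
def gap (α β : ℝ) (x : Vec dx) (y : Vec dy) : WithLp 2 (Vec dx × Vec dy) :=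
  WithLp.toLp 2
    ((1 / α) • (x - proj P.X (x - α • gradX P.g x y)),
     (1 / β) • (y - proj P.Y (y + β • gradY P.g x y)))

/-- The regularized objective `g_k(x,y) = g(x,y) - (ρ_k/2)‖y‖²`. -/
def gk (p : Params) (k : ℕ) : Vec dx → Vec dy → ℝ := regularize (p.ρ k) P.g

/-- `Φ_k(x) = max_{y ∈ Y} g_k(x,y)`. -/
def Φ (p : Params) (k : ℕ) (x : Vec dx) : ℝ := sSup (P.gk p k x '' P.Y)

/-- `y_k^*(x) = argmax_{y ∈ Y} g_k(x,y)`. -/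
def ystar (p : Params) (k : ℕ) (x : Vec dx) : Vec dy :=
  Classical.epsilon fun y => y ∈ P.Y ∧ IsMaxOn (P.gk p k x) P.Y y

end MinimaxProblem

/-! ### The algorithm -/

variable {dx dy : ℕ} {Ξ Ω : Type*} [MeasurableSpace Ξ] [MeasurableSpace Ω]

/-- `ζ k j` are independent samples with law `D`; the mini-batch of iteration `k` is `(ζ k j)_j`. -/
structure IsSampling (P : MinimaxProblem dx dy Ξ) {b : ℕ} (μ : Measure Ω)
    (ζ : ℕ → Fin b → Ω → Ξ) : Prop where
  measurable : ∀ k j, Measurable (ζ k j)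
  law : ∀ k j, μ.map (ζ k j) = P.D
  indep : iIndepFun (fun q : ℕ × Fin b => ζ q.1 q.2) μ

/-- The sequences `x_k, y_k, v_k, w_k` (`k ≥ 1`) generated by FORMDA from the starting point
`(x₁, y₁)` and the samples `ζ`. The first estimators have no momentum term, as `γ₀ = θ₀ = 1`. -/
structure IsRun (P : MinimaxProblem dx dy Ξ) (p : Params) (ζ : ℕ → Fin p.b → Ω → Ξ)
    (x₁ : Vec dx) (y₁ : Vec dy) (x : ℕ → Ω → Vec dx) (y : ℕ → Ω → Vec dy)
    (v : ℕ → Ω → Vec dx) (w : ℕ → Ω → Vec dy) : Prop where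
  x_one : ∀ ω, x 1 ω = x₁
  y_one : ∀ ω, y 1 ω = y₁
  v_one : ∀ ω, v 1 ω = P.batchGradX (p.ρ 1) (fun j => ζ 1 j ω) (x 1 ω) (y 1 ω)
  w_one : ∀ ω, w 1 ω = P.batchGradY (p.ρ 1) (fun j => ζ 1 j ω) (x 1 ω) (y 1 ω)
  v_succ : ∀ k, 1 ≤ k → ∀ ω, v (k + 1) ω =
    P.batchGradX (p.ρ (k + 1)) (fun j => ζ (k + 1) j ω) (x (k + 1) ω) (y (k + 1) ω)
      + (1 - p.γ k) • (v k ω - P.batchGradX (p.ρ k) (fun j => ζ (k + 1) j ω) (x k ω) (y k ω))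
  w_succ : ∀ k, 1 ≤ k → ∀ ω, w (k + 1) ω =
    P.batchGradY (p.ρ (k + 1)) (fun j => ζ (k + 1) j ω) (x (k + 1) ω) (y (k + 1) ω)
      + (1 - p.θ k) • (w k ω - P.batchGradY (p.ρ k) (fun j => ζ (k + 1) j ω) (x k ω) (y k ω))
  x_succ : ∀ k, 1 ≤ k → ∀ ω,
    x (k + 1) ω = x k ω + p.η k • (proj P.X (x k ω - p.α k • v k ω) - x k ω)
  y_succ : ∀ k, 1 ≤ k → ∀ ω,
    y (k + 1) ω = y k ω + p.η k • (proj P.Y (y k ω + p.β • w k ω) - y k ω)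

/-- The iterations `k ≥ 1` at which the stationarity gap is at most `ε` in expectation. -/
def stationaryIterations (P : MinimaxProblem dx dy Ξ) (p : Params) (μ : Measure Ω)
    (x : ℕ → Ω → Vec dx) (y : ℕ → Ω → Vec dy) (ε : ℝ) : Set ℕ :=
  {k | 1 ≤ k ∧ Integrable (fun ω => ‖P.gap (p.α k) p.β (x k ω) (y k ω)‖) μ ∧
    ∫ ω, ‖P.gap (p.α k) p.β (x k ω) (y k ω)‖ ∂μ ≤ ε}

/-- The iteration complexity `T(ε)`: the first such iteration. -/
def T (P : MinimaxProblem dx dy Ξ) (p : Params) (μ : Measure Ω)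
    (x : ℕ → Ω → Vec dx) (y : ℕ → Ω → Vec dy) (ε : ℝ) : ℕ :=
  sInf (stationaryIterations P p μ x y ε)

/-! ### The potential function and the constants -/

/-- `F_{k+1}(ξ, υ)` as a functional of random vectors `ξ, υ`; here `v, w` are the gradient
estimators of the run. -/
def potentialF (P : MinimaxProblem dx dy Ξ) (p : Params) (μ : Measure Ω)
    (v : ℕ → Ω → Vec dx) (w : ℕ → Ω → Vec dy) (k : ℕ)
    (ξ : Ω → Vec dx) (υ : Ω → Vec dy) : ℝ :=
  (∫ ω, P.Φ p (k + 1) (ξ ω) ∂μ)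
    + p.D1 k * (∫ ω, ‖gradX (P.gk p (k + 1)) (ξ ω) (υ ω) - v (k + 1) ω‖ ^ 2 ∂μ)
    + 8 * p.α k * p.L ^ 2 / (p.β * p.ρ (k + 1))
        * (∫ ω, ‖υ ω - P.ystar p (k + 1) (ξ ω)‖ ^ 2 ∂μ)
    + p.D2 k * (∫ ω, ‖gradY (P.gk p (k + 1)) (ξ ω) (υ ω) - w (k + 1) ω‖ ^ 2 ∂μ)

/-- `S_{k+1}(ξ, υ)`. -/
def potentialS (P : MinimaxProblem dx dy Ξ) (p : Params) (μ : Measure Ω)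
    (v : ℕ → Ω → Vec dx) (w : ℕ → Ω → Vec dy) (k : ℕ)
    (ξ : Ω → Vec dx) (υ : Ω → Vec dy) : ℝ :=
  potentialF P p μ v w k ξ υ
    - 40 * p.α (k + 1) * p.L ^ 2 * (p.ρ (k + 1) - p.ρ (k + 2))
        / (p.η (k + 1) * p.β ^ 2 * p.ρ (k + 2) ^ 3)
        * (∫ ω, ‖P.ystar p (k + 1) (ξ ω)‖ ^ 2 ∂μ)
    + 4 * p.D2 (k + 1) * p.ρ (k + 1) ^ 2 * P.σy ^ 2 / p.b

/-- The lower bound of the potential: the infimum of `S_k(ξ, υ)` over `k ≥ 1` and over the random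
vectors `ξ` with values in `X` and `υ` with values in `Y`. -/
def Slow (P : MinimaxProblem dx dy Ξ) (p : Params) (μ : Measure Ω)
    (v : ℕ → Ω → Vec dx) (w : ℕ → Ω → Vec dy) : ℝ :=
  sInf {s | ∃ (k : ℕ) (ξ : Ω → Vec dx) (υ : Ω → Vec dy), Measurable ξ ∧ Measurable υ ∧
    (∀ ω, ξ ω ∈ P.X) ∧ (∀ ω, υ ω ∈ P.Y) ∧ s = potentialS P p μ v w k ξ υ}

/-- The constant `C₁`. -/
def C1 (P : MinimaxProblem dx dy Ξ) (p : Params) (μ : Measure Ω)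
    (x : ℕ → Ω → Vec dx) (y : ℕ → Ω → Vec dy) (v : ℕ → Ω → Vec dx) (w : ℕ → Ω → Vec dy) : ℝ :=
  potentialS P p μ v w 0 (x 1) (y 1) - Slow P p μ v w + p.ρ 1 / 2 * P.σy ^ 2
    + 40 * p.α 1 * p.L ^ 2 * p.ρ 1 / (p.η 1 * p.β ^ 2 * p.ρ 2 ^ 3) * P.σy ^ 2

/-- The constant `C₂`. -/
def C2 (P : MinimaxProblem dx dy Ξ) (p : Params) : ℝ :=
  2 * p.δ ^ 2 * (p.a₅ ^ 2 * p.a₁ + p.a₆ ^ 2 * p.a₂) / p.b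
    + 12 * p.a₂ * p.L ^ 2 * P.σy ^ 2 / (13 * p.b)

end Formda

end

open MeasureTheory ProbabilityTheory Filter Topology
open scoped RealInnerProductSpace

noncomputable section

namespace Formda

/-! ### Smooth and concave functions on convex sets. -/

section Convex

variable {E : Type*} [NormedAddCommGroup E] [InnerProductSpace ℝ E] [CompleteSpace E]

/-! The argument is a descent estimate for one Lyapunov function, `lyapunov`: the expected primal
value E Φ_k(x_k), plus weighted mean squared errors of `v`, of `w`, and of `y` as an approximation
of the inner maximizer.

The regularization makes g_k strongly concave in y with modulus ρ_k, and this gives three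
deterministic facts. A relaxed projected ascent step contracts towards the maximizer
(`norm_sq_ascent_sub_argmaxY_le`). The maximizer moves at most proportionally to the change of x and
to the decrease of ρ (`norm_argmaxY_sub_le`). The primal function has a quadratic upper model, hence
decreases along the x-step up to the errors of `v` and `y` (`maxY_descent_le`). On the stochastic
side, a fresh mini-batch is independent of everything it is evaluated at, so the noise adds in
variance. The momentum correction leaves only γ times the old noise plus a Lipschitz difference,
which the step lengths control (`integral_norm_sq_estimator_le`).

Combined with the right weights, these show that one iteration lowers the Lyapunov function by d₁
η_k α_k `gapBound`, up to terms that telescope in ρ_k and a noise term of order 1/k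
(`lyapunov_succ_le`). All step sizes are monomials in consecutive thirteenth roots u ≤ τ, so the
conditions on the weights become polynomial inequalities (`ConsecutiveRoots`). Summation bounds the
weighted sum of `gapBound` by `C1` + `C2` log, and even leaves over 25 a₄ σ_y²/β²
(`sum_gapBound_le`).

The expected gap at iteration k is at most √`gapBound` + ρ_k σ_y. While no iterate is ε-stationary,
`gapBound` exceeds ε²/2 as soon as ρ_k σ_y ≤ ε/4. The iterations before that contribute at most 52
L² σ_y² to the deficit (`sum_weights_mul_sub_le`), and the amount left over pays for them. So the
displayed inequality already holds with T̃(ε) = T(ε), and the maximum with (2Lσ_y/ε)^{13/2} - 1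
costs nothing. The weights η_k α_k = a₄ (k+2)^{-9/13} have sums of order k^{4/13}, which beat the
logarithm: T(ε) is finite, and solving the inequality for T gives the rate (`exists_rate_constant`).
-/

theorem hasDerivAt_along_segment {f : E → ℝ} {g x d : E} {t : ℝ}
    (h : HasGradientAt f g (x + t • d)) :
    HasDerivAt (fun s : ℝ => f (x + s • d)) ⟪g, d⟫ t := by
  have h1 : HasDerivAt (fun s : ℝ => x + s • d) d t := by
    simpa using ((hasDerivAt_id t).smul_const d).const_add x
  have h2 : HasDerivAt (fun s : ℝ => f (x + s • d)) (InnerProductSpace.toDual ℝ E g d) t :=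
    h.hasFDerivAt.comp_hasDerivAt t h1
  rwa [InnerProductSpace.toDual_apply_apply] at h2

/-- Along the segment, `f` minus its claimed quadratic model has nonpositive derivative, by
Cauchy–Schwarz and the Lipschitz bound; compare the endpoints. -/
theorem le_quadratic_of_lipschitz_gradient {S : Set E} (hS : Convex ℝ S) {f : E → ℝ} {f' : E → E}
    {l : ℝ} (hf : ∀ z ∈ S, HasGradientAt f (f' z) z)
    (hl : ∀ z ∈ S, ∀ z' ∈ S, ‖f' z - f' z'‖ ≤ l * ‖z - z'‖) {x y : E} (hx : x ∈ S) (hy : y ∈ S) :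
    f y ≤ f x + ⟪f' x, y - x⟫ + l / 2 * ‖y - x‖ ^ 2 := by
  have hmem : ∀ t ∈ Set.Icc (0 : ℝ) 1, x + t • (y - x) ∈ S := fun t ht =>
    hS.add_smul_sub_mem hx hy ht
  set h : ℝ → ℝ := fun t => f (x + t • (y - x)) - t * ⟪f' x, y - x⟫ - l / 2 * t ^ 2 * ‖y - x‖ ^ 2
    with hh
  have hd : ∀ t ∈ Set.Icc (0 : ℝ) 1, HasDerivAt h
      (⟪f' (x + t • (y - x)), y - x⟫ - ⟪f' x, y - x⟫ - l * t * ‖y - x‖ ^ 2) t := by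
    intro t ht
    have h1 := hasDerivAt_along_segment (hf _ (hmem t ht))
    have h2 : HasDerivAt (fun s : ℝ => s * ⟪f' x, y - x⟫) ⟪f' x, y - x⟫ t := by
      simpa using (hasDerivAt_id t).mul_const ⟪f' x, y - x⟫
    have h3 : HasDerivAt (fun s : ℝ => l / 2 * s ^ 2 * ‖y - x‖ ^ 2) (l * t * ‖y - x‖ ^ 2) t := by
      have := (((hasDerivAt_id t).pow 2).const_mul (l / 2)).mul_const (‖y - x‖ ^ 2)
      refine this.congr_deriv ?_
      simp only [id, Nat.cast_ofNat, Nat.add_one_sub_one, pow_one, mul_one]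
      ring
    exact (h1.sub h2).sub h3
  have hanti : AntitoneOn h (Set.Icc 0 1) := by
    apply antitoneOn_of_deriv_nonpos (convex_Icc 0 1)
    · exact fun t ht => (hd t ht).continuousAt.continuousWithinAt
    · intro t ht
      rw [interior_Icc] at ht
      exact (hd t (Set.Ioo_subset_Icc_self ht)).differentiableAt.differentiableWithinAt
    · intro t ht
      rw [interior_Icc] at ht
      have ht' := Set.Ioo_subset_Icc_self ht
      rw [(hd t ht').deriv, ← inner_sub_left]
      have h1 := real_inner_le_norm (f' (x + t • (y - x)) - f' x) (y - x)
      have h2 := hl _ (hmem t ht') _ hx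
      rw [add_sub_cancel_left, norm_smul, Real.norm_of_nonneg ht'.1] at h2
      nlinarith [mul_le_mul_of_nonneg_right h2 (norm_nonneg (y - x))]
  have := hanti (by simp) (by simp) (zero_le_one (α := ℝ))
  simp only [hh, one_smul, zero_smul, add_zero, add_sub_cancel] at this
  linarith

theorem quadratic_le_of_lipschitz_gradient {S : Set E} (hS : Convex ℝ S) {f : E → ℝ} {f' : E → E}
    {l : ℝ} (hf : ∀ z ∈ S, HasGradientAt f (f' z) z)
    (hl : ∀ z ∈ S, ∀ z' ∈ S, ‖f' z - f' z'‖ ≤ l * ‖z - z'‖) {x y : E} (hx : x ∈ S) (hy : y ∈ S) :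
    f x + ⟪f' x, y - x⟫ - l / 2 * ‖y - x‖ ^ 2 ≤ f y := by
  have := le_quadratic_of_lipschitz_gradient (f := fun z => - f z) (f' := fun z => - f' z) hS
    (fun z hz => by
      rw [hasGradientAt_iff_hasFDerivAt, map_neg]
      exact (hf z hz).hasFDerivAt.neg) (l := l)
    (fun z hz z' hz' => by
      rw [← neg_sub', norm_neg]; exact hl z hz z' hz') hx hy
  simp only [inner_neg_left] at this
  linarith

/-- Concavity is known on `S` only, but the difference quotients from `x` towards `y` stay in `S`
and dominate `f y - f x`; let the step tend to zero from the right. -/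
theorem _root_.ConcaveOn.le_add_inner_gradient {S : Set E} {f : E → ℝ} (hf : ConcaveOn ℝ S f)
    {g x y : E} (hx : x ∈ S) (hy : y ∈ S) (hg : HasGradientAt f g x) :
    f y ≤ f x + ⟪g, y - x⟫ := by
  have h1 : HasDerivAt (fun s : ℝ => f (x + s • (y - x))) ⟪g, y - x⟫ 0 :=
    hasDerivAt_along_segment (by simpa using hg)
  have h2 := h1.tendsto_slope_zero_right
  have h3 : ∀ᶠ t : ℝ in 𝓝[>] 0, f y - f x ≤
      t⁻¹ • (f (x + (0 + t) • (y - x)) - f (x + (0 : ℝ) • (y - x))) := by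
    filter_upwards [Ioo_mem_nhdsGT (zero_lt_one (α := ℝ))] with t ht
    have h4 := hf.2 hx hy (sub_nonneg.2 ht.2.le) ht.1.le (by ring)
    have h5 : (1 - t) • x + t • y = x + t • (y - x) := by
      rw [sub_smul, smul_sub, one_smul]; abel
    rw [h5] at h4
    simp only [smul_eq_mul, zero_add, zero_smul, add_zero] at h4 ⊢
    rw [inv_mul_eq_div, le_div_iff₀ ht.1]
    linarith
  have := ge_of_tendsto h2 h3
  linarith

end Convex

/-! ### Euclidean projection onto a closed convex set. -/

section Projection

variable {d : ℕ} {K : Set (Vec d)}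

theorem proj_spec (hne : K.Nonempty) (hc : IsClosed K) (x : Vec d) :
    proj K x ∈ K ∧ ∀ u ∈ K, ‖x - proj K x‖ ≤ ‖x - u‖ := by
  have : ∃ z, z ∈ K ∧ ∀ u ∈ K, ‖x - z‖ ≤ ‖x - u‖ := by
    obtain ⟨z, hz, h⟩ := hc.exists_infDist_eq_dist hne x
    refine ⟨z, hz, fun u hu => ?_⟩
    rw [← dist_eq_norm, ← dist_eq_norm, ← h]
    exact Metric.infDist_le_dist_of_mem hu
  exact Classical.epsilon_spec this

theorem inner_sub_proj_nonpos (hne : K.Nonempty) (hc : IsClosed K) (hK : Convex ℝ K) (x : Vec d)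
    {u : Vec d} (hu : u ∈ K) : ⟪x - proj K x, u - proj K x⟫ ≤ 0 := by
  obtain ⟨h1, h2⟩ := proj_spec hne hc x
  refine (norm_eq_iInf_iff_real_inner_le_zero hK h1).1 ?_ u hu
  have : Nonempty K := ⟨⟨_, h1⟩⟩
  refine le_antisymm (le_ciInf fun w => h2 w w.2) ?_
  exact ciInf_le ⟨0, by rintro _ ⟨w, rfl⟩; exact norm_nonneg _⟩ (⟨_, h1⟩ : K)

/-- Adding the variational inequalities of the two projections gives ‖p - q‖² ≤ ⟪x - y, p - q⟫. -/
theorem norm_proj_sub_proj_le (hne : K.Nonempty) (hc : IsClosed K) (hK : Convex ℝ K)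
    (x y : Vec d) : ‖proj K x - proj K y‖ ≤ ‖x - y‖ := by
  have h1 := inner_sub_proj_nonpos hne hc hK x (proj_spec hne hc y).1
  have h2 := inner_sub_proj_nonpos hne hc hK y (proj_spec hne hc x).1
  set p := proj K x
  set q := proj K y
  have h3 : ⟪x - y, p - q⟫ = ‖p - q‖ ^ 2 - ⟪x - p, q - p⟫ - ⟪y - q, p - q⟫ := by
    have e : x - y = (p - q) + (x - p) - (y - q) := by abel
    have e' : q - p = - (p - q) := by abel
    rw [e, inner_sub_left, inner_add_left, e', inner_neg_right, real_inner_self_eq_norm_sq]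
    ring
  have h4 := real_inner_le_norm (x - y) (p - q)
  by_contra! h
  nlinarith [norm_nonneg (x - y), norm_nonneg (p - q)]

theorem continuous_proj (hne : K.Nonempty) (hc : IsClosed K) (hK : Convex ℝ K) :
    Continuous (proj K) :=
  (LipschitzWith.of_dist_le_mul (K := 1) fun x y => by
    simpa [dist_eq_norm] using norm_proj_sub_proj_le hne hc hK x y).continuous

end Projection

/-! ### Gradients under the expectation. -/

section ParametricGradient

variable {d : ℕ} {Ξ : Type*} {F : Vec d → Ξ → ℝ} {U : Set (Vec d)} {M : ℝ}

theorem abs_sub_sub_inner_le_of_ball {x : Vec d} {r : ℝ} (hr : Metric.ball x r ⊆ U)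
    (hd : ∀ ζ, ∀ x ∈ U, DifferentiableAt ℝ (fun x' => F x' ζ) x)
    (hl : ∀ ζ, ∀ x₁ ∈ U, ∀ x₂ ∈ U, ‖gradient (fun x' => F x' ζ) x₁ -
      gradient (fun x' => F x' ζ) x₂‖ ≤ M * ‖x₁ - x₂‖) {z : Vec d} (hz : z ∈ Metric.ball x r)
    (ζ : Ξ) :
    |F z ζ - F x ζ - ⟪gradient (fun x' => F x' ζ) x, z - x⟫| ≤ M / 2 * ‖z - x‖ ^ 2 := by
  have hx : x ∈ Metric.ball x r := Metric.mem_ball_self (Metric.pos_of_mem_ball hz)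
  have h1 := le_quadratic_of_lipschitz_gradient (convex_ball x r)
    (fun z hz => (hd ζ z (hr hz)).hasGradientAt)
    (fun z hz z' hz' => hl ζ z (hr hz) z' (hr hz')) hx hz
  have h2 := quadratic_le_of_lipschitz_gradient (convex_ball x r)
    (fun z hz => (hd ζ z (hr hz)).hasGradientAt)
    (fun z hz z' hz' => hl ζ z (hr hz) z' (hr hz')) hx hz
  rw [abs_le]
  constructor <;> linarith

variable [MeasurableSpace Ξ] {D : Measure Ξ}

theorem euclidean_sum_inner (v : Vec d) :
    v = ∑ i, ⟪EuclideanSpace.basisFun (Fin d) ℝ i, v⟫ • EuclideanSpace.basisFun (Fin d) ℝ i := by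
  conv_lhs => rw [← (EuclideanSpace.basisFun (Fin d) ℝ).sum_repr v]
  simp only [OrthonormalBasis.repr_apply_apply]

/-- Each component of the gradient is a pointwise limit of difference quotients, which are
measurable in the sample. -/
theorem measurable_gradient_apply (hU : IsOpen U) {x : Vec d} (hx : x ∈ U)
    (hm : ∀ x ∈ U, Measurable (F x))
    (hd : ∀ ζ, ∀ x ∈ U, DifferentiableAt ℝ (fun x' => F x' ζ) x) :
    Measurable fun ζ => gradient (fun x' => F x' ζ) x := by
  have key : ∀ e : Vec d, Measurable fun ζ => ⟪e, gradient (fun x' => F x' ζ) x⟫ := by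
    intro e
    have h0 : Tendsto (fun t : ℝ => x + t • e) (𝓝[>] 0) (𝓝 x) := by
      have : Continuous fun t : ℝ => x + t • e := by fun_prop
      simpa using (this.tendsto 0).mono_left nhdsWithin_le_nhds
    have h1 : Tendsto (fun n : ℕ => ((n : ℝ) + 1)⁻¹) atTop (𝓝[>] 0) := by
      refine tendsto_nhdsWithin_iff.2 ⟨?_, Eventually.of_forall fun n => ?_⟩
      · simpa using tendsto_one_div_add_atTop_nhds_zero_nat (𝕜 := ℝ)
      · exact Set.mem_Ioi.2 (by positivity)
    -- `F` is measurable only at points of `U`, so the sequence is shifted until all its points lie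
    -- there.
    obtain ⟨N, hN⟩ := eventually_atTop.1
      ((h0.comp h1).eventually (hU.mem_nhds hx))
    have h2 : Tendsto (fun n : ℕ => n + N) atTop atTop := tendsto_add_atTop_nat N
    refine measurable_of_tendsto_metrizable (f := fun (n : ℕ) ζ =>
      (((n + N : ℕ) : ℝ) + 1)⁻¹⁻¹ * (F (x + (((n + N : ℕ) : ℝ) + 1)⁻¹ • e) ζ - F x ζ)) ?_ ?_
    · intro n
      exact ((hm _ (hN (n + N) (by omega))).sub (hm _ hx)).const_mul _
    · rw [tendsto_pi_nhds]
      intro ζ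
      have h3 := (hasDerivAt_along_segment (d := e) (t := 0) (x := x)
        (by simpa using (hd ζ x hx).hasGradientAt)).tendsto_slope_zero_right
      have h4 := (h3.comp h1).comp h2
      rw [real_inner_comm]
      simpa [Function.comp_def] using h4
  have : (fun ζ => gradient (fun x' => F x' ζ) x) = fun ζ => ∑ i,
      ⟪EuclideanSpace.basisFun (Fin d) ℝ i, gradient (fun x' => F x' ζ) x⟫ •
        EuclideanSpace.basisFun (Fin d) ℝ i := by
    funext ζ
    exact euclidean_sum_inner _
  rw [this]
  exact Finset.measurable_sum _ fun i _ => (key _).smul_const _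

/-- In a unit direction `e`, the quadratic bound at distance r/2 controls ⟪e, ∇F⟫ by two values of
`F` and a constant, all integrable. -/
theorem integrable_gradient_apply [IsProbabilityMeasure D] (hU : IsOpen U) {x : Vec d} (hx : x ∈ U)
    (hm : ∀ x ∈ U, Measurable (F x)) (hi : ∀ x ∈ U, Integrable (F x) D)
    (hd : ∀ ζ, ∀ x ∈ U, DifferentiableAt ℝ (fun x' => F x' ζ) x)
    (hl : ∀ ζ, ∀ x₁ ∈ U, ∀ x₂ ∈ U, ‖gradient (fun x' => F x' ζ) x₁ -
      gradient (fun x' => F x' ζ) x₂‖ ≤ M * ‖x₁ - x₂‖) :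
    Integrable (fun ζ => gradient (fun x' => F x' ζ) x) D := by
  have hmeas := measurable_gradient_apply hU hx hm hd
  obtain ⟨r, hr0, hr⟩ := Metric.isOpen_iff.1 hU x hx
  have key : ∀ e : Vec d, ‖e‖ = 1 →
      Integrable (fun ζ => ⟪e, gradient (fun x' => F x' ζ) x⟫) D := by
    intro e he
    have hz : x + (r / 2) • e ∈ Metric.ball x r := by
      rw [Metric.mem_ball, dist_eq_norm, add_sub_cancel_left, norm_smul, he, mul_one,
        Real.norm_of_nonneg (by positivity)]
      linarith
    refine Integrable.mono' (g := fun ζ => 2 / r * (|F (x + (r / 2) • e) ζ| + |F x ζ|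
      + M / 2 * (r / 2) ^ 2)) ?_ (measurable_const.inner hmeas).aestronglyMeasurable ?_
    · exact (((hi _ (hr hz)).abs.add (hi _ hx).abs).add (integrable_const _)).const_mul _
    · refine Eventually.of_forall fun ζ => ?_
      have h1 := abs_sub_sub_inner_le_of_ball hr hd hl hz ζ
      rw [add_sub_cancel_left, norm_smul, he, mul_one, Real.norm_of_nonneg (by positivity),
        inner_smul_right, real_inner_comm] at h1
      set I := ⟪e, gradient (fun x' => F x' ζ) x⟫
      have h2 : |r / 2 * I| ≤ |F (x + (r / 2) • e) ζ| + |F x ζ| + M / 2 * (r / 2) ^ 2 := by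
        have := abs_sub_abs_le_abs_sub (r / 2 * I) (F (x + (r / 2) • e) ζ - F x ζ)
        rw [abs_sub_comm (r / 2 * I) (F (x + (r / 2) • e) ζ - F x ζ)] at this
        have := abs_sub (F (x + (r / 2) • e) ζ) (F x ζ)
        linarith
      rw [abs_mul, abs_of_pos (by positivity)] at h2
      rw [Real.norm_eq_abs, div_mul_eq_mul_div, le_div_iff₀ hr0]
      linarith
  have : (fun ζ => gradient (fun x' => F x' ζ) x) = fun ζ => ∑ i,
      ⟪EuclideanSpace.basisFun (Fin d) ℝ i, gradient (fun x' => F x' ζ) x⟫ •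
        EuclideanSpace.basisFun (Fin d) ℝ i := by
    funext ζ
    exact euclidean_sum_inner _
  rw [this]
  exact integrable_finsetSum _ fun i _ => (key _ (by simp)).smul_const _

/-- Differentiation under the integral by domination: near `x` the increments of `F` are bounded by
(‖∇F(x, ζ)‖ + |M| r / 2) ‖z - x‖, and this factor is integrable. -/
theorem hasGradientAt_integral [IsProbabilityMeasure D] (hU : IsOpen U) {x : Vec d} (hx : x ∈ U)
    (hm : ∀ x ∈ U, Measurable (F x)) (hi : ∀ x ∈ U, Integrable (F x) D)
    (hd : ∀ ζ, ∀ x ∈ U, DifferentiableAt ℝ (fun x' => F x' ζ) x)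
    (hl : ∀ ζ, ∀ x₁ ∈ U, ∀ x₂ ∈ U, ‖gradient (fun x' => F x' ζ) x₁ -
      gradient (fun x' => F x' ζ) x₂‖ ≤ M * ‖x₁ - x₂‖) :
    HasGradientAt (fun z => ∫ ζ, F z ζ ∂D) (∫ ζ, gradient (fun x' => F x' ζ) x ∂D) x := by
  have hint := integrable_gradient_apply hU hx hm hi hd hl
  obtain ⟨r, hr0, hr⟩ := Metric.isOpen_iff.1 hU x hx
  have h := hasFDerivAt_integral_of_dominated_loc_of_lip' (F := F) (μ := D)
    (F' := fun ζ => InnerProductSpace.toDual ℝ (Vec d) (gradient (fun x' => F x' ζ) x))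
    (bound := fun ζ => ‖gradient (fun x' => F x' ζ) x‖ + |M| / 2 * r)
    (Metric.ball_mem_nhds x hr0) (fun z hz => (hm z (hr hz)).aestronglyMeasurable) (hi x hx)
    ((InnerProductSpace.toDual ℝ (Vec d)).continuous.comp_aestronglyMeasurable hint.1)
    (Eventually.of_forall fun ζ z hz => ?_) (hint.norm.add (integrable_const _))
    (Eventually.of_forall fun ζ => (hd ζ x hx).hasGradientAt.hasFDerivAt)
  · rw [hasGradientAt_iff_hasFDerivAt]
    have h2 := h.2
    have h3 := (InnerProductSpace.toDual ℝ (Vec d)).toContinuousLinearEquiv.integral_comp_comm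
      (μ := D) (fun ζ => gradient (fun x' => F x' ζ) x)
    simp only [LinearIsometryEquiv.coe_toContinuousLinearEquiv] at h3
    rwa [h3] at h2
  · have h1 := abs_sub_sub_inner_le_of_ball hr hd hl hz ζ
    have h2 := abs_real_inner_le_norm (gradient (fun x' => F x' ζ) x) (z - x)
    have h3 := abs_sub_abs_le_abs_sub (F z ζ - F x ζ) ⟪gradient (fun x' => F x' ζ) x, z - x⟫
    rw [Metric.mem_ball, dist_eq_norm] at hz
    have h4 : M / 2 * ‖z - x‖ ^ 2 ≤ |M| / 2 * r * ‖z - x‖ := by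
      have h5 : M / 2 * ‖z - x‖ ^ 2 ≤ |M| / 2 * ‖z - x‖ ^ 2 := by
        gcongr
        exact le_abs_self M
      nlinarith [mul_nonneg (mul_nonneg (abs_nonneg M) (norm_nonneg (z - x)))
        (sub_nonneg.2 hz.le)]
    rw [Real.norm_eq_abs, add_mul]
    linarith

end ParametricGradient

/-! ### The regularized functions, the expected objective and its gradient oracles. -/

section Regularize

variable {dx dy : ℕ}

theorem gradX_regularize (ρ : ℝ) (f : Vec dx → Vec dy → ℝ) (x : Vec dx) (y : Vec dy) :
    gradX (regularize ρ f) x y = gradX f x y := by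
  simp only [gradX, regularize, gradient, fderiv_sub_const]

theorem hasGradientAt_regularize {ρ : ℝ} {f : Vec dx → Vec dy → ℝ} {x : Vec dx} {y g : Vec dy}
    (h : HasGradientAt (fun y' => f x y') g y) :
    HasGradientAt (regularize ρ f x) (g - ρ • y) y := by
  rw [hasGradientAt_iff_hasFDerivAt] at h ⊢
  have h1 : HasFDerivAt (fun y' : Vec dy => ρ / 2 * ‖y'‖ ^ 2)
      ((ρ / 2) • (2 • (innerSL ℝ y))) y := by
    simpa using ((hasStrictFDerivAt_norm_sq y).hasFDerivAt).const_mul (ρ / 2)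
  refine (h.sub h1).congr_fderiv ?_
  ext u
  simp
  ring

theorem gradY_regularize {ρ : ℝ} {f : Vec dx → Vec dy → ℝ} {x : Vec dx} {y : Vec dy}
    (h : DifferentiableAt ℝ (fun y' => f x y') y) :
    gradY (regularize ρ f) x y = gradY f x y - ρ • y :=
  (hasGradientAt_regularize h.hasGradientAt).gradient

end Regularize

namespace MinimaxProblem

variable {dx dy : ℕ} {Ξ : Type*} [MeasurableSpace Ξ]

/-- The regularity of the objective `g` that is used by the analysis. -/
structure IsRegular (P : MinimaxProblem dx dy Ξ) (l : ℝ) : Prop where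
  l_nonneg : 0 ≤ l
  X_nonempty : P.X.Nonempty
  X_convex : Convex ℝ P.X
  X_compact : IsCompact P.X
  Y_nonempty : P.Y.Nonempty
  Y_convex : Convex ℝ P.Y
  Y_compact : IsCompact P.Y
  concave : ∀ x ∈ P.X, ConcaveOn ℝ P.Y (P.g x)
  hasGradX : ∀ x ∈ P.X, ∀ y ∈ P.Y, HasGradientAt (fun x' => P.g x' y) (gradX P.g x y) x
  hasGradY : ∀ x ∈ P.X, ∀ y ∈ P.Y, HasGradientAt (fun y' => P.g x y') (gradY P.g x y) y
  lipX : ∀ x₁ ∈ P.X, ∀ x₂ ∈ P.X, ∀ y₁ ∈ P.Y, ∀ y₂ ∈ P.Y,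
    ‖gradX P.g x₁ y₁ - gradX P.g x₂ y₂‖ ≤ l * (‖x₁ - x₂‖ + ‖y₁ - y₂‖)
  lipY : ∀ x₁ ∈ P.X, ∀ x₂ ∈ P.X, ∀ y₁ ∈ P.Y, ∀ y₂ ∈ P.Y,
    ‖gradY P.g x₁ y₁ - gradY P.g x₂ y₂‖ ≤ l * (‖x₁ - x₂‖ + ‖y₁ - y₂‖)

/-- An oracle `H` on `X × Y`: measurable and integrable in the sample, jointly `l`-Lipschitz in the
point, with mean `h`. -/
structure IsOracle (P : MinimaxProblem dx dy Ξ) {d : ℕ} (l δ : ℝ) (H : Ξ → Vec dx → Vec dy → Vec d)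
    (h : Vec dx → Vec dy → Vec d) : Prop where
  meas : ∀ x ∈ P.X, ∀ y ∈ P.Y, Measurable fun ζ => H ζ x y
  integrable : ∀ x ∈ P.X, ∀ y ∈ P.Y, Integrable (fun ζ => H ζ x y) P.D
  lip : ∀ ζ, ∀ x₁ ∈ P.X, ∀ x₂ ∈ P.X, ∀ y₁ ∈ P.Y, ∀ y₂ ∈ P.Y,
    ‖H ζ x₁ y₁ - H ζ x₂ y₂‖ ≤ l * (‖x₁ - x₂‖ + ‖y₁ - y₂‖)
  mean : ∀ x ∈ P.X, ∀ y ∈ P.Y, ∫ ζ, H ζ x y ∂P.D = h x y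
  sq_integrable : ∀ x ∈ P.X, ∀ y ∈ P.Y, Integrable (fun ζ => ‖H ζ x y - h x y‖ ^ 2) P.D
  variance_le : ∀ x ∈ P.X, ∀ y ∈ P.Y, ∫ ζ, ‖H ζ x y - h x y‖ ^ 2 ∂P.D ≤ δ ^ 2

theorem IsOracle.mean_lip {P : MinimaxProblem dx dy Ξ} [IsProbabilityMeasure P.D] {d : ℕ} {l δ : ℝ}
    {H : Ξ → Vec dx → Vec dy → Vec d} {h : Vec dx → Vec dy → Vec d} (hH : P.IsOracle l δ H h)
    {x₁ x₂ : Vec dx} (hx₁ : x₁ ∈ P.X) (hx₂ : x₂ ∈ P.X) {y₁ y₂ : Vec dy} (hy₁ : y₁ ∈ P.Y)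
    (hy₂ : y₂ ∈ P.Y) : ‖h x₁ y₁ - h x₂ y₂‖ ≤ l * (‖x₁ - x₂‖ + ‖y₁ - y₂‖) := by
  rw [← hH.mean _ hx₁ _ hy₁, ← hH.mean _ hx₂ _ hy₂,
    ← integral_sub (hH.integrable _ hx₁ _ hy₁) (hH.integrable _ hx₂ _ hy₂)]
  have := norm_integral_le_of_norm_le_const (μ := P.D)
    (Eventually.of_forall fun ζ => hH.lip ζ _ hx₁ _ hx₂ _ hy₁ _ hy₂)
  simpa using this

variable {P : MinimaxProblem dx dy Ξ} {l δ : ℝ}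

theorem sample_differentiableAt_right (hP : P.IsStandard) (ζ : Ξ) {x : Vec dx} (hx : x ∈ P.X)
    {y : Vec dy} (hy : y ∈ P.Y) : DifferentiableAt ℝ (fun y' => P.sample ζ x y') y := by
  obtain ⟨U, V, M, hU, hXU, hV, hYV, hm, hd, hlx, hly⟩ := hP.smooth
  exact (hd ζ x (hXU hx) y (hYV hy)).2

theorem isOracle_gradX (hP : P.IsStandard) (hl : P.LipschitzGradients l)
    (hv : P.BoundedVariance δ) :
    P.IsOracle l δ (fun ζ => gradX (P.sample ζ)) (gradX P.g) ∧
    ∀ x ∈ P.X, ∀ y ∈ P.Y, HasGradientAt (fun x' => P.g x' y) (gradX P.g x y) x := by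
  have := hP.isProbability
  obtain ⟨U, V, M, hU, hXU, hV, hYV, hm, hd, hlx, hly⟩ := hP.smooth
  have hg : ∀ x ∈ P.X, ∀ y ∈ P.Y, HasGradientAt (fun x' => P.g x' y)
      (∫ ζ, gradX (P.sample ζ) x y ∂P.D) x := fun x hx y hy =>
    hasGradientAt_integral (F := fun x' ζ => P.G x' y ζ) hU (hXU hx)
      (fun x hx => (hm x hx y (hYV hy)).1) (fun x hx => (hm x hx y (hYV hy)).2)
      (fun ζ x hx => (hd ζ x hx y (hYV hy)).1)
      (fun ζ x₁ hx₁ x₂ hx₂ => hlx ζ x₁ hx₁ x₂ hx₂ y (hYV hy))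
  have he : ∀ x ∈ P.X, ∀ y ∈ P.Y, ∫ ζ, gradX (P.sample ζ) x y ∂P.D = gradX P.g x y :=
    fun x hx y hy => (hg x hx y hy).gradient.symm
  refine ⟨⟨fun x hx y hy => ?_, fun x hx y hy => ?_, ?_, he, hv.x_integrable, hv.x_le⟩,
    fun x hx y hy => he x hx y hy ▸ hg x hx y hy⟩
  · exact measurable_gradient_apply (F := fun x' ζ => P.G x' y ζ) hU (hXU hx)
      (fun x hx => (hm x hx y (hYV hy)).1) (fun ζ x hx => (hd ζ x hx y (hYV hy)).1)
  · exact integrable_gradient_apply (F := fun x' ζ => P.G x' y ζ) hU (hXU hx)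
      (fun x hx => (hm x hx y (hYV hy)).1) (fun x hx => (hm x hx y (hYV hy)).2)
      (fun ζ x hx => (hd ζ x hx y (hYV hy)).1)
      (fun ζ x₁ hx₁ x₂ hx₂ => hlx ζ x₁ hx₁ x₂ hx₂ y (hYV hy))
  · intro ζ x₁ hx₁ x₂ hx₂ y₁ hy₁ y₂ hy₂
    have h1 := hl.xx ζ x₁ hx₁ x₂ hx₂ y₁ hy₁
    have h2 := hl.xy ζ x₂ hx₂ y₁ hy₁ y₂ hy₂
    calc _ ≤ _ := norm_sub_le_norm_sub_add_norm_sub _ (gradX (P.sample ζ) x₂ y₁) _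
      _ ≤ _ := by linarith

theorem isOracle_gradY (hP : P.IsStandard) (hl : P.LipschitzGradients l)
    (hv : P.BoundedVariance δ) :
    P.IsOracle l δ (fun ζ => gradY (P.sample ζ)) (gradY P.g) ∧
    ∀ x ∈ P.X, ∀ y ∈ P.Y, HasGradientAt (fun y' => P.g x y') (gradY P.g x y) y := by
  have := hP.isProbability
  obtain ⟨U, V, M, hU, hXU, hV, hYV, hm, hd, hlx, hly⟩ := hP.smooth
  have hg : ∀ x ∈ P.X, ∀ y ∈ P.Y, HasGradientAt (fun y' => P.g x y')
      (∫ ζ, gradY (P.sample ζ) x y ∂P.D) y := fun x hx y hy =>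
    hasGradientAt_integral (F := fun y' ζ => P.G x y' ζ) hV (hYV hy)
      (fun y hy => (hm x (hXU hx) y hy).1) (fun y hy => (hm x (hXU hx) y hy).2)
      (fun ζ y hy => (hd ζ x (hXU hx) y hy).2)
      (fun ζ y₁ hy₁ y₂ hy₂ => hly ζ x (hXU hx) y₁ hy₁ y₂ hy₂)
  have he : ∀ x ∈ P.X, ∀ y ∈ P.Y, ∫ ζ, gradY (P.sample ζ) x y ∂P.D = gradY P.g x y :=
    fun x hx y hy => (hg x hx y hy).gradient.symm
  refine ⟨⟨fun x hx y hy => ?_, fun x hx y hy => ?_, ?_, he, hv.y_integrable, hv.y_le⟩,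
    fun x hx y hy => he x hx y hy ▸ hg x hx y hy⟩
  · exact measurable_gradient_apply (F := fun y' ζ => P.G x y' ζ) hV (hYV hy)
      (fun y hy => (hm x (hXU hx) y hy).1) (fun ζ y hy => (hd ζ x (hXU hx) y hy).2)
  · exact integrable_gradient_apply (F := fun y' ζ => P.G x y' ζ) hV (hYV hy)
      (fun y hy => (hm x (hXU hx) y hy).1) (fun y hy => (hm x (hXU hx) y hy).2)
      (fun ζ y hy => (hd ζ x (hXU hx) y hy).2)
      (fun ζ y₁ hy₁ y₂ hy₂ => hly ζ x (hXU hx) y₁ hy₁ y₂ hy₂)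
  · intro ζ x₁ hx₁ x₂ hx₂ y₁ hy₁ y₂ hy₂
    have h1 := hl.yx ζ x₁ hx₁ x₂ hx₂ y₁ hy₁
    have h2 := hl.yy ζ x₂ hx₂ y₁ hy₁ y₂ hy₂
    calc _ ≤ _ := norm_sub_le_norm_sub_add_norm_sub _ (gradY (P.sample ζ) x₂ y₁) _
      _ ≤ _ := by linarith

theorem isRegular (hl0 : 0 ≤ l) (hP : P.IsStandard) (hl : P.LipschitzGradients l)
    (hv : P.BoundedVariance δ) : P.IsRegular l := by
  have := hP.isProbability
  obtain ⟨hX, hgX⟩ := isOracle_gradX hP hl hv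
  obtain ⟨hY, hgY⟩ := isOracle_gradY hP hl hv
  exact ⟨hl0, hP.X_nonempty, hP.X_convex, hP.X_compact, hP.Y_nonempty, hP.Y_convex, hP.Y_compact,
    hP.concave, hgX, hgY,
    fun x₁ hx₁ x₂ hx₂ y₁ hy₁ y₂ hy₂ => hX.mean_lip hx₁ hx₂ hy₁ hy₂,
    fun x₁ hx₁ x₂ hx₂ y₁ hy₁ y₂ hy₂ => hY.mean_lip hx₁ hx₂ hy₁ hy₂⟩

end MinimaxProblem

theorem norm_le_σy {dx dy : ℕ} {Ξ : Type*} [MeasurableSpace Ξ] {P : MinimaxProblem dx dy Ξ}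
    (h : IsCompact P.Y) {y : Vec dy} (hy : y ∈ P.Y) : ‖y‖ ≤ P.σy :=
  le_csSup (h.image continuous_norm).bddAbove ⟨y, hy, rfl⟩

/-! ### The inner maximizer and the primal function. -/

namespace MinimaxProblem

variable {dx dy : ℕ} {Ξ : Type*} [MeasurableSpace Ξ] {P : MinimaxProblem dx dy Ξ} {l : ℝ}

/-- The maximizer over `Y` of the regularized objective. -/
def argmaxY (P : MinimaxProblem dx dy Ξ) (ρ : ℝ) (x : Vec dx) : Vec dy :=
  Classical.epsilon fun y => y ∈ P.Y ∧ IsMaxOn (regularize ρ P.g x) P.Y y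

/-- The maximum over `Y` of the regularized objective. -/
def maxY (P : MinimaxProblem dx dy Ξ) (ρ : ℝ) (x : Vec dx) : ℝ :=
  sSup (regularize ρ P.g x '' P.Y)

namespace IsRegular

section

variable (h : P.IsRegular l) {ρ ρ' : ℝ} {x x' : Vec dx} (hx : x ∈ P.X) (hx' : x' ∈ P.X)
include h hx

theorem hasGradientAt_regularize {y : Vec dy} (hy : y ∈ P.Y) :
    HasGradientAt (regularize ρ P.g x) (gradY P.g x y - ρ • y) y :=
  Formda.hasGradientAt_regularize (h.hasGradY x hx y hy)

theorem gradY_gk {y : Vec dy} (hy : y ∈ P.Y) :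
    gradY (regularize ρ P.g) x y = gradY P.g x y - ρ • y :=
  (h.hasGradientAt_regularize hx hy).gradient

theorem argmaxY_spec : P.argmaxY ρ x ∈ P.Y ∧ IsMaxOn (regularize ρ P.g x) P.Y (P.argmaxY ρ x) := by
  have : ∃ y, y ∈ P.Y ∧ IsMaxOn (regularize ρ P.g x) P.Y y :=
    h.Y_compact.exists_isMaxOn h.Y_nonempty fun y hy =>
      (h.hasGradientAt_regularize hx hy).continuousAt.continuousWithinAt
  exact Classical.epsilon_spec this

theorem maxY_eq : P.maxY ρ x = regularize ρ P.g x (P.argmaxY ρ x) := by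
  obtain ⟨h1, h2⟩ := h.argmaxY_spec (ρ := ρ) hx
  exact IsGreatest.csSup_eq ⟨⟨_, h1, rfl⟩, by rintro _ ⟨y, hy, rfl⟩; exact h2 hy⟩

theorem le_maxY {y : Vec dy} (hy : y ∈ P.Y) : regularize ρ P.g x y ≤ P.maxY ρ x := by
  rw [h.maxY_eq hx]
  exact (h.argmaxY_spec hx).2 hy

theorem inner_argmaxY_nonpos {y : Vec dy} (hy : y ∈ P.Y) :
    ⟪gradY P.g x (P.argmaxY ρ x) - ρ • P.argmaxY ρ x, y - P.argmaxY ρ x⟫ ≤ 0 := by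
  obtain ⟨h1, h2⟩ := h.argmaxY_spec (ρ := ρ) hx
  have h3 := (h2.localize).hasFDerivWithinAt_nonpos
    (h.hasGradientAt_regularize (ρ := ρ) hx h1).hasFDerivAt.hasFDerivWithinAt
    (sub_mem_posTangentConeAt_of_segment_subset (h.Y_convex.segment_subset h1 hy))
  rwa [InnerProductSpace.toDual_apply_apply] at h3

theorem regularize_le {y u : Vec dy} (hy : y ∈ P.Y) (hu : u ∈ P.Y) :
    regularize ρ P.g x u ≤ regularize ρ P.g x y + ⟪gradY P.g x y - ρ • y, u - y⟫
      - ρ / 2 * ‖u - y‖ ^ 2 := by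
  have h1 := (h.concave x hx).le_add_inner_gradient hy hu (h.hasGradY x hx y hy)
  have h2 : ‖u‖ ^ 2 = ‖y‖ ^ 2 + 2 * ⟪y, u - y⟫ + ‖u - y‖ ^ 2 := by
    rw [← norm_add_sq_real, add_sub_cancel]
  simp only [regularize, inner_sub_left, inner_smul_left, RCLike.conj_to_real] at *
  rw [h2]
  linarith

theorem le_regularize {y u : Vec dy} (hy : y ∈ P.Y) (hu : u ∈ P.Y) :
    regularize ρ P.g x y + ⟪gradY P.g x y - ρ • y, u - y⟫ - (l + ρ) / 2 * ‖u - y‖ ^ 2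
      ≤ regularize ρ P.g x u := by
  have h1 := quadratic_le_of_lipschitz_gradient h.Y_convex (h.hasGradY x hx) (l := l)
    (fun z hz z' hz' => by simpa using h.lipY x hx x hx z hz z' hz') hy hu
  have h2 : ‖u‖ ^ 2 = ‖y‖ ^ 2 + 2 * ⟪y, u - y⟫ + ‖u - y‖ ^ 2 := by
    rw [← norm_add_sq_real, add_sub_cancel]
  simp only [regularize, inner_sub_left, inner_smul_left, RCLike.conj_to_real] at *
  rw [h2]
  linarith

/-- Quadratic growth: strong concavity expanded at the maximizer, where the linear term is
nonpositive. -/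
theorem regularize_le_argmaxY {u : Vec dy} (hu : u ∈ P.Y) :
    regularize ρ P.g x u + ρ / 2 * ‖u - P.argmaxY ρ x‖ ^ 2
      ≤ regularize ρ P.g x (P.argmaxY ρ x) := by
  have h1 := h.regularize_le (ρ := ρ) hx (h.argmaxY_spec (ρ := ρ) hx).1 hu
  have h2 := h.inner_argmaxY_nonpos (ρ := ρ) hx hu
  linarith

/-- One relaxed projected ascent step contracts towards the maximizer, up to the gradient error. -/
theorem norm_sq_ascent_sub_argmaxY_le {β η : ℝ} (hρ : 0 < ρ) (hβ : 0 < β) (hη : 0 ≤ η)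
    (hη' : η ≤ 2 / 3) (hβl : β * (l + ρ) ≤ 1 / 6) {y w : Vec dy} (hy : y ∈ P.Y) :
    ‖y + η • (proj P.Y (y + β • w) - y) - P.argmaxY ρ x‖ ^ 2 ≤
      (1 - η * β * ρ) * ‖y - P.argmaxY ρ x‖ ^ 2 - 7 / 6 * η * ‖proj P.Y (y + β • w) - y‖ ^ 2
        + η * β / ρ * ‖gradY P.g x y - ρ • y - w‖ ^ 2 := by
  set s := P.argmaxY ρ x with hs
  set t := proj P.Y (y + β • w) with ht
  set e := gradY P.g x y - ρ • y - w with he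
  have hsY : s ∈ P.Y := (h.argmaxY_spec hx).1
  have htY : t ∈ P.Y := (proj_spec h.Y_nonempty h.Y_compact.isClosed _).1
  have h1 := h.regularize_le (ρ := ρ) hx hy hsY
  have h2 := h.le_regularize (ρ := ρ) hx hy htY
  have h3 := h.regularize_le_argmaxY (ρ := ρ) hx htY
  rw [← hs] at h3
  have h4 := inner_sub_proj_nonpos h.Y_nonempty h.Y_compact.isClosed h.Y_convex (y + β • w) hsY
  rw [← ht] at h4
  have hgrad : gradY P.g x y - ρ • y = e + w := by rw [he]; abel
  rw [hgrad] at h1 h2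
  have hsty : s - t = (s - y) - (t - y) := by abel
  have hts : t - s = (t - y) - (s - y) := by abel
  have hywt : y + β • w - t = β • w - (t - y) := by abel
  have hexp : y + η • (t - y) - s = η • (t - y) - (s - y) := by abel
  have hys : ‖y - s‖ ^ 2 = ‖s - y‖ ^ 2 := by rw [norm_sub_rev]
  rw [hexp, hys]
  rw [hsty, hywt] at h4
  rw [hts] at h3
  set a := s - y
  set b := t - y
  -- Young's inequality with weight ρ, so that the distance term is exactly the quadratic growth
  -- supplied by `h3`.
  have h5 : 2 * ⟪e, a - b⟫ ≤ ρ * ‖b - a‖ ^ 2 + ‖e‖ ^ 2 / ρ := by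
    have h6 := real_inner_le_norm e (a - b)
    rw [norm_sub_rev a b] at h6
    have h7 : 0 ≤ (ρ * ‖b - a‖ - ‖e‖) ^ 2 / ρ := by positivity
    have h8 : (ρ * ‖b - a‖ - ‖e‖) ^ 2 / ρ =
      ρ * ‖b - a‖ ^ 2 + ‖e‖ ^ 2 / ρ - 2 * (‖e‖ * ‖b - a‖) := by field_simp; ring
    linarith
  have h9 : ‖η • b - a‖ ^ 2 = η ^ 2 * ‖b‖ ^ 2 - 2 * η * ⟪b, a⟫ + ‖a‖ ^ 2 := by
    rw [norm_sub_sq_real, norm_smul, inner_smul_left, mul_pow, Real.norm_eq_abs, sq_abs]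
    simp
    ring
  rw [h9]
  simp only [inner_sub_left, inner_sub_right, inner_add_left, inner_smul_left,
    RCLike.conj_to_real, real_inner_self_eq_norm_sq] at h1 h2 h4 h5
  have h10 : 0 ≤ (l + ρ) * ‖b‖ ^ 2 := by have := h.l_nonneg; positivity
  have h11 : β * ((l + ρ) * ‖b‖ ^ 2) ≤ 1 / 6 * ‖b‖ ^ 2 := by
    rw [← mul_assoc]; gcongr
  have h12 : η * β / ρ * ‖e‖ ^ 2 = η * (β * (‖e‖ ^ 2 / ρ)) := by ring
  rw [h12]
  -- Strong concavity at `y`, smoothness from `y` to `t`, quadratic growth at `t` and the projection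
  -- inequality, added up. The factor 11/6 is 2 - β(l + ρ) at worst; the bound η² ≤ (2/3)η below
  -- then leaves 7/6.
  have h13 : 2 * ⟪b, a⟫ ≥ 11 / 6 * ‖b‖ ^ 2 + β * ρ * ‖a‖ ^ 2 - β * (‖e‖ ^ 2 / ρ) := by
    have h14 : β * (ρ / 2 * ‖a‖ ^ 2 + ρ / 2 * ‖b - a‖ ^ 2) ≤
        β * (⟪e, a⟫ + ⟪w, a⟫ - (⟪e, b⟫ + ⟪w, b⟫) + (l + ρ) / 2 * ‖b‖ ^ 2) :=
      mul_le_mul_of_nonneg_left (by linarith) hβ.le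
    have h15 := mul_le_mul_of_nonneg_left h5 hβ.le
    linarith
  have h16 := mul_le_mul_of_nonneg_left h13 hη
  have h17 : η ^ 2 * ‖b‖ ^ 2 ≤ 2 / 3 * η * ‖b‖ ^ 2 := by
    have : η ^ 2 ≤ 2 / 3 * η := by nlinarith
    gcongr
  linarith

include hx'

/-- Test each maximizer's variational inequality against the other one and add. Strong monotonicity
with modulus `ρ'` dominates; what differs is the gradient at two points x and the term (ρ - ρ')u. -/
theorem norm_argmaxY_sub_le (hρρ' : ρ' ≤ ρ) :
    ρ' * ‖P.argmaxY ρ' x' - P.argmaxY ρ x‖ ≤ l * ‖x' - x‖ + (ρ - ρ') * P.σy := by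
  set u := P.argmaxY ρ x with hu
  set u' := P.argmaxY ρ' x' with hu'
  have huY : u ∈ P.Y := (h.argmaxY_spec hx).1
  have huY' : u' ∈ P.Y := (h.argmaxY_spec hx').1
  have h1 := h.inner_argmaxY_nonpos (ρ := ρ) hx huY'
  have h2 := h.inner_argmaxY_nonpos (ρ := ρ') hx' huY
  rw [← hu] at h1
  rw [← hu'] at h2
  have h3 := (h.concave x' hx').le_add_inner_gradient huY huY' (h.hasGradY x' hx' u huY)
  have h4 := (h.concave x' hx').le_add_inner_gradient huY' huY (h.hasGradY x' hx' u' huY')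
  have h5 := h.lipY x hx x' hx' u huY u huY
  rw [sub_self, norm_zero, add_zero, norm_sub_rev x x'] at h5
  have h6 := abs_le.1 (abs_real_inner_le_norm (gradY P.g x u - gradY P.g x' u) (u' - u))
  have h7 := abs_le.1 (abs_real_inner_le_norm u (u' - u))
  have h8 := norm_le_σy h.Y_compact huY
  have huu : u - u' = -(u' - u) := by abel
  have hexp : u' = (u' - u) + u := by abel
  rw [huu] at h2 h4
  set z := u' - u
  simp only [inner_sub_left, inner_smul_left, inner_neg_right, RCLike.conj_to_real] at h1 h2 h6
  rw [inner_neg_right] at h4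
  have h9 : ⟪u', z⟫ = ‖z‖ ^ 2 + ⟪u, z⟫ := by
    rw [hexp, inner_add_left, real_inner_self_eq_norm_sq]
  rw [h9] at h2
  have h10 : ‖gradY P.g x u - gradY P.g x' u‖ * ‖z‖ ≤ l * ‖x' - x‖ * ‖z‖ := by gcongr
  have h11 : (ρ - ρ') * ⟪u, z⟫ ≤ (ρ - ρ') * (P.σy * ‖z‖) := by
    have : ‖u‖ * ‖z‖ ≤ P.σy * ‖z‖ := by gcongr
    exact mul_le_mul_of_nonneg_left (h7.2.trans this) (sub_nonneg.2 hρρ')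
  have h12 : ρ' * ‖z‖ * ‖z‖ ≤ (l * ‖x' - x‖ + (ρ - ρ') * P.σy) * ‖z‖ := by linarith
  rcases (norm_nonneg z).eq_or_lt with h0 | h0
  · rw [← h0, mul_zero]
    have := h.l_nonneg
    have := (norm_nonneg u).trans h8
    have := sub_nonneg.2 hρρ'
    positivity
  · exact le_of_mul_le_mul_right h12 h0

/-- A one-sided substitute for the smoothness of the primal function, without differentiating it.
Expand in x at the new maximizer, then replace the gradient there by the one at the old maximizer;
the cost l ‖u' - u‖ ‖x' - x‖ is absorbed by quadratic growth, which produces l²/ρ. -/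
theorem maxY_le_quadratic (hρ : 0 < ρ) :
    P.maxY ρ x' ≤ P.maxY ρ x + ⟪gradX P.g x (P.argmaxY ρ x), x' - x⟫
      + (l + l ^ 2 / ρ) / 2 * ‖x' - x‖ ^ 2 := by
  rw [h.maxY_eq hx, h.maxY_eq hx']
  set u := P.argmaxY ρ x with hu
  set u' := P.argmaxY ρ x' with hu'
  have huY : u ∈ P.Y := (h.argmaxY_spec hx).1
  have huY' : u' ∈ P.Y := (h.argmaxY_spec hx').1
  have h1 := le_quadratic_of_lipschitz_gradient h.X_convex
    (fun z hz => h.hasGradX z hz u' huY') (l := l)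
    (fun z hz z' hz' => by simpa using h.lipX z hz z' hz' u' huY' u' huY') hx hx'
  have h2 := h.regularize_le_argmaxY (ρ := ρ) hx huY'
  rw [← hu] at h2
  have h3 := h.lipX x hx x hx u' huY' u huY
  rw [sub_self, norm_zero, zero_add] at h3
  have h4 := real_inner_le_norm (gradX P.g x u' - gradX P.g x u) (x' - x)
  have h5 : ‖gradX P.g x u' - gradX P.g x u‖ * ‖x' - x‖ ≤ l * ‖u' - u‖ * ‖x' - x‖ := by gcongr
  have h6 : l * ‖u' - u‖ * ‖x' - x‖ ≤ ρ / 2 * ‖u' - u‖ ^ 2 + l ^ 2 / ρ / 2 * ‖x' - x‖ ^ 2 := by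
    have h7 : 0 ≤ (ρ * ‖u' - u‖ - l * ‖x' - x‖) ^ 2 / ρ := by positivity
    have h8 : (ρ * ‖u' - u‖ - l * ‖x' - x‖) ^ 2 / ρ = ρ * ‖u' - u‖ ^ 2
      + l ^ 2 / ρ * ‖x' - x‖ ^ 2 - 2 * (l * ‖u' - u‖ * ‖x' - x‖) := by field_simp; ring
    linarith
  rw [inner_sub_left] at h4
  simp only [regularize] at *
  linarith

end

section

variable (h : P.IsRegular l) {ρ ρ' : ℝ} {x : Vec dx} (hx : x ∈ P.X)
include h hx

theorem maxY_le_maxY_add (hρρ' : ρ' ≤ ρ) :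
    P.maxY ρ' x ≤ P.maxY ρ x + (ρ - ρ') / 2 * P.σy ^ 2 := by
  have h1 := h.argmaxY_spec (ρ := ρ') hx
  have h2 := h.le_maxY (ρ := ρ) hx h1.1
  have h3 := norm_le_σy h.Y_compact h1.1
  have h4 : (ρ - ρ') / 2 * ‖P.argmaxY ρ' x‖ ^ 2 ≤ (ρ - ρ') / 2 * P.σy ^ 2 := by
    have := sub_nonneg.2 hρρ'
    gcongr
  rw [h.maxY_eq hx]
  simp only [regularize] at *
  linarith

/-- One relaxed projected descent step decreases `maxY ρ`, up to the errors of the gradient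
estimator and of the maximizer. -/
theorem maxY_descent_le {α η : ℝ} (hρ : 0 < ρ) (hα : 0 < α) (hη : 0 ≤ η) (hη' : η ≤ 1)
    {v : Vec dx} {y : Vec dy} (hy : y ∈ P.Y) :
    P.maxY ρ (x + η • (proj P.X (x - α • v) - x)) ≤ P.maxY ρ x
      - (3 * η / (4 * α) - η ^ 2 * (l + l ^ 2 / ρ) / 2) * ‖proj P.X (x - α • v) - x‖ ^ 2
      + 2 * η * α * ‖gradX P.g x y - v‖ ^ 2
      + 2 * η * α * l ^ 2 * ‖y - P.argmaxY ρ x‖ ^ 2 := by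
  set t := proj P.X (x - α • v) with ht
  have htX : t ∈ P.X := (proj_spec h.X_nonempty h.X_compact.isClosed _).1
  have hx' : x + η • (t - x) ∈ P.X := h.X_convex.add_smul_sub_mem hx htX ⟨hη, hη'⟩
  have h1 := h.maxY_le_quadratic hx hx' hρ
  have h2 := inner_sub_proj_nonpos h.X_nonempty h.X_compact.isClosed h.X_convex (x - α • v) hx
  rw [← ht] at h2
  have h3 := h.lipX x hx x hx (P.argmaxY ρ x) (h.argmaxY_spec hx).1 y hy
  rw [sub_self, norm_zero, zero_add, norm_sub_rev _ y] at h3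
  rw [add_sub_cancel_left, inner_smul_right, norm_smul, mul_pow, Real.norm_eq_abs, sq_abs] at h1
  have e1 : x - α • v - t = -(α • v + (t - x)) := by abel
  have e2 : x - t = -(t - x) := by abel
  rw [e1, e2, inner_neg_neg, inner_add_left, inner_smul_left, RCLike.conj_to_real,
    real_inner_self_eq_norm_sq] at h2
  set b := t - x
  set s := P.argmaxY ρ x
  -- Used twice, for the estimator error and for the maximizer error. Each use costs 1/(8α), which
  -- leaves 3/(4α) of the 1/α given by the projection.
  have young : ∀ (p : Vec dx) (m : ℝ), ‖p‖ ≤ m →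
      ⟪p, b⟫ ≤ 2 * α * m ^ 2 + 1 / (8 * α) * ‖b‖ ^ 2 := by
    intro p m hm
    have h4 := real_inner_le_norm p b
    have h5 : ‖p‖ * ‖b‖ ≤ m * ‖b‖ := by gcongr
    have h6 : 0 ≤ (4 * α * m - ‖b‖) ^ 2 / (8 * α) := by positivity
    have h7 : (4 * α * m - ‖b‖) ^ 2 / (8 * α) =
      2 * α * m ^ 2 + 1 / (8 * α) * ‖b‖ ^ 2 - m * ‖b‖ := by field_simp; ring
    linarith
  have h8 := young (gradX P.g x y - v) _ le_rfl
  have h9 := young (gradX P.g x s - gradX P.g x y) _ h3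
  have h10 : ⟪v, b⟫ ≤ - (1 / α * ‖b‖ ^ 2) := by
    rw [← mul_le_mul_iff_right₀ hα]
    field_simp
    linarith
  rw [inner_sub_left] at h8 h9
  have h11 : ⟪gradX P.g x s, b⟫ ≤ -(3 / (4 * α) * ‖b‖ ^ 2) + 2 * α * ‖gradX P.g x y - v‖ ^ 2
      + 2 * α * (l * ‖y - s‖) ^ 2 := by
    have : 3 / (4 * α) * ‖b‖ ^ 2 = 1 / α * ‖b‖ ^ 2 - 1 / (8 * α) * ‖b‖ ^ 2
      - 1 / (8 * α) * ‖b‖ ^ 2 := by field_simp; ring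
    linarith
  have h12 := mul_le_mul_of_nonneg_left h11 hη
  have h13 : 3 * η / (4 * α) = η * (3 / (4 * α)) := by ring
  rw [h13]
  linarith

end

end IsRegular
end MinimaxProblem

/-! ### Averages of independent centered samples. -/

section Independence

variable {Ω Ξ 𝒰 : Type*} [MeasurableSpace Ξ] [MeasurableSpace 𝒰] {D : Measure Ξ}

theorem _root_.MeasureTheory.MemLp.integrable_real_inner {mΩ : MeasurableSpace Ω}
    {μ : Measure Ω} {E : Type*} [NormedAddCommGroup E]
    [InnerProductSpace ℝ E] {f g : Ω → E} (hf : MemLp f 2 μ) (hg : MemLp g 2 μ) :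
    Integrable (fun ω => ⟪f ω, g ω⟫) μ := by
  refine Integrable.mono' (g := fun ω => ‖f ω‖ ^ 2 + ‖g ω‖ ^ 2)
    (((memLp_two_iff_integrable_sq_norm hf.1).1 hf).add
      ((memLp_two_iff_integrable_sq_norm hg.1).1 hg)) (hf.1.inner hg.1)
    (Eventually.of_forall fun ω => ?_)
  have := norm_inner_le_norm (𝕜 := ℝ) (f ω) (g ω)
  nlinarith [norm_nonneg (f ω), norm_nonneg (g ω), sq_nonneg (‖f ω‖ - ‖g ω‖)]

theorem map_prodMk_eq_of_indep {m mΩ : MeasurableSpace Ω} {μ : Measure Ω}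
    [IsProbabilityMeasure μ] {ζ : Ω → Ξ} (hm : m ≤ mΩ)
    (hind : Indep m (MeasurableSpace.comap ζ inferInstance) μ) (hζ : Measurable ζ)
    (hlaw : μ.map ζ = D) {U : Ω → 𝒰} (hU : Measurable[m] U) :
    μ.map (fun ω => (U ω, ζ ω)) = (μ.map U).prod D := by
  have h1 : U ⟂ᵢ[μ] ζ := (IndepFun_iff_Indep _ _ _).2
    (indep_of_indep_of_le_left hind hU.comap_le)
  rw [h1.map_prod_eq_prod_map_map (hU.mono hm le_rfl).aemeasurable hζ.aemeasurable, hlaw]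

/-- Integrating out a sample that is independent of the remaining data. -/
theorem integral_comp_of_indep {m mΩ : MeasurableSpace Ω} {μ : Measure Ω}
    [IsProbabilityMeasure μ] {ζ : Ω → Ξ} (hm : m ≤ mΩ)
    (hind : Indep m (MeasurableSpace.comap ζ inferInstance) μ) (hζ : Measurable ζ)
    (hlaw : μ.map ζ = D) {U : Ω → 𝒰} (hU : Measurable[m] U) {f : 𝒰 → Ξ → ℝ}
    (hf : Measurable (Function.uncurry f)) (hint : Integrable (fun ω => f (U ω) (ζ ω)) μ) :
    Integrable (fun ω => ∫ ξ, f (U ω) ξ ∂D) μ ∧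
    ∫ ω, f (U ω) (ζ ω) ∂μ = ∫ ω, ∫ ξ, f (U ω) ξ ∂D ∂μ := by
  have hmap := map_prodMk_eq_of_indep hm hind hζ hlaw hU
  have hU' := hU.mono hm le_rfl
  have : IsProbabilityMeasure D := hlaw ▸ Measure.isProbabilityMeasure_map hζ.aemeasurable
  have : IsProbabilityMeasure (μ.map U) := Measure.isProbabilityMeasure_map hU'.aemeasurable
  have hp : Measurable fun ω => (U ω, ζ ω) := hU'.prodMk hζ
  have hint' : Integrable (Function.uncurry f) ((μ.map U).prod D) := by
    rw [← hmap, integrable_map_measure hf.aestronglyMeasurable hp.aemeasurable]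
    exact hint
  constructor
  · exact (integrable_map_measure hint'.integral_prod_left.1 hU'.aemeasurable).1
      hint'.integral_prod_left
  calc ∫ ω, f (U ω) (ζ ω) ∂μ = ∫ p, Function.uncurry f p ∂(μ.map fun ω => (U ω, ζ ω)) := by
        rw [integral_map hp.aemeasurable hf.aestronglyMeasurable]; rfl
    _ = ∫ u, ∫ ξ, f u ξ ∂D ∂(μ.map U) := by
        rw [hmap, integral_prod _ hint']; rfl
    _ = _ := by
        rw [integral_map hU'.aemeasurable]
        exact hint'.integral_prod_left.1

/-- Second moment of a fixed vector plus an average of independent centered vectors. -/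
theorem integral_norm_sq_add_average_le {mΩ : MeasurableSpace Ω} {μ : Measure Ω}
    [IsProbabilityMeasure μ] {d b : ℕ} (hb : 0 < b)
    {ζ : Fin b → Ω → Ξ} (hζ : ∀ j, Measurable (ζ j)) (hlaw : ∀ j, μ.map (ζ j) = D)
    {m : Fin b → MeasurableSpace Ω} (hm : ∀ j, m j ≤ mΩ)
    (hind : ∀ j, Indep (m j) (MeasurableSpace.comap (ζ j) inferInstance) μ)
    (hmζ : ∀ i j, i ≠ j → Measurable[m j] (ζ i))
    {U : Ω → 𝒰} (hU : ∀ j, Measurable[m j] U) {e : Ω → Vec d} (he : ∀ j, Measurable[m j] e)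
    (he2 : MemLp e 2 μ) {K : 𝒰 → Ξ → Vec d} (hK : Measurable (Function.uncurry K))
    (hKi : ∀ u, Integrable (K u) D) (hK0 : ∀ u, ∫ ξ, K u ξ ∂D = 0)
    (hK2 : ∀ j, MemLp (fun ω => K (U ω) (ζ j ω)) 2 μ) {B : 𝒰 → ℝ}
    (hB : ∀ u, ∫ ξ, ‖K u ξ‖ ^ 2 ∂D ≤ B u) (hBi : Integrable (fun ω => B (U ω)) μ) (c : ℝ) :
    MemLp (fun ω => c • e ω + (1 / (b : ℝ)) • ∑ j, K (U ω) (ζ j ω)) 2 μ ∧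
    ∫ ω, ‖c • e ω + (1 / (b : ℝ)) • ∑ j, K (U ω) (ζ j ω)‖ ^ 2 ∂μ ≤
      c ^ 2 * (∫ ω, ‖e ω‖ ^ 2 ∂μ) + (1 / (b : ℝ)) * ∫ ω, B (U ω) ∂μ := by
  have hsum : MemLp (fun ω => ∑ j, K (U ω) (ζ j ω)) 2 μ :=
    memLp_finsetSum _ fun j _ => hK2 j
  refine ⟨(he2.const_smul c).add (hsum.const_smul (1 / (b : ℝ))), ?_⟩
  -- All cross terms vanish for one reason: the other factor is measurable for `m j`, which is
  -- independent of the `j`-th sample. This covers both the past error `e` and the other samples of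
  -- the batch.
  have hinner : ∀ (F : Ω → Vec d) (j : Fin b), Measurable[m j] F → MemLp F 2 μ →
      ∫ ω, ⟪F ω, K (U ω) (ζ j ω)⟫ ∂μ = 0 := by
    intro F j hF hF2
    have h1 := (integral_comp_of_indep (𝒰 := Vec d × 𝒰) (hm j) (hind j) (hζ j) (hlaw j)
      (U := fun ω => (F ω, U ω)) (hF.prodMk (hU j)) (f := fun u ξ => ⟪u.1, K u.2 ξ⟫)
      (by
        have : Measurable fun p : (Vec d × 𝒰) × Ξ => K p.1.2 p.2 :=
          hK.comp ((measurable_snd.comp measurable_fst).prodMk measurable_snd)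
        exact (measurable_fst.comp measurable_fst).inner this)
      (hF2.integrable_real_inner (hK2 j))).2
    rw [h1]
    simp only [integral_inner (hKi _), hK0, inner_zero_right, integral_zero]
  have hee : ∀ j, ∫ ω, ⟪e ω, K (U ω) (ζ j ω)⟫ ∂μ = 0 := fun j => hinner e j (he j) he2
  have hij : ∀ i j, i ≠ j → ∫ ω, ⟪K (U ω) (ζ i ω), K (U ω) (ζ j ω)⟫ ∂μ = 0 := fun i j hij =>
    hinner _ j (hK.comp ((hU j).prodMk (hmζ i j hij))) (hK2 i)
  have hjj : ∀ j, ∫ ω, ⟪K (U ω) (ζ j ω), K (U ω) (ζ j ω)⟫ ∂μ ≤ ∫ ω, B (U ω) ∂μ := by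
    intro j
    simp only [real_inner_self_eq_norm_sq]
    obtain ⟨h1, h2⟩ := integral_comp_of_indep (hm j) (hind j) (hζ j) (hlaw j) (hU j)
      (f := fun u ξ => ‖K u ξ‖ ^ 2) (hK.norm.pow_const 2)
      ((memLp_two_iff_integrable_sq_norm (hK2 j).1).1 (hK2 j))
    rw [h2]
    exact integral_mono h1 hBi fun ω => hB _
  have hexp : ∀ ω, ‖c • e ω + (1 / (b : ℝ)) • ∑ j, K (U ω) (ζ j ω)‖ ^ 2 =
      c ^ 2 * ‖e ω‖ ^ 2 + 2 * c / b * ∑ j, ⟪e ω, K (U ω) (ζ j ω)⟫ +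
        1 / (b : ℝ) ^ 2 * ∑ i, ∑ j, ⟪K (U ω) (ζ i ω), K (U ω) (ζ j ω)⟫ := by
    intro ω
    rw [norm_add_sq_real, norm_smul, norm_smul, inner_smul_left, inner_smul_right, mul_pow, mul_pow,
      ← real_inner_self_eq_norm_sq (∑ j, K (U ω) (ζ j ω)), sum_inner]
    simp only [inner_sum, Real.norm_eq_abs, sq_abs, RCLike.conj_to_real]
    ring
  have hi1 : Integrable (fun ω => c ^ 2 * ‖e ω‖ ^ 2) μ :=
    ((memLp_two_iff_integrable_sq_norm he2.1).1 he2).const_mul _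
  have hi2 : Integrable (fun ω => 2 * c / b * ∑ j, ⟪e ω, K (U ω) (ζ j ω)⟫) μ :=
    (integrable_finsetSum _ fun j _ => he2.integrable_real_inner (hK2 j)).const_mul _
  have hi3 : Integrable (fun ω => 1 / (b : ℝ) ^ 2 *
      ∑ i, ∑ j, ⟪K (U ω) (ζ i ω), K (U ω) (ζ j ω)⟫) μ :=
    (integrable_finsetSum _ fun i _ => integrable_finsetSum _ fun j _ =>
      (hK2 i).integrable_real_inner (hK2 j)).const_mul _
  simp only [hexp]
  have hi12 : Integrable (fun ω => c ^ 2 * ‖e ω‖ ^ 2 +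
      2 * c / b * ∑ j, ⟪e ω, K (U ω) (ζ j ω)⟫) μ := hi1.add hi2
  rw [integral_add hi12 hi3, integral_add hi1 hi2, integral_const_mul, integral_const_mul,
    integral_const_mul, integral_finsetSum _ fun j _ => he2.integrable_real_inner (hK2 j),
    integral_finsetSum _ fun i _ => integrable_finsetSum _ fun j _ =>
      (hK2 i).integrable_real_inner (hK2 j)]
  simp only [hee, Finset.sum_const_zero, mul_zero, add_zero]
  have h4 : ∑ i, ∫ ω, ∑ j, ⟪K (U ω) (ζ i ω), K (U ω) (ζ j ω)⟫ ∂μ ≤ b * ∫ ω, B (U ω) ∂μ := by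
    calc _ ≤ ∑ _i : Fin b, ∫ ω, B (U ω) ∂μ := by
          refine Finset.sum_le_sum fun i _ => ?_
          rw [integral_finsetSum _ fun j _ => (hK2 i).integrable_real_inner (hK2 j),
            Finset.sum_eq_single i (fun j _ hj => hij i j hj.symm) (by simp)]
          exact hjj i
      _ = _ := by simp
  have hb' : (0 : ℝ) < b := by exact_mod_cast hb
  have h5 := mul_le_mul_of_nonneg_left h4 (show 0 ≤ 1 / (b : ℝ) ^ 2 by positivity)
  have h6 : 1 / (b : ℝ) ^ 2 * (b * ∫ ω, B (U ω) ∂μ) = 1 / (b : ℝ) * ∫ ω, B (U ω) ∂μ := by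
    field_simp
  linarith

end Independence

/-! ### Noise of a Lipschitz oracle and the momentum recursion. -/

namespace MinimaxProblem.IsOracle

variable {dx dy d : ℕ} {Ξ Ω : Type*} [MeasurableSpace Ξ] {P : MinimaxProblem dx dy Ξ}
  {l δ : ℝ} {H : Ξ → Vec dx → Vec dy → Vec d} {h : Vec dx → Vec dy → Vec d}

/-- A Carathéodory function: continuous in the point, measurable in the sample. The subtypes appear
because the Lipschitz bound holds only on `X × Y`. -/
theorem measurable_uncurry (hH : P.IsOracle l δ H h) :
    Measurable fun p : (P.X × P.Y) × Ξ => H p.2 p.1.1 p.1.2 := by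
  refine measurable_uncurry_of_continuous_of_measurable
    (u := fun (z : P.X × P.Y) ξ => H ξ z.1 z.2) (fun ξ => ?_)
    (fun z => hH.meas _ z.1.2 _ z.2.2)
  refine continuous_iff_continuousAt.2 fun z => tendsto_iff_norm_sub_tendsto_zero.2 ?_
  refine squeeze_zero (fun _ => norm_nonneg _)
    (fun w => hH.lip ξ _ w.1.2 _ z.1.2 _ w.2.2 _ z.2.2) ?_
  have : Continuous fun w : P.X × P.Y =>
    l * (‖(w.1 : Vec dx) - z.1‖ + ‖(w.2 : Vec dy) - z.2‖) := by fun_prop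
  simpa using this.tendsto z

theorem continuous_mean [IsProbabilityMeasure P.D] (hH : P.IsOracle l δ H h) :
    Continuous fun z : P.X × P.Y => h z.1 z.2 := by
  refine continuous_iff_continuousAt.2 fun z => tendsto_iff_norm_sub_tendsto_zero.2 ?_
  refine squeeze_zero (fun _ => norm_nonneg _)
    (fun w => hH.mean_lip w.1.2 z.1.2 w.2.2 z.2.2) ?_
  have : Continuous fun w : P.X × P.Y =>
    l * (‖(w.1 : Vec dx) - z.1‖ + ‖(w.2 : Vec dy) - z.2‖) := by fun_prop
  simpa using this.tendsto z

theorem measurable_comp (hH : P.IsOracle l δ H h) {m : MeasurableSpace Ω} {ζ : Ω → Ξ}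
    (hζ : Measurable ζ) {x : Ω → Vec dx} (hx : Measurable x) (hxX : ∀ ω, x ω ∈ P.X)
    {y : Ω → Vec dy} (hy : Measurable y) (hyY : ∀ ω, y ω ∈ P.Y) :
    Measurable fun ω => H (ζ ω) (x ω) (y ω) :=
  hH.measurable_uncurry.comp
    (((hx.subtype_mk (h := hxX)).prodMk (hy.subtype_mk (h := hyY))).prodMk hζ)

theorem measurable_mean_comp [IsProbabilityMeasure P.D] (hH : P.IsOracle l δ H h)
    {m : MeasurableSpace Ω}
    {x : Ω → Vec dx} (hx : Measurable x) (hxX : ∀ ω, x ω ∈ P.X)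
    {y : Ω → Vec dy} (hy : Measurable y) (hyY : ∀ ω, y ω ∈ P.Y) :
    Measurable fun ω => h (x ω) (y ω) :=
  hH.continuous_mean.measurable.comp
    ((hx.subtype_mk (h := hxX)).prodMk (hy.subtype_mk (h := hyY)))

/-- The noise is square integrable, at random points and an arbitrary sample with law `D`. -/
theorem memLp_noise [MeasurableSpace Ω] {μ : Measure Ω} [IsProbabilityMeasure μ]
    [IsProbabilityMeasure P.D] (hH : P.IsOracle l δ H h)
    (hX : IsCompact P.X) (hY : IsCompact P.Y) (hl : 0 ≤ l) {ζ : Ω → Ξ} (hζ : Measurable ζ)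
    (hlaw : μ.map ζ = P.D) {x : Ω → Vec dx} (hx : Measurable x) (hxX : ∀ ω, x ω ∈ P.X)
    {y : Ω → Vec dy} (hy : Measurable y) (hyY : ∀ ω, y ω ∈ P.Y) :
    MemLp (fun ω => H (ζ ω) (x ω) (y ω) - h (x ω) (y ω)) 2 μ := by
  have : Nonempty Ω := nonempty_of_isProbabilityMeasure μ
  obtain ⟨ω₀⟩ := this
  set x₀ := x ω₀
  set y₀ := y ω₀
  have h0 : MemLp (fun ξ => H ξ x₀ y₀ - h x₀ y₀) 2 P.D :=
    (memLp_two_iff_integrable_sq_norm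
      ((hH.meas _ (hxX ω₀) _ (hyY ω₀)).sub_const _).aestronglyMeasurable).2
      (hH.sq_integrable _ (hxX ω₀) _ (hyY ω₀))
  have h1 : MemLp (fun ω => H (ζ ω) x₀ y₀ - h x₀ y₀) 2 μ := by
    rw [← hlaw] at h0
    exact (memLp_map_measure_iff h0.1 hζ.aemeasurable).1 h0
  have hmeas := (hH.measurable_comp hζ hx hxX hy hyY).sub (hH.measurable_mean_comp hx hxX hy hyY)
  have hmeas0 : Measurable (fun ω => H (ζ ω) x₀ y₀ - h x₀ y₀) :=
    ((hH.meas _ (hxX ω₀) _ (hyY ω₀)).comp hζ).sub_const _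
  -- The noise at the random point differs from the noise at a fixed point by a bounded amount,
  -- since `X` and `Y` have finite diameter. No independence is needed.
  have h2 : MemLp (fun ω => (H (ζ ω) (x ω) (y ω) - h (x ω) (y ω)) -
      (H (ζ ω) x₀ y₀ - h x₀ y₀)) 2 μ := by
    refine MemLp.of_bound (hmeas.sub hmeas0).aestronglyMeasurable
      (2 * (l * (Metric.diam P.X + Metric.diam P.Y))) (Eventually.of_forall fun ω => ?_)
    have e1 := hH.lip (ζ ω) _ (hxX ω) _ (hxX ω₀) _ (hyY ω) _ (hyY ω₀)
    have e2 := hH.mean_lip (hxX ω) (hxX ω₀) (hyY ω) (hyY ω₀)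
    have e3 := Metric.dist_le_diam_of_mem hX.isBounded (hxX ω) (hxX ω₀)
    have e4 := Metric.dist_le_diam_of_mem hY.isBounded (hyY ω) (hyY ω₀)
    rw [dist_eq_norm] at e3 e4
    have e5 : l * (‖x ω - x ω₀‖ + ‖y ω - y ω₀‖) ≤ l * (Metric.diam P.X + Metric.diam P.Y) := by
      gcongr
    rw [sub_sub_sub_comm]
    have e6 := norm_sub_le (H (ζ ω) (x ω) (y ω) - H (ζ ω) x₀ y₀) (h (x ω) (y ω) - h x₀ y₀)
    linarith
  refine (memLp_congr_ae (Eventually.of_forall fun ω => ?_)).1 (h2.add h1)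
  simp

/-- One step of the variance recursion of the recursive momentum estimator. -/
theorem integral_norm_sq_estimator_le [MeasurableSpace Ω] {μ : Measure Ω} [IsProbabilityMeasure μ]
    [IsProbabilityMeasure P.D] (hH : P.IsOracle l δ H h)
    (hX : IsCompact P.X) (hY : IsCompact P.Y) (hl : 0 ≤ l) {b : ℕ} (hb : 0 < b)
    {ζ : Fin b → Ω → Ξ} (hζ : ∀ j, Measurable (ζ j)) (hlaw : ∀ j, μ.map (ζ j) = P.D)
    {m : Fin b → MeasurableSpace Ω} (hm : ∀ j, m j ≤ ‹MeasurableSpace Ω›)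
    (hind : ∀ j, Indep (m j) (MeasurableSpace.comap (ζ j) inferInstance) μ)
    (hmζ : ∀ i j, i ≠ j → Measurable[m j] (ζ i))
    {e : Ω → Vec d} (he : ∀ j, Measurable[m j] e) (he2 : MemLp e 2 μ)
    {x x' : Ω → Vec dx} {y y' : Ω → Vec dy}
    (hx : ∀ j, Measurable[m j] x) (hx' : ∀ j, Measurable[m j] x')
    (hy : ∀ j, Measurable[m j] y) (hy' : ∀ j, Measurable[m j] y')
    (hxX : ∀ ω, x ω ∈ P.X) (hxX' : ∀ ω, x' ω ∈ P.X)
    (hyY : ∀ ω, y ω ∈ P.Y) (hyY' : ∀ ω, y' ω ∈ P.Y) (γ : ℝ) :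
    let e' := fun ω => (1 - γ) • e ω + (1 / (b : ℝ)) • ∑ j,
      ((H (ζ j ω) (x' ω) (y' ω) - h (x' ω) (y' ω)) -
        (1 - γ) • (H (ζ j ω) (x ω) (y ω) - h (x ω) (y ω)))
    MemLp e' 2 μ ∧
    ∫ ω, ‖e' ω‖ ^ 2 ∂μ ≤ (1 - γ) ^ 2 * (∫ ω, ‖e ω‖ ^ 2 ∂μ) +
      (1 / (b : ℝ)) * (2 * γ ^ 2 * δ ^ 2 +
        16 * l ^ 2 * ((∫ ω, ‖x' ω - x ω‖ ^ 2 ∂μ) + ∫ ω, ‖y' ω - y ω‖ ^ 2 ∂μ)) := by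
  intro e'
  let N : (P.X × P.Y) → Ξ → Vec d := fun z ξ => H ξ z.1 z.2 - h z.1 z.2
  let K : (P.X × P.Y) × (P.X × P.Y) → Ξ → Vec d := fun u ξ => N u.2 ξ - (1 - γ) • N u.1 ξ
  let B : (P.X × P.Y) × (P.X × P.Y) → ℝ := fun u => 2 * γ ^ 2 * δ ^ 2 +
    16 * l ^ 2 * (‖(u.2.1 : Vec dx) - u.1.1‖ ^ 2 + ‖(u.2.2 : Vec dy) - u.1.2‖ ^ 2)
  let U : Ω → (P.X × P.Y) × (P.X × P.Y) := fun ω =>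
    ((⟨x ω, hxX ω⟩, ⟨y ω, hyY ω⟩), (⟨x' ω, hxX' ω⟩, ⟨y' ω, hyY' ω⟩))
  have hN : Measurable fun p : (P.X × P.Y) × Ξ => N p.1 p.2 :=
    hH.measurable_uncurry.sub (hH.continuous_mean.measurable.comp measurable_fst)
  have hK : Measurable (Function.uncurry K) :=
    (hN.comp ((measurable_snd.comp measurable_fst).prodMk measurable_snd)).sub
      ((hN.comp ((measurable_fst.comp measurable_fst).prodMk measurable_snd)).const_smul (1 - γ))
  have hNi : ∀ z, Integrable (N z) P.D := fun z =>
    (hH.integrable _ z.1.2 _ z.2.2).sub (integrable_const _)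
  have hN0 : ∀ z, ∫ ξ, N z ξ ∂P.D = 0 := fun z => by
    simp only [N]
    rw [integral_sub (hH.integrable _ z.1.2 _ z.2.2) (integrable_const _),
      hH.mean _ z.1.2 _ z.2.2]
    simp
  have hKi : ∀ u, Integrable (K u) P.D := fun u => (hNi _).sub ((hNi _).smul (1 - γ))
  have hK0 : ∀ u, ∫ ξ, K u ξ ∂P.D = 0 := fun u => by
    have hs : Integrable (fun ξ => (1 - γ) • N u.1 ξ) P.D := (hNi _).smul (1 - γ)
    simp only [K]
    rw [integral_sub (hNi _) hs, integral_smul, hN0, hN0, smul_zero, sub_zero]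
  have hN2 : ∀ z, Integrable (fun ξ => ‖N z ξ‖ ^ 2) P.D := fun z =>
    hH.sq_integrable _ z.1.2 _ z.2.2
  have hKpt : ∀ u ξ, ‖K u ξ‖ ^ 2 ≤ 2 * γ ^ 2 * ‖N u.1 ξ‖ ^ 2 +
      16 * l ^ 2 * (‖(u.2.1 : Vec dx) - u.1.1‖ ^ 2 + ‖(u.2.2 : Vec dy) - u.1.2‖ ^ 2) := by
    intro u ξ
    -- The momentum cancellation: only the fraction γ of the old noise survives, next to a
    -- difference of noises at neighbouring points. That difference is at most 2l(s + t), whose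
    -- square is at most 8l²(s² + t²); splitting the sum doubles this to 16l².
    have e0 : K u ξ = γ • N u.1 ξ + (N u.2 ξ - N u.1 ξ) := by
      simp only [K, sub_smul, one_smul]; abel
    have e1 := hH.lip ξ _ u.2.1.2 _ u.1.1.2 _ u.2.2.2 _ u.1.2.2
    have e2 := hH.mean_lip u.2.1.2 u.1.1.2 u.2.2.2 u.1.2.2
    have e3 : ‖N u.2 ξ - N u.1 ξ‖ ≤
        2 * (l * (‖(u.2.1 : Vec dx) - u.1.1‖ + ‖(u.2.2 : Vec dy) - u.1.2‖)) := by
      simp only [N]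
      rw [sub_sub_sub_comm]
      refine (norm_sub_le _ _).trans ?_
      linarith
    have e4 := norm_add_le (γ • N u.1 ξ) (N u.2 ξ - N u.1 ξ)
    rw [norm_smul] at e4
    have e5 : ‖γ‖ ^ 2 = γ ^ 2 := by rw [Real.norm_eq_abs, sq_abs]
    rw [e0, ← e5]
    generalize ‖(u.2.1 : Vec dx) - u.1.1‖ = s at *
    generalize ‖(u.2.2 : Vec dy) - u.1.2‖ = t at *
    generalize hr : ‖N u.2 ξ - N u.1 ξ‖ = r at *
    have hr0 : 0 ≤ r := hr ▸ norm_nonneg _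
    generalize hq : ‖γ‖ * ‖N u.1 ξ‖ = q at *
    have e6 : ‖γ • N u.1 ξ + (N u.2 ξ - N u.1 ξ)‖ ^ 2 ≤ (q + r) ^ 2 := by gcongr
    have e7 : r ^ 2 ≤ (2 * (l * (s + t))) ^ 2 := by gcongr
    have e8 : (2 * (l * (s + t))) ^ 2 ≤ 8 * l ^ 2 * (s ^ 2 + t ^ 2) := by
      nlinarith [mul_nonneg (sq_nonneg l) (sq_nonneg (s - t))]
    have e9 : 2 * ‖γ‖ ^ 2 * ‖N u.1 ξ‖ ^ 2 = 2 * q ^ 2 := by rw [← hq]; ring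
    nlinarith [sq_nonneg (q - r)]
  have hB : ∀ u, ∫ ξ, ‖K u ξ‖ ^ 2 ∂P.D ≤ B u := by
    intro u
    have hi := ((hN2 u.1).const_mul (2 * γ ^ 2)).add (integrable_const (μ := P.D)
      (16 * l ^ 2 * (‖(u.2.1 : Vec dx) - u.1.1‖ ^ 2 + ‖(u.2.2 : Vec dy) - u.1.2‖ ^ 2)))
    refine (integral_mono_of_nonneg (Eventually.of_forall fun ξ => by positivity) hi
      (Eventually.of_forall fun ξ => hKpt u ξ)).trans ?_
    simp only [Pi.add_apply]
    rw [integral_add ((hN2 u.1).const_mul (2 * γ ^ 2)) (integrable_const _), integral_const_mul]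
    have := mul_le_mul_of_nonneg_left (hH.variance_le _ u.1.1.2 _ u.1.2.2)
      (show 0 ≤ 2 * γ ^ 2 by positivity)
    simpa [B, N] using this
  have hU : ∀ j, Measurable[m j] U := fun j =>
    ((hx j).subtype_mk.prodMk (hy j).subtype_mk).prodMk
      ((hx' j).subtype_mk.prodMk (hy' j).subtype_mk)
  let j₀ : Fin b := ⟨0, hb⟩
  have hxm := (hx j₀).mono (hm j₀) le_rfl
  have hym := (hy j₀).mono (hm j₀) le_rfl
  have hxm' := (hx' j₀).mono (hm j₀) le_rfl
  have hym' := (hy' j₀).mono (hm j₀) le_rfl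
  have hK2 : ∀ j, MemLp (fun ω => K (U ω) (ζ j ω)) 2 μ := fun j =>
    (hH.memLp_noise hX hY hl (hζ j) (hlaw j) hxm' hxX' hym' hyY').sub
      ((hH.memLp_noise hX hY hl (hζ j) (hlaw j) hxm hxX hym hyY).const_smul (1 - γ))
  have hdx : Integrable (fun ω => ‖x' ω - x ω‖ ^ 2) μ := by
    refine Integrable.of_bound ((hxm'.sub hxm).norm.pow_const 2).aestronglyMeasurable
      (Metric.diam P.X ^ 2) (Eventually.of_forall fun ω => ?_)
    have := Metric.dist_le_diam_of_mem hX.isBounded (hxX' ω) (hxX ω)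
    rw [dist_eq_norm] at this
    rw [Real.norm_of_nonneg (by positivity)]
    gcongr
  have hdy : Integrable (fun ω => ‖y' ω - y ω‖ ^ 2) μ := by
    refine Integrable.of_bound ((hym'.sub hym).norm.pow_const 2).aestronglyMeasurable
      (Metric.diam P.Y ^ 2) (Eventually.of_forall fun ω => ?_)
    have := Metric.dist_le_diam_of_mem hY.isBounded (hyY' ω) (hyY ω)
    rw [dist_eq_norm] at this
    rw [Real.norm_of_nonneg (by positivity)]
    gcongr
  have hBi : Integrable (fun ω => B (U ω)) μ :=
    (integrable_const _).add ((hdx.add hdy).const_mul _)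
  have key := integral_norm_sq_add_average_le hb hζ hlaw hm hind hmζ hU he he2 hK hKi hK0 hK2
    hB hBi (1 - γ)
  have hBU : ∫ ω, B (U ω) ∂μ = 2 * γ ^ 2 * δ ^ 2 +
        16 * l ^ 2 * ((∫ ω, ‖x' ω - x ω‖ ^ 2 ∂μ) + ∫ ω, ‖y' ω - y ω‖ ^ 2 ∂μ) := by
    have hs : Integrable (fun ω => ‖x' ω - x ω‖ ^ 2 + ‖y' ω - y ω‖ ^ 2) μ := hdx.add hdy
    simp only [B, U]
    rw [integral_add (integrable_const _) (hs.const_mul _), integral_const_mul (16 * l ^ 2),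
      integral_add hdx hdy]
    simp
  rw [hBU] at key
  exact key

end MinimaxProblem.IsOracle

/-! ### Continuity of the maximizer and of the primal function. -/

theorem measurable_comp_of_continuousOn {Ω E F : Type*} [MeasurableSpace Ω] [TopologicalSpace E]
    [MeasurableSpace E] [OpensMeasurableSpace E] [TopologicalSpace F] [MeasurableSpace F]
    [BorelSpace F] {S : Set E} {f : E → F} (hf : ContinuousOn f S) {ξ : Ω → E} (hξ : Measurable ξ)
    (hS : ∀ ω, ξ ω ∈ S) : Measurable fun ω => f (ξ ω) :=
  (continuousOn_iff_continuous_domRestrict.1 hf).measurable.comp (hξ.subtype_mk (h := hS))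

theorem continuousOn_of_norm_sub_le {E F : Type*} [NormedAddCommGroup E]
    [NormedAddCommGroup F] {S : Set E} {f : E → F} {B C : ℝ}
    (h : ∀ x ∈ S, ∀ x' ∈ S, ‖f x' - f x‖ ≤ B * ‖x' - x‖ + C * ‖x' - x‖ ^ 2) :
    ContinuousOn f S := by
  intro x hx
  refine tendsto_iff_norm_sub_tendsto_zero.2 ?_
  have h1 : Continuous fun x' : E => B * ‖x' - x‖ + C * ‖x' - x‖ ^ 2 := by fun_prop
  have h2 := (h1.tendsto x).mono_left (nhdsWithin_le_nhds (s := S))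
  simp only [sub_self, norm_zero, mul_zero, ne_eq, OfNat.ofNat_ne_zero, not_false_eq_true,
    zero_pow, add_zero] at h2
  refine squeeze_zero' (Eventually.of_forall fun _ => norm_nonneg _) ?_ h2
  filter_upwards [self_mem_nhdsWithin] with x' hx' using h x hx x' hx'

namespace MinimaxProblem.IsRegular

variable {dx dy : ℕ} {Ξ : Type*} [MeasurableSpace Ξ] {P : MinimaxProblem dx dy Ξ} {l : ℝ}

theorem continuousOn_argmaxY (h : P.IsRegular l) {ρ : ℝ} (hρ : 0 < ρ) :
    ContinuousOn (P.argmaxY ρ) P.X := by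
  refine continuousOn_of_norm_sub_le (B := l / ρ) (C := 0) fun x hx x' hx' => ?_
  have := h.norm_argmaxY_sub_le hx hx' (le_refl ρ)
  rw [sub_self, zero_mul, add_zero] at this
  rw [zero_mul, add_zero, div_mul_eq_mul_div, le_div_iff₀ hρ]
  linarith

theorem continuousOn_maxY (h : P.IsRegular l) {ρ : ℝ} (hρ : 0 < ρ) :
    ContinuousOn (P.maxY ρ) P.X := by
  obtain ⟨x₀, hx₀⟩ := h.X_nonempty
  obtain ⟨y₀, hy₀⟩ := h.Y_nonempty
  set B := ‖gradX P.g x₀ y₀‖ + l * (Metric.diam P.X + Metric.diam P.Y)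
  have hB : ∀ x ∈ P.X, ‖gradX P.g x (P.argmaxY ρ x)‖ ≤ B := by
    intro x hx
    have hy := (h.argmaxY_spec (ρ := ρ) hx).1
    have e1 := h.lipX x hx x₀ hx₀ _ hy _ hy₀
    have e3 := Metric.dist_le_diam_of_mem h.X_compact.isBounded hx hx₀
    have e4 := Metric.dist_le_diam_of_mem h.Y_compact.isBounded hy hy₀
    rw [dist_eq_norm] at e3 e4
    have e5 := norm_le_norm_add_norm_sub' (gradX P.g x (P.argmaxY ρ x)) (gradX P.g x₀ y₀)
    refine e5.trans (add_le_add_right (e1.trans ?_) _)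
    have := h.l_nonneg
    gcongr
  have key : ∀ x ∈ P.X, ∀ x' ∈ P.X, P.maxY ρ x' - P.maxY ρ x ≤
      B * ‖x' - x‖ + (l + l ^ 2 / ρ) / 2 * ‖x' - x‖ ^ 2 := by
    intro x hx x' hx'
    have e1 := h.maxY_le_quadratic hx hx' hρ
    have e2 := real_inner_le_norm (gradX P.g x (P.argmaxY ρ x)) (x' - x)
    have e3 := mul_le_mul_of_nonneg_right (hB x hx) (norm_nonneg (x' - x))
    linarith
  refine continuousOn_of_norm_sub_le (B := B) (C := (l + l ^ 2 / ρ) / 2) fun x hx x' hx' => ?_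
  rw [Real.norm_eq_abs, abs_le]
  have h1 := key x hx x' hx'
  have h2 := key x' hx' x hx
  rw [norm_sub_rev] at h2
  constructor <;> linarith

end MinimaxProblem.IsRegular

/-- A run of the method under all the assumptions on problem, parameters and sampling. -/
structure IsAdmissibleRun {dx dy : ℕ} {Ξ Ω : Type*} [MeasurableSpace Ξ] [MeasurableSpace Ω]
    (P : MinimaxProblem dx dy Ξ) (p : Params) (μ : Measure Ω) (ζ : ℕ → Fin p.b → Ω → Ξ)
    (x₁ : Vec dx) (y₁ : Vec dy) (x : ℕ → Ω → Vec dx) (y : ℕ → Ω → Vec dy)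
    (v : ℕ → Ω → Vec dx) (w : ℕ → Ω → Vec dy) : Prop where
  valid : p.Valid
  standard : P.IsStandard
  lipschitz : P.LipschitzGradients p.l
  variance : P.BoundedVariance p.δ
  sampling : IsSampling P μ ζ
  x₁_mem : x₁ ∈ P.X
  y₁_mem : y₁ ∈ P.Y
  run : IsRun P p ζ x₁ y₁ x y v w

/-! ### Feasibility and measurability of the iterates, recursions of the estimator errors. -/

namespace Params

variable {p : Params}

theorem η_pos (k : ℕ) : 0 < p.η k := by unfold η; positivity

theorem η_le_one (k : ℕ) : p.η k ≤ 1 := by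
  unfold η
  rw [div_le_one (by positivity)]
  exact Real.one_le_rpow (by linarith [Nat.cast_nonneg (α := ℝ) k]) (by norm_num)

end Params

variable {dx dy : ℕ} {Ξ Ω : Type*} [MeasurableSpace Ξ] {P : MinimaxProblem dx dy Ξ} {p : Params}

theorem batchGradX_eq {b : ℕ} (ρ : ℝ) (I : Fin b → Ξ) (x : Vec dx) (y : Vec dy) :
    P.batchGradX ρ I x y = (1 / (b : ℝ)) • ∑ j, gradX (P.sample (I j)) x y := by
  simp only [MinimaxProblem.batchGradX, gradX_regularize]

theorem batchGradY_eq (hP : P.IsStandard) {b : ℕ} (hb : 0 < b) (ρ : ℝ) (I : Fin b → Ξ) {x : Vec dx}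
    {y : Vec dy} (hx : x ∈ P.X) (hy : y ∈ P.Y) :
    P.batchGradY ρ I x y = (1 / (b : ℝ)) • (∑ j, gradY (P.sample (I j)) x y) - ρ • y := by
  have hb' : (b : ℝ) ≠ 0 := by positivity
  simp only [MinimaxProblem.batchGradY,
    gradY_regularize (MinimaxProblem.sample_differentiableAt_right hP _ hx hy),
    Finset.sum_sub_distrib, Finset.sum_const, Finset.card_univ, Fintype.card_fin, smul_sub]
  rw [← Nat.cast_smul_eq_nsmul ℝ, smul_smul, one_div_mul_cancel hb', one_smul]

/-- The error of a momentum estimator is its damped predecessor plus an average of centered noise.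
With γ = 1 it also describes the first estimators. -/
theorem estimator_error_eq {d b : ℕ} (hb : 0 < b) (γ : ℝ) (v h h' : Vec d) (A B : Fin b → Vec d) :
    (1 - γ) • (v - h) + (1 / (b : ℝ)) • ∑ j, ((A j - h') - (1 - γ) • (B j - h)) =
      (1 / (b : ℝ)) • (∑ j, A j) + (1 - γ) • (v - (1 / (b : ℝ)) • ∑ j, B j) - h' := by
  have hb' : (b : ℝ) ≠ 0 := by positivity
  have hs : ∑ j, ((A j - h') - (1 - γ) • (B j - h)) =
      (∑ j, A j) - (b : ℝ) • h' - (1 - γ) • ((∑ j, B j) - (b : ℝ) • h) := by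
    simp only [Finset.sum_sub_distrib, ← Finset.smul_sum, Finset.sum_const, Finset.card_univ,
      Fintype.card_fin, Nat.cast_smul_eq_nsmul]
  rw [hs]
  match_scalars <;> field_simp
  ring

/-- The iterates up to `k`, and the points `(x, y)` of iteration `k + 1`, are functions of the
samples of the first `k` iterations. -/
theorem IsRun.measurable_iterates [m : MeasurableSpace Ω] {ζ : ℕ → Fin p.b → Ω → Ξ} {x₁ : Vec dx}
    {y₁ : Vec dy} {x : ℕ → Ω → Vec dx} {y : ℕ → Ω → Vec dy} {v : ℕ → Ω → Vec dx}
    {w : ℕ → Ω → Vec dy} {l δ : ℝ} (hP : P.IsStandard) (hb : 0 < p.b)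
    (hX : P.IsOracle l δ (fun ζ => gradX (P.sample ζ)) (gradX P.g))
    (hY : P.IsOracle l δ (fun ζ => gradY (P.sample ζ)) (gradY P.g))
    (hrun : IsRun P p ζ x₁ y₁ x y v w) (hmem : ∀ k, 1 ≤ k → ∀ ω, x k ω ∈ P.X ∧ y k ω ∈ P.Y)
    (k : ℕ) (hk : 1 ≤ k) (hm : ∀ i ≤ k, ∀ j, Measurable (ζ i j)) :
    Measurable (x k) ∧ Measurable (y k) ∧ Measurable (v k) ∧ Measurable (w k) ∧
      Measurable (x (k + 1)) ∧ Measurable (y (k + 1)) := by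
  have hnext : ∀ k, 1 ≤ k → Measurable (x k) → Measurable (y k) → Measurable (v k) →
      Measurable (w k) → Measurable (x (k + 1)) ∧ Measurable (y (k + 1)) := by
    intro k hk hx hy hv hw
    have ex : x (k + 1) = fun ω => x k ω + p.η k • (proj P.X (x k ω - p.α k • v k ω) - x k ω) :=
      funext (hrun.x_succ k hk)
    have ey : y (k + 1) = fun ω => y k ω + p.η k • (proj P.Y (y k ω + p.β • w k ω) - y k ω) :=
      funext (hrun.y_succ k hk)
    have hpx := (continuous_proj hP.X_nonempty hP.X_compact.isClosed
      hP.X_convex).measurable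
    have hpy := (continuous_proj hP.Y_nonempty hP.Y_compact.isClosed
      hP.Y_convex).measurable
    rw [ex, ey]
    exact ⟨hx.add (((hpx.comp (hx.sub (hv.const_smul (p.α k)))).sub hx).const_smul (p.η k)),
      hy.add (((hpy.comp (hy.add (hw.const_smul p.β))).sub hy).const_smul (p.η k))⟩
  have hbX : ∀ (ρ : ℝ) (i k : ℕ), 1 ≤ k → (∀ j, Measurable (ζ i j)) → Measurable (x k) →
      Measurable (y k) →
      Measurable fun ω => P.batchGradX ρ (fun j => ζ i j ω) (x k ω) (y k ω) := by
    intro ρ i k hk hζ hx hy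
    simp only [batchGradX_eq]
    exact (Finset.measurable_sum _ fun j _ => hX.measurable_comp (hζ j) hx
      (fun ω => (hmem k hk ω).1) hy (fun ω => (hmem k hk ω).2)).const_smul
        (1 / (p.b : ℝ))
  have hbY : ∀ (ρ : ℝ) (i k : ℕ), 1 ≤ k → (∀ j, Measurable (ζ i j)) → Measurable (x k) →
      Measurable (y k) →
      Measurable fun ω => P.batchGradY ρ (fun j => ζ i j ω) (x k ω) (y k ω) := by
    intro ρ i k hk hζ hx hy
    have e : (fun ω => P.batchGradY ρ (fun j => ζ i j ω) (x k ω) (y k ω)) = fun ω =>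
        (1 / (p.b : ℝ)) • (∑ j, gradY (P.sample (ζ i j ω)) (x k ω) (y k ω)) - ρ • y k ω :=
      funext fun ω => batchGradY_eq hP hb _ _ (hmem k hk ω).1
        (hmem k hk ω).2
    rw [e]
    exact ((Finset.measurable_sum _ fun j _ => hY.measurable_comp (hζ j) hx
      (fun ω => (hmem k hk ω).1) hy (fun ω => (hmem k hk ω).2)).const_smul
        (1 / (p.b : ℝ))).sub (hy.const_smul ρ)
  suffices hmain : ∀ n, 1 ≤ n → n ≤ k → Measurable (x n) ∧ Measurable (y n) ∧
      Measurable (v n) ∧ Measurable (w n) by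
    obtain ⟨h1, h2, h3, h4⟩ := hmain k hk le_rfl
    exact ⟨h1, h2, h3, h4, hnext k hk h1 h2 h3 h4⟩
  intro n hn
  induction n, hn using Nat.le_induction with
  | base =>
    intro h1k
    have ex : x 1 = fun _ => x₁ := funext hrun.x_one
    have ey : y 1 = fun _ => y₁ := funext hrun.y_one
    have hx : Measurable (x 1) := ex ▸ measurable_const
    have hy : Measurable (y 1) := ey ▸ measurable_const
    refine ⟨hx, hy, ?_, ?_⟩
    · rw [funext hrun.v_one]
      exact hbX _ 1 1 le_rfl (hm 1 h1k) hx hy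
    · rw [funext hrun.w_one]
      exact hbY _ 1 1 le_rfl (hm 1 h1k) hx hy
  | succ n hn ih =>
    intro hnk
    obtain ⟨h1, h2, h3, h4⟩ := ih (by omega)
    obtain ⟨h5, h6⟩ := hnext n hn h1 h2 h3 h4
    refine ⟨h5, h6, ?_, ?_⟩
    · rw [funext (hrun.v_succ n hn)]
      exact (hbX _ (n + 1) (n + 1) (by omega) (hm _ hnk) h5 h6).add
        ((h3.sub (hbX _ (n + 1) n hn (hm _ hnk) h1 h2)).const_smul (1 - p.γ n))
    · rw [funext (hrun.w_succ n hn)]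
      exact (hbY _ (n + 1) (n + 1) (by omega) (hm _ hnk) h5 h6).add
        ((h4.sub (hbY _ (n + 1) n hn (hm _ hnk) h1 h2)).const_smul (1 - p.θ n))

namespace IsAdmissibleRun

variable [MeasurableSpace Ω] {μ : Measure Ω} {ζ : ℕ → Fin p.b → Ω → Ξ} {x₁ : Vec dx} {y₁ : Vec dy}
  {x : ℕ → Ω → Vec dx} {y : ℕ → Ω → Vec dy} {v : ℕ → Ω → Vec dx} {w : ℕ → Ω → Vec dy}
  (R : IsAdmissibleRun P p μ ζ x₁ y₁ x y v w)

include R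

theorem regular : P.IsRegular p.l :=
  MinimaxProblem.isRegular R.valid.l_pos.le R.standard R.lipschitz R.variance

theorem oracleX : P.IsOracle p.l p.δ (fun ζ => gradX (P.sample ζ)) (gradX P.g) :=
  (MinimaxProblem.isOracle_gradX R.standard R.lipschitz R.variance).1

theorem oracleY : P.IsOracle p.l p.δ (fun ζ => gradY (P.sample ζ)) (gradY P.g) :=
  (MinimaxProblem.isOracle_gradY R.standard R.lipschitz R.variance).1

theorem projX_mem (u : Vec dx) : proj P.X u ∈ P.X :=
  (proj_spec R.standard.X_nonempty R.standard.X_compact.isClosed u).1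

theorem projY_mem (u : Vec dy) : proj P.Y u ∈ P.Y :=
  (proj_spec R.standard.Y_nonempty R.standard.Y_compact.isClosed u).1

theorem mem_feasible (k : ℕ) (hk : 1 ≤ k) (ω : Ω) : x k ω ∈ P.X ∧ y k ω ∈ P.Y := by
  induction k, hk using Nat.le_induction with
  | base => rw [R.run.x_one, R.run.y_one]; exact ⟨R.x₁_mem, R.y₁_mem⟩
  | succ k hk ih =>
    rw [R.run.x_succ k hk, R.run.y_succ k hk]
    exact ⟨R.standard.X_convex.add_smul_sub_mem ih.1 (R.projX_mem _)
        ⟨Params.η_pos k |>.le, Params.η_le_one k⟩,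
      R.standard.Y_convex.add_smul_sub_mem ih.2 (R.projY_mem _)
        ⟨Params.η_pos k |>.le, Params.η_le_one k⟩⟩

theorem v_error_succ {k : ℕ} (hk : 1 ≤ k) (ω : Ω) :
    v (k + 1) ω - gradX P.g (x (k + 1) ω) (y (k + 1) ω) =
      (1 - p.γ k) • (v k ω - gradX P.g (x k ω) (y k ω)) + (1 / (p.b : ℝ)) • ∑ j,
        ((gradX (P.sample (ζ (k + 1) j ω)) (x (k + 1) ω) (y (k + 1) ω)
            - gradX P.g (x (k + 1) ω) (y (k + 1) ω)) -
          (1 - p.γ k) • (gradX (P.sample (ζ (k + 1) j ω)) (x k ω) (y k ω)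
            - gradX P.g (x k ω) (y k ω))) := by
  rw [estimator_error_eq R.valid.b_pos, R.run.v_succ k hk, batchGradX_eq, batchGradX_eq]

/-- The regularization enters each batch gradient as the exact term -ρ_k y_k, which cancels against
the mean. The change of ρ_k therefore adds nothing to the error. -/
theorem w_error_succ {k : ℕ} (hk : 1 ≤ k) (ω : Ω) :
    w (k + 1) ω - (gradY P.g (x (k + 1) ω) (y (k + 1) ω) - p.ρ (k + 1) • y (k + 1) ω) =
      (1 - p.θ k) • (w k ω - (gradY P.g (x k ω) (y k ω) - p.ρ k • y k ω)) +
        (1 / (p.b : ℝ)) • ∑ j,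
        ((gradY (P.sample (ζ (k + 1) j ω)) (x (k + 1) ω) (y (k + 1) ω)
            - gradY P.g (x (k + 1) ω) (y (k + 1) ω)) -
          (1 - p.θ k) • (gradY (P.sample (ζ (k + 1) j ω)) (x k ω) (y k ω)
            - gradY P.g (x k ω) (y k ω))) := by
  have e : ∀ a g r : Vec dy, a - (g - r) = (a + r) - g := fun a g r => by abel
  rw [e (w k ω), estimator_error_eq R.valid.b_pos, R.run.w_succ k hk,
    batchGradY_eq R.standard R.valid.b_pos _ _ (R.mem_feasible (k + 1) (by omega) ω).1
      (R.mem_feasible (k + 1) (by omega) ω).2,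
    batchGradY_eq R.standard R.valid.b_pos _ _ (R.mem_feasible k hk ω).1 (R.mem_feasible k hk ω).2]
  module

/-- The σ-algebra is arbitrary so that it can be the one generated by all samples except one of
batch k + 1. The points of iteration k + 1 are included, as they do not use that batch. -/
theorem measurable_iterates (k : ℕ) (hk : 1 ≤ k) : ∀ m : MeasurableSpace Ω,
    (∀ i ≤ k, ∀ j, Measurable[m] (ζ i j)) →
    Measurable[m] (x k) ∧ Measurable[m] (y k) ∧ Measurable[m] (v k) ∧ Measurable[m] (w k) ∧
      Measurable[m] (x (k + 1)) ∧ Measurable[m] (y (k + 1)) := by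
  -- The defining equations do not involve a σ-algebra, so the same run can be reassembled over `m`.
  obtain ⟨h1, h2, h3, h4, h5, h6, h7, h8⟩ := R.run
  have hP := R.standard
  have hb := R.valid.b_pos
  have hX := R.oracleX
  have hY := R.oracleY
  have hmem := R.mem_feasible
  intro m hm
  exact IsRun.measurable_iterates hP hb hX hY ⟨h1, h2, h3, h4, h5, h6, h7, h8⟩ hmem k hk hm

end IsAdmissibleRun

theorem integrable_of_bounded {Ω : Type*} [MeasurableSpace Ω] {μ : Measure Ω}
    [IsProbabilityMeasure μ] {f : Ω → ℝ} (hf : Measurable f) {C : ℝ} (h0 : ∀ ω, 0 ≤ f ω)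
    (hC : ∀ ω, f ω ≤ C) : Integrable f μ :=
  Integrable.of_bound hf.aestronglyMeasurable C
    (Eventually.of_forall fun ω => by rw [Real.norm_of_nonneg (h0 ω)]; exact hC ω)

theorem sq_norm_sub_le_sq_diam {E : Type*} [NormedAddCommGroup E] {K : Set E} (hK : IsCompact K)
    {a b : E} (ha : a ∈ K) (hb : b ∈ K) : ‖a - b‖ ^ 2 ≤ Metric.diam K ^ 2 := by
  have := Metric.dist_le_diam_of_mem hK.isBounded ha hb
  rw [dist_eq_norm] at this
  gcongr

theorem sq_integral_le_integral_sq {Ω : Type*} [MeasurableSpace Ω] {μ : Measure Ω}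
    [IsProbabilityMeasure μ] {f : Ω → ℝ} (hf : MemLp f 2 μ) :
    (∫ ω, f ω ∂μ) ^ 2 ≤ ∫ ω, f ω ^ 2 ∂μ := by
  have h1 := variance_nonneg f μ
  rw [variance_eq_sub hf] at h1
  simpa using h1

/-- In an independent family, the remaining variables generate a σ-algebra independent of any given
one. -/
theorem exists_indep_measurableSpace {ι Ω Ξ : Type*} [MeasurableSpace Ξ] {mΩ : MeasurableSpace Ω}
    {μ : Measure Ω} {f : ι → Ω → Ξ} (hf : ∀ i, Measurable (f i)) (hind : iIndepFun f μ) (q : ι) :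
    ∃ m : MeasurableSpace Ω, m ≤ mΩ ∧
      Indep m (MeasurableSpace.comap (f q) inferInstance) μ ∧ ∀ r, r ≠ q → Measurable[m] (f r) := by
  refine ⟨⨆ r ∈ ({q}ᶜ : Set ι), MeasurableSpace.comap (f r) inferInstance,
    iSup₂_le fun r _ => (hf r).comap_le, ?_, fun r hr =>
      measurable_iff_comap_le.2 (le_iSup₂_of_le r (by simpa using hr) le_rfl)⟩
  have h := indep_iSup_of_disjoint (m := fun r => MeasurableSpace.comap (f r) inferInstance)
    (fun r => (hf r).comap_le) hind.iIndep (S := {q}ᶜ) (T := {q})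
    (Set.disjoint_compl_left_iff_subset.2 le_rfl)
  rwa [iSup_singleton] at h

namespace IsAdmissibleRun

variable {dx dy : ℕ} {Ξ Ω : Type*} [MeasurableSpace Ξ] {P : MinimaxProblem dx dy Ξ} {p : Params}
  [MeasurableSpace Ω] {μ : Measure Ω} {ζ : ℕ → Fin p.b → Ω → Ξ} {x₁ : Vec dx} {y₁ : Vec dy}
  {x : ℕ → Ω → Vec dx} {y : ℕ → Ω → Vec dy} {v : ℕ → Ω → Vec dx} {w : ℕ → Ω → Vec dy}
  (R : IsAdmissibleRun P p μ ζ x₁ y₁ x y v w)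

include R

theorem measurable_iterates' (k : ℕ) (hk : 1 ≤ k) :
    Measurable (x k) ∧ Measurable (y k) ∧ Measurable (v k) ∧ Measurable (w k) := by
  obtain ⟨h1, h2, h3, h4, -⟩ := R.measurable_iterates k hk _ fun i _ j => R.sampling.measurable i j
  exact ⟨h1, h2, h3, h4⟩

theorem measurable_errors (k : ℕ) (hk : 1 ≤ k) : ∀ m : MeasurableSpace Ω,
    (∀ i ≤ k, ∀ j, Measurable[m] (ζ i j)) →
    Measurable[m] (fun ω => v k ω - gradX P.g (x k ω) (y k ω)) ∧
    Measurable[m] (fun ω => w k ω - (gradY P.g (x k ω) (y k ω) - p.ρ k • y k ω)) := by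
  have := R.standard.isProbability
  have hX := R.oracleX
  have hY := R.oracleY
  have hmeas := R.measurable_iterates k hk
  have hmem := R.mem_feasible k hk
  intro m hm
  obtain ⟨h1, h2, h3, h4, -⟩ := hmeas m hm
  exact ⟨h3.sub (hX.measurable_mean_comp h1 (fun ω => (hmem ω).1) h2 (fun ω => (hmem ω).2)),
    h4.sub ((hY.measurable_mean_comp h1 (fun ω => (hmem ω).1) h2 (fun ω => (hmem ω).2)).sub
      (h2.const_smul (p.ρ k)))⟩

/-- The recursion of the mean squared error of a momentum estimator of the method, for an oracle
with `g`-independent shape. -/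
theorem estimator_step [IsProbabilityMeasure μ] {d : ℕ} {H : Ξ → Vec dx → Vec dy → Vec d}
    {h : Vec dx → Vec dy → Vec d} (hH : P.IsOracle p.l p.δ H h) {k : ℕ} (hk : 1 ≤ k)
    {e e' : Ω → Vec d} (γ : ℝ)
    (he : ∀ m : MeasurableSpace Ω, (∀ i ≤ k, ∀ j, Measurable[m] (ζ i j)) → Measurable[m] e)
    (he2 : MemLp e 2 μ)
    (hrec : ∀ ω, e' ω = (1 - γ) • e ω + (1 / (p.b : ℝ)) • ∑ j,
      ((H (ζ (k + 1) j ω) (x (k + 1) ω) (y (k + 1) ω) - h (x (k + 1) ω) (y (k + 1) ω)) -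
        (1 - γ) • (H (ζ (k + 1) j ω) (x k ω) (y k ω) - h (x k ω) (y k ω)))) :
    MemLp e' 2 μ ∧ ∫ ω, ‖e' ω‖ ^ 2 ∂μ ≤ (1 - γ) ^ 2 * (∫ ω, ‖e ω‖ ^ 2 ∂μ) +
      (1 / (p.b : ℝ)) * (2 * γ ^ 2 * p.δ ^ 2 + 16 * p.l ^ 2 * p.η k ^ 2 *
        ((∫ ω, ‖proj P.X (x k ω - p.α k • v k ω) - x k ω‖ ^ 2 ∂μ) +
          ∫ ω, ‖proj P.Y (y k ω + p.β • w k ω) - y k ω‖ ^ 2 ∂μ)) := by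
  have := R.standard.isProbability
  -- `m j` is generated by all samples other than ζ^{k+1}_j. It contains the first k batches and the
  -- rest of batch k + 1.
  choose m hm hind hmne using fun j : Fin p.b =>
    exists_indep_measurableSpace (fun q : ℕ × Fin p.b => R.sampling.measurable q.1 q.2)
      R.sampling.indep (k + 1, j)
  have hζ : ∀ i j, i ≠ j → Measurable[m j] (ζ (k + 1) i) := fun i j hij =>
    hmne j (k + 1, i) fun h => hij (Prod.ext_iff.1 h).2
  have hmeas : ∀ j, ∀ i ≤ k, ∀ j', Measurable[m j] (ζ i j') := fun j i hi j' =>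
    hmne j (i, j') fun h => absurd (Prod.ext_iff.1 h).1 (by simp only; omega)
  have hiter := fun j => R.measurable_iterates k hk (m j) (hmeas j)
  have key := hH.integral_norm_sq_estimator_le (μ := μ) R.standard.X_compact R.standard.Y_compact
    R.valid.l_pos.le R.valid.b_pos (fun j => R.sampling.measurable (k + 1) j)
    (fun j => R.sampling.law (k + 1) j) hm hind hζ
    (e := e) (fun j => he _ (hmeas j)) he2 (fun j => (hiter j).1) (fun j => (hiter j).2.2.2.2.1)
    (fun j => (hiter j).2.1) (fun j => (hiter j).2.2.2.2.2)
    (fun ω => (R.mem_feasible k hk ω).1) (fun ω => (R.mem_feasible (k + 1) (by omega) ω).1)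
    (fun ω => (R.mem_feasible k hk ω).2) (fun ω => (R.mem_feasible (k + 1) (by omega) ω).2) γ
  have hfun : e' = _ := funext hrec
  rw [← hfun] at key
  refine ⟨key.1, key.2.trans_eq ?_⟩
  have hX : ∀ ω, ‖x (k + 1) ω - x k ω‖ ^ 2 =
      p.η k ^ 2 * ‖proj P.X (x k ω - p.α k • v k ω) - x k ω‖ ^ 2 := fun ω => by
    rw [R.run.x_succ k hk, add_sub_cancel_left, norm_smul, mul_pow, Real.norm_eq_abs, sq_abs]
  have hY : ∀ ω, ‖y (k + 1) ω - y k ω‖ ^ 2 =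
      p.η k ^ 2 * ‖proj P.Y (y k ω + p.β • w k ω) - y k ω‖ ^ 2 := fun ω => by
    rw [R.run.y_succ k hk, add_sub_cancel_left, norm_smul, mul_pow, Real.norm_eq_abs, sq_abs]
  simp only [hX, hY, integral_const_mul]
  ring

theorem memLp_v_error [IsProbabilityMeasure μ] (k : ℕ) (hk : 1 ≤ k) :
    MemLp (fun ω => v k ω - gradX P.g (x k ω) (y k ω)) 2 μ := by
  have := R.standard.isProbability
  induction k, hk using Nat.le_induction with
  | base =>
    have e : (fun ω => v 1 ω - gradX P.g (x 1 ω) (y 1 ω)) = fun ω => (1 / (p.b : ℝ)) • ∑ j,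
        (gradX (P.sample (ζ 1 j ω)) (x 1 ω) (y 1 ω) - gradX P.g (x 1 ω) (y 1 ω)) := by
      funext ω
      have := estimator_error_eq R.valid.b_pos 1 0 0 (gradX P.g (x 1 ω) (y 1 ω))
        (fun j => gradX (P.sample (ζ 1 j ω)) (x 1 ω) (y 1 ω)) 0
      rw [R.run.v_one, batchGradX_eq]
      simpa using this.symm
    rw [e]
    obtain ⟨hx, hy, -⟩ := R.measurable_iterates' 1 le_rfl
    exact (memLp_finsetSum _ fun j _ => R.oracleX.memLp_noise R.standard.X_compact
      R.standard.Y_compact R.valid.l_pos.le (R.sampling.measurable 1 j) (R.sampling.law 1 j) hx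
      (fun ω => (R.mem_feasible 1 le_rfl ω).1) hy
      (fun ω => (R.mem_feasible 1 le_rfl ω).2)).const_smul (1 / (p.b : ℝ))
  | succ k hk ih =>
    have hme := R.measurable_errors k hk
    exact (R.estimator_step R.oracleX hk (p.γ k) (fun m hm => (hme m hm).1) ih
      (fun ω => R.v_error_succ hk ω)).1

theorem memLp_w_error [IsProbabilityMeasure μ] (k : ℕ) (hk : 1 ≤ k) :
    MemLp (fun ω => w k ω - (gradY P.g (x k ω) (y k ω) - p.ρ k • y k ω)) 2 μ := by
  have := R.standard.isProbability
  induction k, hk using Nat.le_induction with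
  | base =>
    have e : (fun ω => w 1 ω - (gradY P.g (x 1 ω) (y 1 ω) - p.ρ 1 • y 1 ω)) =
        fun ω => (1 / (p.b : ℝ)) • ∑ j,
        (gradY (P.sample (ζ 1 j ω)) (x 1 ω) (y 1 ω) - gradY P.g (x 1 ω) (y 1 ω)) := by
      funext ω
      have := estimator_error_eq R.valid.b_pos 1 0 0 (gradY P.g (x 1 ω) (y 1 ω))
        (fun j => gradY (P.sample (ζ 1 j ω)) (x 1 ω) (y 1 ω)) 0
      rw [R.run.w_one, batchGradY_eq R.standard R.valid.b_pos _ _ (R.mem_feasible 1 le_rfl ω).1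
        (R.mem_feasible 1 le_rfl ω).2, sub_sub_sub_cancel_right]
      simpa using this.symm
    rw [e]
    obtain ⟨hx, hy, -⟩ := R.measurable_iterates' 1 le_rfl
    exact (memLp_finsetSum _ fun j _ => R.oracleY.memLp_noise R.standard.X_compact
      R.standard.Y_compact R.valid.l_pos.le (R.sampling.measurable 1 j) (R.sampling.law 1 j) hx
      (fun ω => (R.mem_feasible 1 le_rfl ω).1) hy
      (fun ω => (R.mem_feasible 1 le_rfl ω).2)).const_smul (1 / (p.b : ℝ))
  | succ k hk ih =>
    have hme := R.measurable_errors k hk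
    exact (R.estimator_step R.oracleY hk (p.θ k) (fun m hm => (hme m hm).2) ih
      (fun ω => R.w_error_succ hk ω)).1

end IsAdmissibleRun

/-- Mean squared error of the estimator `v k`. -/
def vErr {dx dy : ℕ} {Ξ Ω : Type*} [MeasurableSpace Ξ] [MeasurableSpace Ω]
    (P : MinimaxProblem dx dy Ξ) (μ : Measure Ω) (x : ℕ → Ω → Vec dx) (y : ℕ → Ω → Vec dy)
    (v : ℕ → Ω → Vec dx) (k : ℕ) : ℝ :=
  ∫ ω, ‖v k ω - gradX P.g (x k ω) (y k ω)‖ ^ 2 ∂μ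

/-- Mean squared error of the estimator `w k`. -/
def wErr {dx dy : ℕ} {Ξ Ω : Type*} [MeasurableSpace Ξ] [MeasurableSpace Ω]
    (P : MinimaxProblem dx dy Ξ) (p : Params) (μ : Measure Ω) (x : ℕ → Ω → Vec dx)
    (y : ℕ → Ω → Vec dy) (w : ℕ → Ω → Vec dy) (k : ℕ) : ℝ :=
  ∫ ω, ‖w k ω - (gradY P.g (x k ω) (y k ω) - p.ρ k • y k ω)‖ ^ 2 ∂μ

/-- Mean squared length of the projected step in `x`. -/
def xStep {dx dy : ℕ} {Ξ Ω : Type*} [MeasurableSpace Ξ] [MeasurableSpace Ω]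
    (P : MinimaxProblem dx dy Ξ) (p : Params) (μ : Measure Ω) (x : ℕ → Ω → Vec dx)
    (v : ℕ → Ω → Vec dx) (k : ℕ) : ℝ :=
  ∫ ω, ‖proj P.X (x k ω - p.α k • v k ω) - x k ω‖ ^ 2 ∂μ

/-- Mean squared length of the projected step in `y`. -/
def yStep {dx dy : ℕ} {Ξ Ω : Type*} [MeasurableSpace Ξ] [MeasurableSpace Ω]
    (P : MinimaxProblem dx dy Ξ) (p : Params) (μ : Measure Ω) (y : ℕ → Ω → Vec dy)
    (w : ℕ → Ω → Vec dy) (k : ℕ) : ℝ :=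
  ∫ ω, ‖proj P.Y (y k ω + p.β • w k ω) - y k ω‖ ^ 2 ∂μ

/-- Mean squared distance of `y k` from the maximizer. -/
def yGap {dx dy : ℕ} {Ξ Ω : Type*} [MeasurableSpace Ξ] [MeasurableSpace Ω]
    (P : MinimaxProblem dx dy Ξ) (p : Params) (μ : Measure Ω) (x : ℕ → Ω → Vec dx)
    (y : ℕ → Ω → Vec dy) (k : ℕ) : ℝ :=
  ∫ ω, ‖y k ω - P.argmaxY (p.ρ k) (x k ω)‖ ^ 2 ∂μ

/-- Expected value of the regularized primal function. -/
def primal {dx dy : ℕ} {Ξ Ω : Type*} [MeasurableSpace Ξ] [MeasurableSpace Ω]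
    (P : MinimaxProblem dx dy Ξ) (p : Params) (μ : Measure Ω) (x : ℕ → Ω → Vec dx) (k : ℕ) : ℝ :=
  ∫ ω, P.maxY (p.ρ k) (x k ω) ∂μ

namespace IsAdmissibleRun

variable {dx dy : ℕ} {Ξ Ω : Type*} [MeasurableSpace Ξ] {P : MinimaxProblem dx dy Ξ} {p : Params}
  [MeasurableSpace Ω] {μ : Measure Ω} {ζ : ℕ → Fin p.b → Ω → Ξ} {x₁ : Vec dx} {y₁ : Vec dy}
  {x : ℕ → Ω → Vec dx} {y : ℕ → Ω → Vec dy} {v : ℕ → Ω → Vec dx} {w : ℕ → Ω → Vec dy}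
  (R : IsAdmissibleRun P p μ ζ x₁ y₁ x y v w)

include R

theorem vErr_succ_le [IsProbabilityMeasure μ] {k : ℕ} (hk : 1 ≤ k) :
    vErr P μ x y v (k + 1) ≤ (1 - p.γ k) ^ 2 * vErr P μ x y v k + (1 / (p.b : ℝ)) *
      (2 * p.γ k ^ 2 * p.δ ^ 2 + 16 * p.l ^ 2 * p.η k ^ 2 *
        (xStep P p μ x v k + yStep P p μ y w k)) :=
  have hme := R.measurable_errors k hk
  (R.estimator_step R.oracleX hk (p.γ k) (fun m hm => (hme m hm).1) (R.memLp_v_error k hk)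
    (fun ω => R.v_error_succ hk ω)).2

theorem wErr_succ_le [IsProbabilityMeasure μ] {k : ℕ} (hk : 1 ≤ k) :
    wErr P p μ x y w (k + 1) ≤ (1 - p.θ k) ^ 2 * wErr P p μ x y w k + (1 / (p.b : ℝ)) *
      (2 * p.θ k ^ 2 * p.δ ^ 2 + 16 * p.l ^ 2 * p.η k ^ 2 *
        (xStep P p μ x v k + yStep P p μ y w k)) :=
  have hme := R.measurable_errors k hk
  (R.estimator_step R.oracleY hk (p.θ k) (fun m hm => (hme m hm).2) (R.memLp_w_error k hk)
    (fun ω => R.w_error_succ hk ω)).2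

end IsAdmissibleRun

/-! ### One-step inequalities in expectation. -/

theorem integral_le_of_le_linear {Ω : Type*} [MeasurableSpace Ω] {μ : Measure Ω}
    [IsProbabilityMeasure μ] {f f₁ f₂ f₃ f₄ : Ω → ℝ} {c₁ c₂ c₃ c₄ c : ℝ} (hf : Integrable f μ)
    (h₁ : Integrable f₁ μ) (h₂ : Integrable f₂ μ) (h₃ : Integrable f₃ μ) (h₄ : Integrable f₄ μ)
    (h : ∀ ω, f ω ≤ c₁ * f₁ ω + c₂ * f₂ ω + c₃ * f₃ ω + c₄ * f₄ ω + c) :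
    ∫ ω, f ω ∂μ ≤ c₁ * (∫ ω, f₁ ω ∂μ) + c₂ * (∫ ω, f₂ ω ∂μ) + c₃ * (∫ ω, f₃ ω ∂μ)
      + c₄ * (∫ ω, f₄ ω ∂μ) + c := by
  have i₁ := h₁.const_mul c₁
  have i₂ := h₂.const_mul c₂
  have i₃ := h₃.const_mul c₃
  have i₄ := h₄.const_mul c₄
  have i₁₂ : Integrable (fun ω => c₁ * f₁ ω + c₂ * f₂ ω) μ := i₁.add i₂
  have i₁₂₃ : Integrable (fun ω => c₁ * f₁ ω + c₂ * f₂ ω + c₃ * f₃ ω) μ := i₁₂.add i₃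
  have i₁₂₃₄ : Integrable (fun ω => c₁ * f₁ ω + c₂ * f₂ ω + c₃ * f₃ ω + c₄ * f₄ ω) μ := i₁₂₃.add i₄
  have e : ∫ ω, (c₁ * f₁ ω + c₂ * f₂ ω + c₃ * f₃ ω + c₄ * f₄ ω + c) ∂μ =
      c₁ * (∫ ω, f₁ ω ∂μ) + c₂ * (∫ ω, f₂ ω ∂μ) + c₃ * (∫ ω, f₃ ω ∂μ)
      + c₄ * (∫ ω, f₄ ω ∂μ) + c := by
    rw [integral_add i₁₂₃₄ (integrable_const c), integral_add i₁₂₃ i₄, integral_add i₁₂ i₃,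
      integral_add i₁ i₂, integral_const_mul, integral_const_mul, integral_const_mul,
      integral_const_mul]
    simp
  rw [← e]
  exact integral_mono hf (i₁₂₃₄.add (integrable_const c)) h

theorem norm_add_sq_le_weighted {E : Type*} [SeminormedAddCommGroup E] (a b : E) {t : ℝ}
    (ht : 0 < t) : ‖a + b‖ ^ 2 ≤ (1 + t) * ‖a‖ ^ 2 + (1 + 1 / t) * ‖b‖ ^ 2 := by
  have h1 : ‖a + b‖ ^ 2 ≤ (‖a‖ + ‖b‖) ^ 2 := by gcongr; exact norm_add_le a b
  have h2 : 0 ≤ (t * ‖a‖ - ‖b‖) ^ 2 / t := by positivity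
  have h3 : (t * ‖a‖ - ‖b‖) ^ 2 / t = t * ‖a‖ ^ 2 + 1 / t * ‖b‖ ^ 2 - 2 * ‖a‖ * ‖b‖ := by
    field_simp
    ring
  nlinarith

/-- The triangle inequality in the plane: the bias κ sits in one coordinate and leaves the root with
coefficient 1, so that only the other terms pay the factor 2. -/
theorem le_sqrt_add_of_sq_eq {A a B c κ f s G : ℝ} (hG : 0 ≤ G) (hκ : 0 ≤ κ) (h : G ^ 2 = f ^ 2 + s ^ 2) (hf : 0 ≤ f)
    (hf' : f ≤ A + a) (hs : 0 ≤ s) (hs' : s ≤ B + c + κ) :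
    G ≤ √(2 * A ^ 2 + 2 * a ^ 2 + 2 * B ^ 2 + 2 * c ^ 2) + κ := by
  have hS : B + c ≤ √(2 * A ^ 2 + 2 * a ^ 2 + 2 * B ^ 2 + 2 * c ^ 2) := by
    apply Real.le_sqrt_of_sq_le
    nlinarith [sq_nonneg (B - c), sq_nonneg A, sq_nonneg a]
  refine (pow_le_pow_iff_left₀ hG (by positivity) two_ne_zero).1 ?_
  rw [h, add_sq, Real.sq_sqrt (by positivity)]
  have h3 : f ^ 2 ≤ (A + a) ^ 2 := by gcongr
  have h4 : s ^ 2 ≤ (B + c + κ) ^ 2 := by gcongr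
  have h5 := mul_le_mul_of_nonneg_right hS hκ
  nlinarith [sq_nonneg (A - a), sq_nonneg (B - c)]

namespace MinimaxProblem.IsRegular

/-- The stationarity gap is controlled by the projected steps along gradient estimators, the errors
of the estimators, and the regularization. -/
theorem norm_gap_le {dx dy : ℕ} {Ξ : Type*} [MeasurableSpace Ξ] {P : MinimaxProblem dx dy Ξ} {l : ℝ}
    (h : P.IsRegular l) {α β ρ : ℝ} (hα : 0 < α) (hβ : 0 < β) (hρ : 0 < ρ) (x v : Vec dx)
    {y : Vec dy} (hy : y ∈ P.Y) (w : Vec dy) :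
    ‖P.gap α β x y‖ ≤ √(2 / α ^ 2 * ‖proj P.X (x - α • v) - x‖ ^ 2 + 2 * ‖v - gradX P.g x y‖ ^ 2
      + 2 / β ^ 2 * ‖proj P.Y (y + β • w) - y‖ ^ 2 + 2 * ‖w - (gradY P.g x y - ρ • y)‖ ^ 2)
      + ρ * P.σy := by
  set r2 := 2 / α ^ 2 * ‖proj P.X (x - α • v) - x‖ ^ 2 + 2 * ‖v - gradX P.g x y‖ ^ 2
      + 2 / β ^ 2 * ‖proj P.Y (y + β • w) - y‖ ^ 2 + 2 * ‖w - (gradY P.g x y - ρ • y)‖ ^ 2 with hr2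
  have hr2_nonneg : 0 ≤ r2 := by positivity
  have hnX := norm_proj_sub_proj_le h.X_nonempty h.X_compact.isClosed
    h.X_convex (x - α • v) (x - α • gradX P.g (x) (y))
  have hnY := norm_proj_sub_proj_le h.Y_nonempty h.Y_compact.isClosed
    h.Y_convex (y + β • w) (y + β • gradY P.g (x) (y))
  rw [sub_sub_sub_cancel_left, ← smul_sub, norm_smul, Real.norm_of_nonneg hα.le,
    norm_sub_rev (gradX P.g _ _)] at hnX
  rw [add_sub_add_left_eq_sub, ← smul_sub, norm_smul, Real.norm_of_nonneg hβ.le] at hnY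
  have hσ := norm_le_σy h.Y_compact hy
  have hw : ‖w - gradY P.g (x) (y)‖ ≤
      ‖w - (gradY P.g (x) (y) - ρ • y)‖ + ρ * P.σy := by
    have e : w - gradY P.g (x) (y) =
      (w - (gradY P.g (x) (y) - ρ • y)) - ρ • y := by abel
    rw [e]
    refine (norm_sub_le _ _).trans ?_
    rw [norm_smul, Real.norm_of_nonneg hρ.le]
    gcongr
  have hX := norm_sub_le_norm_sub_add_norm_sub (x) (proj P.X (x - α • v))
    (proj P.X (x - α • gradX P.g (x) (y)))
  have hY := norm_sub_le_norm_sub_add_norm_sub (y) (proj P.Y (y + β • w))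
    (proj P.Y (y + β • gradY P.g (x) (y)))
  rw [norm_sub_rev (x)  (proj P.X (x - α • v))] at hX
  rw [norm_sub_rev (y) (proj P.Y (y + β • w))] at hY
  have hgap : ‖P.gap (α) β (x) (y)‖ ^ 2 =
      (1 / α * ‖x - proj P.X (x - α • gradX P.g (x) (y))‖) ^ 2 +
      (1 / β * ‖y - proj P.Y (y + β • gradY P.g (x) (y))‖) ^ 2 := by
    rw [gap, WithLp.prod_norm_sq_eq_of_L2]
    change ‖(1 / α) • (x - proj P.X (x - α • gradX P.g x y))‖ ^ 2 +
      ‖(1 / β) • (y - proj P.Y (y + β • gradY P.g x y))‖ ^ 2 = _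
    rw [norm_smul, norm_smul, Real.norm_of_nonneg (one_div_nonneg.2 hα.le),
      Real.norm_of_nonneg (one_div_nonneg.2 hβ.le)]
  set A := ‖proj P.X (x - α • v) - x‖
  set a := ‖v - gradX P.g (x) (y)‖
  set B := ‖proj P.Y (y + β • w) - y‖
  set c := ‖w - (gradY P.g (x) (y) - ρ • y)‖
  set κ := ρ * P.σy
  have hκ : 0 ≤ κ := mul_nonneg hρ.le ((norm_nonneg _).trans hσ)
  have h1 : 1 / α * ‖x - proj P.X (x - α • gradX P.g (x) (y))‖ ≤
      1 / α * A + a := by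
    have : 1 / α * A + a = 1 / α * (A + α * a) := by field_simp
    rw [this]
    gcongr
    linarith
  have h2 : 1 / β * ‖y - proj P.Y (y + β • gradY P.g (x) (y))‖ ≤
      (1 / β * B + c) + κ := by
    have : (1 / β * B + c) + κ = 1 / β * (B + β * (c + κ)) := by field_simp; ring
    rw [this]
    gcongr
    have := mul_le_mul_of_nonneg_left hw hβ.le
    linarith
  have hr : r2 = 2 * (1 / α * A) ^ 2 + 2 * a ^ 2 + 2 * (1 / β * B) ^ 2 + 2 * c ^ 2 := by
    rw [hr2]; ring
  rw [hr]
  exact le_sqrt_add_of_sq_eq (norm_nonneg _) hκ hgap (by positivity) h1 (by positivity) h2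

end MinimaxProblem.IsRegular

namespace Params

variable {p : Params}

/-- Division by 2^{2/13} ≥ 1 does not decrease a nonpositive number, so `L ≤ 0` would give ρ₁ ≥ L
and contradict L = l + ρ₁ with l > 0. -/
theorem Valid.L_pos (h : p.Valid) : 0 < p.L := by
  have h1 := h.L_eq
  have h2 := h.l_pos
  unfold ρ at h1
  have h3 : (1 : ℝ) ≤ (((1 : ℕ) : ℝ) + 1) ^ ((2 : ℝ) / 13) :=
    Real.one_le_rpow (by norm_num) (by norm_num)
  by_contra! hL
  have h4 : p.L ≤ p.L / (((1 : ℕ) : ℝ) + 1) ^ ((2 : ℝ) / 13) := by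
    rw [le_div_iff₀ (by linarith)]
    nlinarith
  linarith

theorem Valid.ρ_pos (h : p.Valid) (k : ℕ) : 0 < p.ρ k := by
  have := h.L_pos
  unfold ρ
  positivity

theorem Valid.ρ_succ_le (h : p.Valid) (k : ℕ) : p.ρ (k + 1) ≤ p.ρ k := by
  have := h.L_pos
  unfold ρ
  push_cast
  gcongr
  linarith

theorem Valid.ρ_antitone (h : p.Valid) : Antitone p.ρ := antitone_nat_of_succ_le h.ρ_succ_le

theorem Valid.l_add_ρ_le (h : p.Valid) {k : ℕ} (hk : 1 ≤ k) : p.l + p.ρ k ≤ p.L := by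
  have := h.ρ_antitone hk
  have := h.L_eq
  linarith

theorem Valid.β_mul_le (h : p.Valid) {k : ℕ} (hk : 1 ≤ k) : p.β * (p.l + p.ρ k) ≤ 1 / 6 := by
  have h1 := h.L_pos
  have h2 := mul_le_mul h.β_le (h.l_add_ρ_le hk) (by have := h.ρ_pos k; have := h.l_pos; positivity)
    (by positivity)
  refine h2.trans_eq ?_
  field_simp

theorem Valid.α_pos (h : p.Valid) (k : ℕ) : 0 < p.α k := by
  have := h.a₄_pos
  unfold α
  positivity

/-- The worst case is k = 1, where (3/2)^13 ≤ 3^5. The value 2/3 is what the contraction of the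
ascent step requires. -/
theorem η_le {k : ℕ} (hk : 1 ≤ k) : p.η k ≤ 2 / 3 := by
  have hk' : (1 : ℝ) ≤ k := by exact_mod_cast hk
  have h1 : (3 : ℝ) / 2 ≤ ((k : ℝ) + 2) ^ ((5 : ℝ) / 13) := by
    have h2 : ((3 : ℝ) / 2) = (((3 : ℝ) / 2) ^ (13 : ℕ)) ^ ((1 : ℝ) / 13) := by
      rw [← Real.rpow_natCast, ← Real.rpow_mul (by norm_num)]
      norm_num
    have h3 : ((k : ℝ) + 2) ^ ((5 : ℝ) / 13) = (((k : ℝ) + 2) ^ (5 : ℕ)) ^ ((1 : ℝ) / 13) := by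
      rw [← Real.rpow_natCast, ← Real.rpow_mul (by positivity)]
      norm_num
    rw [h2, h3]
    gcongr
    calc ((3 : ℝ) / 2) ^ 13 ≤ 3 ^ 5 := by norm_num
      _ ≤ ((k : ℝ) + 2) ^ 5 := by gcongr; linarith
  unfold η
  rw [div_le_iff₀ (by positivity)]
  linarith

end Params

namespace IsAdmissibleRun

variable {dx dy : ℕ} {Ξ Ω : Type*} [MeasurableSpace Ξ] {P : MinimaxProblem dx dy Ξ} {p : Params}
  [MeasurableSpace Ω] {μ : Measure Ω} {ζ : ℕ → Fin p.b → Ω → Ξ} {x₁ : Vec dx} {y₁ : Vec dy}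
  {x : ℕ → Ω → Vec dx} {y : ℕ → Ω → Vec dy} {v : ℕ → Ω → Vec dx} {w : ℕ → Ω → Vec dy}
  (R : IsAdmissibleRun P p μ ζ x₁ y₁ x y v w)

include R

theorem measurable_stepX {k : ℕ} (hk : 1 ≤ k) :
    Measurable fun ω => proj P.X (x k ω - p.α k • v k ω) := by
  obtain ⟨h1, -, h3, -⟩ := R.measurable_iterates' k hk
  exact (continuous_proj R.standard.X_nonempty R.standard.X_compact.isClosed
    R.standard.X_convex).measurable.comp (h1.sub (h3.const_smul (p.α k)))

theorem measurable_stepY {k : ℕ} (hk : 1 ≤ k) :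
    Measurable fun ω => proj P.Y (y k ω + p.β • w k ω) := by
  obtain ⟨-, h2, -, h4⟩ := R.measurable_iterates' k hk
  exact (continuous_proj R.standard.Y_nonempty R.standard.Y_compact.isClosed
    R.standard.Y_convex).measurable.comp (h2.add (h4.const_smul p.β))

theorem measurable_argmaxY (j : ℕ) {ξ : Ω → Vec dx} (hξ : Measurable ξ) (hX : ∀ ω, ξ ω ∈ P.X) :
    Measurable fun ω => P.argmaxY (p.ρ j) (ξ ω) :=
  measurable_comp_of_continuousOn (R.regular.continuousOn_argmaxY (R.valid.ρ_pos j)) hξ hX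

theorem integrable_maxY [IsProbabilityMeasure μ] (j : ℕ) {ξ : Ω → Vec dx} (hξ : Measurable ξ)
    (hX : ∀ ω, ξ ω ∈ P.X) : Integrable (fun ω => P.maxY (p.ρ j) (ξ ω)) μ := by
  have hc := R.regular.continuousOn_maxY (R.valid.ρ_pos j)
  obtain ⟨C, hC⟩ := R.standard.X_compact.exists_bound_of_continuousOn hc
  exact Integrable.of_bound (measurable_comp_of_continuousOn hc hξ hX).aestronglyMeasurable C
    (Eventually.of_forall fun ω => hC _ (hX ω))

theorem integrable_xStep [IsProbabilityMeasure μ] {k : ℕ} (hk : 1 ≤ k) :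
    Integrable (fun ω => ‖proj P.X (x k ω - p.α k • v k ω) - x k ω‖ ^ 2) μ :=
  integrable_of_bounded (((R.measurable_stepX hk).sub (R.measurable_iterates' k hk).1).norm.pow_const 2)
    (fun _ => by positivity) fun ω =>
      sq_norm_sub_le_sq_diam R.standard.X_compact (R.projX_mem _) (R.mem_feasible k hk ω).1

theorem integrable_yStep [IsProbabilityMeasure μ] {k : ℕ} (hk : 1 ≤ k) :
    Integrable (fun ω => ‖proj P.Y (y k ω + p.β • w k ω) - y k ω‖ ^ 2) μ :=
  integrable_of_bounded
    (((R.measurable_stepY hk).sub (R.measurable_iterates' k hk).2.1).norm.pow_const 2)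
    (fun _ => by positivity) fun ω =>
      sq_norm_sub_le_sq_diam R.standard.Y_compact (R.projY_mem _) (R.mem_feasible k hk ω).2

theorem integrable_yGap [IsProbabilityMeasure μ] {k : ℕ} (hk : 1 ≤ k) :
    Integrable (fun ω => ‖y k ω - P.argmaxY (p.ρ k) (x k ω)‖ ^ 2) μ :=
  integrable_of_bounded
    (((R.measurable_iterates' k hk).2.1.sub (R.measurable_argmaxY k (R.measurable_iterates' k hk).1
      (fun ω => (R.mem_feasible k hk ω).1))).norm.pow_const 2)
    (fun _ => by positivity) fun ω =>
      sq_norm_sub_le_sq_diam R.standard.Y_compact (R.mem_feasible k hk ω).2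
        (R.regular.argmaxY_spec (R.mem_feasible k hk ω).1).1

theorem integrable_vErr [IsProbabilityMeasure μ] {k : ℕ} (hk : 1 ≤ k) :
    Integrable (fun ω => ‖v k ω - gradX P.g (x k ω) (y k ω)‖ ^ 2) μ :=
  (memLp_two_iff_integrable_sq_norm (R.memLp_v_error k hk).1).1 (R.memLp_v_error k hk)

theorem integrable_wErr [IsProbabilityMeasure μ] {k : ℕ} (hk : 1 ≤ k) :
    Integrable (fun ω => ‖w k ω - (gradY P.g (x k ω) (y k ω) - p.ρ k • y k ω)‖ ^ 2) μ :=
  (memLp_two_iff_integrable_sq_norm (R.memLp_w_error k hk).1).1 (R.memLp_w_error k hk)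

theorem primal_succ_le [IsProbabilityMeasure μ] {k : ℕ} (hk : 1 ≤ k) :
    primal P p μ x (k + 1) ≤ primal P p μ x k
      - (3 * p.η k / (4 * p.α k) - p.η k ^ 2 * (p.l + p.l ^ 2 / p.ρ k) / 2) * xStep P p μ x v k
      + 2 * p.η k * p.α k * vErr P μ x y v k
      + 2 * p.η k * p.α k * p.l ^ 2 * yGap P p μ x y k
      + (p.ρ k - p.ρ (k + 1)) / 2 * P.σy ^ 2 := by
  have hmem := R.mem_feasible k hk
  have key := integral_le_of_le_linear (μ := μ) (c₁ := 1)
    (c₂ := -(3 * p.η k / (4 * p.α k) - p.η k ^ 2 * (p.l + p.l ^ 2 / p.ρ k) / 2))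
    (c₃ := 2 * p.η k * p.α k) (c₄ := 2 * p.η k * p.α k * p.l ^ 2)
    (c := (p.ρ k - p.ρ (k + 1)) / 2 * P.σy ^ 2)
    (R.integrable_maxY (k + 1) (R.measurable_iterates' (k + 1) (by omega)).1
      (fun ω => (R.mem_feasible (k + 1) (by omega) ω).1))
    (R.integrable_maxY k (R.measurable_iterates' k hk).1 (fun ω => (hmem ω).1))
    (R.integrable_xStep hk) (R.integrable_vErr hk) (R.integrable_yGap hk) fun ω => by
      -- The descent is taken with ρ_k throughout; the switch to ρ_{k+1} happens at the new point
      -- and costs a telescoping term.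
      have h1 := R.regular.maxY_le_maxY_add (R.mem_feasible (k + 1) (by omega) ω).1
        (R.valid.ρ_succ_le k)
      have h2 := R.regular.maxY_descent_le (hmem ω).1 (R.valid.ρ_pos k) (R.valid.α_pos k)
        (Params.η_pos (p := p) k).le (Params.η_le_one k) (v := v k ω) (hmem ω).2
      rw [← R.run.x_succ k hk] at h2
      rw [norm_sub_rev (v k ω)]
      linarith
  unfold primal xStep vErr yGap
  linarith

/-- Young's inequality with free parameter `t` separates the contraction towards the old maximizer
from the displacement of the maximizer. -/
theorem yGap_succ_le [IsProbabilityMeasure μ] {k : ℕ} (hk : 1 ≤ k) {t : ℝ} (ht : 0 < t) :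
    yGap P p μ x y (k + 1) ≤
      (1 + t) * ((1 - p.η k * p.β * p.ρ k) * yGap P p μ x y k
        - 7 / 6 * p.η k * yStep P p μ y w k + p.η k * p.β / p.ρ k * wErr P p μ x y w k)
      + (1 + 1 / t) * (2 * (p.l / p.ρ (k + 1)) ^ 2 * p.η k ^ 2 * xStep P p μ x v k
        + 2 * ((p.ρ k - p.ρ (k + 1)) / p.ρ (k + 1)) ^ 2 * P.σy ^ 2) := by
  have hmem := R.mem_feasible k hk
  have hmem' := R.mem_feasible (k + 1) (by omega)
  have key := integral_le_of_le_linear (μ := μ)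
    (c₁ := (1 + t) * (1 - p.η k * p.β * p.ρ k))
    (c₂ := -((1 + t) * (7 / 6 * p.η k)))
    (c₃ := (1 + t) * (p.η k * p.β / p.ρ k))
    (c₄ := (1 + 1 / t) * (2 * (p.l / p.ρ (k + 1)) ^ 2 * p.η k ^ 2))
    (c := (1 + 1 / t) * (2 * ((p.ρ k - p.ρ (k + 1)) / p.ρ (k + 1)) ^ 2 * P.σy ^ 2))
    (R.integrable_yGap (k := k + 1) (by omega)) (R.integrable_yGap hk) (R.integrable_yStep hk)
    (R.integrable_wErr hk) (R.integrable_xStep hk) fun ω => by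
      have h1 := R.regular.norm_sq_ascent_sub_argmaxY_le (hmem ω).1 (R.valid.ρ_pos k) R.valid.β_pos
        (Params.η_pos (p := p) k).le (Params.η_le hk) (R.valid.β_mul_le hk) (w := w k ω) (hmem ω).2
      rw [← R.run.y_succ k hk, norm_sub_rev _ (w k ω)] at h1
      have h2 := R.regular.norm_argmaxY_sub_le (hmem ω).1 (hmem' ω).1 (R.valid.ρ_succ_le k)
      have hx : ‖x (k + 1) ω - x k ω‖ = p.η k * ‖proj P.X (x k ω - p.α k • v k ω) - x k ω‖ := by
        rw [R.run.x_succ k hk, add_sub_cancel_left, norm_smul,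
          Real.norm_of_nonneg (Params.η_pos k).le]
      rw [hx] at h2
      have hρ := R.valid.ρ_pos (k + 1)
      have h3 := norm_add_sq_le_weighted (y (k + 1) ω - P.argmaxY (p.ρ k) (x k ω))
        (P.argmaxY (p.ρ k) (x k ω) - P.argmaxY (p.ρ (k + 1)) (x (k + 1) ω)) ht
      rw [sub_add_sub_cancel, norm_sub_rev (P.argmaxY (p.ρ k) (x k ω))] at h3
      set z := ‖P.argmaxY (p.ρ (k + 1)) (x (k + 1) ω) - P.argmaxY (p.ρ k) (x k ω)‖ with hz
      set b := ‖proj P.X (x k ω - p.α k • v k ω) - x k ω‖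
      have h4 : z ≤ p.l / p.ρ (k + 1) * (p.η k * b) +
          (p.ρ k - p.ρ (k + 1)) / p.ρ (k + 1) * P.σy := by
        rw [div_mul_eq_mul_div, div_mul_eq_mul_div, ← add_div, le_div_iff₀ hρ]
        linarith
      have h5 : z ^ 2 ≤ 2 * (p.l / p.ρ (k + 1)) ^ 2 * p.η k ^ 2 * b ^ 2 +
          2 * ((p.ρ k - p.ρ (k + 1)) / p.ρ (k + 1)) ^ 2 * P.σy ^ 2 := by
        have h6 : z ^ 2 ≤ (p.l / p.ρ (k + 1) * (p.η k * b) +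
          (p.ρ k - p.ρ (k + 1)) / p.ρ (k + 1) * P.σy) ^ 2 := by
          have : 0 ≤ z := norm_nonneg _
          gcongr
        nlinarith [sq_nonneg (p.l / p.ρ (k + 1) * (p.η k * b) -
          (p.ρ k - p.ρ (k + 1)) / p.ρ (k + 1) * P.σy)]
      have h7 := mul_le_mul_of_nonneg_left h1 (show 0 ≤ 1 + t by positivity)
      have h8 := mul_le_mul_of_nonneg_left h5 (show 0 ≤ 1 + 1 / t by positivity)
      linarith
  unfold yGap yStep wErr xStep at *
  linarith

theorem measurable_norm_gap {k : ℕ} (hk : 1 ≤ k) :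
    Measurable fun ω => ‖P.gap (p.α k) p.β (x k ω) (y k ω)‖ := by
  have := R.standard.isProbability
  have hmem := R.mem_feasible k hk
  obtain ⟨hx, hy, -⟩ := R.measurable_iterates' k hk
  have hgX := R.oracleX.measurable_mean_comp hx (fun ω => (hmem ω).1) hy (fun ω => (hmem ω).2)
  have hgY := R.oracleY.measurable_mean_comp hx (fun ω => (hmem ω).1) hy (fun ω => (hmem ω).2)
  have hcX := (continuous_proj R.standard.X_nonempty R.standard.X_compact.isClosed
    R.standard.X_convex)
  have hcY := (continuous_proj R.standard.Y_nonempty R.standard.Y_compact.isClosed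
    R.standard.Y_convex)
  have hX : Measurable fun ω => (1 / p.α k) •
      (x k ω - proj P.X (x k ω - p.α k • gradX P.g (x k ω) (y k ω))) :=
    (hx.sub (hcX.measurable.comp (hx.sub (hgX.const_smul (p.α k))))).const_smul (1 / p.α k)
  have hY : Measurable fun ω => (1 / p.β) •
      (y k ω - proj P.Y (y k ω + p.β • gradY P.g (x k ω) (y k ω))) :=
    (hy.sub (hcY.measurable.comp (hy.add (hgY.const_smul p.β)))).const_smul (1 / p.β)
  have e : (fun ω => ‖P.gap (p.α k) p.β (x k ω) (y k ω)‖) = fun ω => √(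
      ‖(1 / p.α k) • (x k ω - proj P.X (x k ω - p.α k • gradX P.g (x k ω) (y k ω)))‖ ^ 2 +
      ‖(1 / p.β) • (y k ω - proj P.Y (y k ω + p.β • gradY P.g (x k ω) (y k ω)))‖ ^ 2) := by
    funext ω
    rw [MinimaxProblem.gap, WithLp.prod_norm_eq_of_L2]
    rfl
  rw [e]
  exact ((hX.norm.pow_const 2).add (hY.norm.pow_const 2)).sqrt

/-- A bound on the mean squared stationarity gap of the regularized problem. -/
theorem gap_le [IsProbabilityMeasure μ] {k : ℕ} (hk : 1 ≤ k) :
    Integrable (fun ω => ‖P.gap (p.α k) p.β (x k ω) (y k ω)‖) μ ∧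
    ∫ ω, ‖P.gap (p.α k) p.β (x k ω) (y k ω)‖ ∂μ ≤
      √(2 / p.α k ^ 2 * xStep P p μ x v k + 2 * vErr P μ x y v k
        + 2 / p.β ^ 2 * yStep P p μ y w k + 2 * wErr P p μ x y w k) + p.ρ k * P.σy := by
  have := R.standard.isProbability
  have hmem := R.mem_feasible k hk
  have hα := R.valid.α_pos k
  have hβ := R.valid.β_pos
  have hρ := R.valid.ρ_pos k
  set r2 : Ω → ℝ := fun ω => 2 / p.α k ^ 2 * ‖proj P.X (x k ω - p.α k • v k ω) - x k ω‖ ^ 2 +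
    2 * ‖v k ω - gradX P.g (x k ω) (y k ω)‖ ^ 2 +
    2 / p.β ^ 2 * ‖proj P.Y (y k ω + p.β • w k ω) - y k ω‖ ^ 2 +
    2 * ‖w k ω - (gradY P.g (x k ω) (y k ω) - p.ρ k • y k ω)‖ ^ 2 with hr2
  have hr2_nonneg : ∀ ω, 0 ≤ r2 ω := fun ω => by positivity
  have hr2_int : Integrable r2 μ :=
    ((((R.integrable_xStep hk).const_mul _).add ((R.integrable_vErr hk).const_mul _)).add
      ((R.integrable_yStep hk).const_mul _)).add ((R.integrable_wErr hk).const_mul _)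
  have hr_mem : MemLp (fun ω => √(r2 ω)) 2 μ := by
    refine (memLp_two_iff_integrable_sq
      (Real.continuous_sqrt.comp_aestronglyMeasurable hr2_int.1)).2 ?_
    simpa only [Real.sq_sqrt (hr2_nonneg _)] using hr2_int
  have hpt : ∀ ω, ‖P.gap (p.α k) p.β (x k ω) (y k ω)‖ ≤ √(r2 ω) + p.ρ k * P.σy := fun ω =>
    R.regular.norm_gap_le hα hβ hρ (x k ω) (v k ω) (hmem ω).2 (w k ω)
  have hint : Integrable (fun ω => √(r2 ω) + p.ρ k * P.σy) μ :=
    (hr_mem.integrable (by norm_num)).add (integrable_const _)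
  have hmeas := R.measurable_norm_gap hk
  have hgi : Integrable (fun ω => ‖P.gap (p.α k) p.β (x k ω) (y k ω)‖) μ :=
    hint.mono' hmeas.aestronglyMeasurable (Eventually.of_forall fun ω => by
      rw [norm_norm]; exact hpt ω)
  refine ⟨hgi, (integral_mono hgi hint hpt).trans ?_⟩
  rw [integral_add (hr_mem.integrable (by norm_num)) (integrable_const _)]
  simp only [integral_const, probReal_univ, one_smul]
  gcongr
  -- Jensen's inequality: the mean of the root is at most the root of the mean.
  apply Real.le_sqrt_of_sq_le
  refine (sq_integral_le_integral_sq hr_mem).trans ?_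
  simp only [Real.sq_sqrt (hr2_nonneg _)]
  have := integral_le_of_le_linear (μ := μ) (f := r2) (c₁ := 2 / p.α k ^ 2) (c₂ := 2)
    (c₃ := 2 / p.β ^ 2) (c₄ := 2) (c := 0) hr2_int (R.integrable_xStep hk) (R.integrable_vErr hk)
    (R.integrable_yStep hk) (R.integrable_wErr hk) (fun ω => by simp [hr2])
  unfold xStep vErr yStep wErr
  linarith

end IsAdmissibleRun

/-! ### Arithmetic of the step sizes. -/

theorem rpow_div_thirteen {s : ℝ} (hs : 0 ≤ s) (j : ℕ) :
    s ^ ((j : ℝ) / 13) = (s ^ ((1 : ℝ) / 13)) ^ j := by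
  rw [← Real.rpow_natCast, ← Real.rpow_mul hs]
  congr 1
  ring

/-- Consecutive thirteenth roots `u ≤ τ`, in terms of which all step sizes are monomials. -/
structure ConsecutiveRoots (u τ : ℝ) : Prop where
  one_le : 1 ≤ u
  le : u ≤ τ
  pow_eq : τ ^ 13 = u ^ 13 + 1

namespace ConsecutiveRoots

variable {u τ : ℝ} (h : ConsecutiveRoots u τ)
include h

theorem pos : 0 < u := by linarith [h.one_le]

theorem pos' : 0 < τ := by linarith [h.one_le, h.le]

theorem one_le' : 1 ≤ τ := h.one_le.trans h.le

/-- Bernoulli gives 13 u^12 (τ - u) ≤ 1. This bounds the growth of the weights `D1` and `D2`, and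
12/13 is the reserve for it in the lower bounds on a₅ and a₆. -/
theorem cube_sub_cube_le : τ ^ 3 - u ^ 3 ≤ 12 / 13 / τ ^ 9 := by
  have hu := h.pos
  have hτ := h.pos'
  have h1 : 13 * u ^ 12 * (τ - u) ≤ 1 := by
    have h2 := one_add_mul_le_pow (a := (τ - u) / u)
      (by have := div_nonneg (sub_nonneg.2 h.le) hu.le; linarith) 13
    have h3 : 1 + (τ - u) / u = τ / u := by field_simp; ring
    rw [h3, div_pow, le_div_iff₀ (by positivity), h.pow_eq] at h2
    have h4 : (1 + ((13 : ℕ) : ℝ) * ((τ - u) / u)) * u ^ 13 = u ^ 13 + 13 * u ^ 12 * (τ - u) := by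
      push_cast
      field_simp
    linarith
  have h5 : τ ^ 11 ≤ 2 * u ^ 12 := by
    have h6 : τ ^ 13 ≤ 2 * u ^ 13 := by
      rw [h.pow_eq]
      linarith [one_le_pow₀ h.one_le (n := 13)]
    have h7 : u ^ 2 * τ ^ 11 ≤ u ^ 2 * (2 * u ^ 12) := by
      calc u ^ 2 * τ ^ 11 ≤ τ ^ 2 * τ ^ 11 := by
            gcongr; exact h.le
        _ = τ ^ 13 := by ring
        _ ≤ 2 * u ^ 13 := h6
        _ ≤ 2 * u ^ 14 := by
            have := pow_le_pow_right₀ h.one_le (show 13 ≤ 14 by norm_num)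
            linarith
        _ = u ^ 2 * (2 * u ^ 12) := by ring
    exact le_of_mul_le_mul_left h7 (by positivity)
  have h8 : τ ^ 3 - u ^ 3 ≤ 3 * τ ^ 2 * (τ - u) := by
    have : 0 ≤ τ - u := sub_nonneg.2 h.le
    have h9 : τ ^ 2 + τ * u + u ^ 2 ≤ 3 * τ ^ 2 := by nlinarith [h.le]
    calc τ ^ 3 - u ^ 3 = (τ ^ 2 + τ * u + u ^ 2) * (τ - u) := by ring
      _ ≤ _ := by gcongr
  rw [le_div_iff₀ (by positivity)]
  calc (τ ^ 3 - u ^ 3) * τ ^ 9 ≤ (3 * τ ^ 2 * (τ - u)) * τ ^ 9 := by gcongr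
    _ = 3 * (τ - u) * τ ^ 11 := by ring
    _ ≤ 3 * (τ - u) * (2 * u ^ 12) := by
        have : 0 ≤ τ - u := sub_nonneg.2 h.le
        gcongr
    _ = 6 / 13 * (13 * u ^ 12 * (τ - u)) := by ring
    _ ≤ 12 / 13 := by linarith

/-- Since u² τ^11 ≥ u^13, the product (τ² - u²) τ^11 is at most τ^13 - u^13 = 1. -/
theorem inv_sq_sub_le : 1 / u ^ 2 - 1 / τ ^ 2 ≤ 1 / (u ^ 2 * τ ^ 13) := by
  have hu := h.pos
  have hτ := h.pos'
  have h1 : u ^ 2 * τ ^ 11 ≥ u ^ 13 := by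
    calc u ^ 13 = u ^ 2 * u ^ 11 := by ring
      _ ≤ _ := by gcongr; exact h.le
  rw [div_sub_div _ _ (by positivity) (by positivity), div_le_div_iff₀ (by positivity)
    (by positivity)]
  have h2 : (τ ^ 2 - u ^ 2) * τ ^ 11 ≤ 1 := by
    have : (τ ^ 2 - u ^ 2) * τ ^ 11 = τ ^ 13 - u ^ 2 * τ ^ 11 := by ring
    rw [this, h.pow_eq]; linarith
  calc (1 * τ ^ 2 - u ^ 2 * 1) * (u ^ 2 * τ ^ 13) =
        ((τ ^ 2 - u ^ 2) * τ ^ 11) * (u ^ 2 * τ ^ 2) := by ring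
    _ ≤ 1 * (u ^ 2 * τ ^ 2) := by gcongr

variable {L l β a₄ : ℝ} (hL : 0 < L) (hl : 0 ≤ l) (hlL : l ≤ L / 4) (hβ : 0 < β)
  (hβL : β * L ≤ 1 / 6) (ha₄ : 0 < a₄)

include hL hβ in
-- The quantity here is the Young parameter t = ηβρ/2, written in the roots.
theorem half_mul_pos : 0 < 1 / τ ^ 5 * β * (L / u ^ 2) / 2 := by
  have hu := h.pos
  have hτ := h.pos'
  positivity

include hβL in
theorem half_mul_le : 1 / τ ^ 5 * β * (L / u ^ 2) / 2 ≤ 1 / 12 := by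
  have hu := h.pos
  have hτ := h.pos'
  have e : 1 / τ ^ 5 * β * (L / u ^ 2) / 2 = β * L / (2 * (τ ^ 5 * u ^ 2)) := by field_simp
  rw [e, div_le_iff₀ (by positivity)]
  have : 1 ≤ τ ^ 5 * u ^ 2 := one_le_mul_of_one_le_of_one_le (one_le_pow₀ h.one_le')
    (one_le_pow₀ h.one_le)
  linarith

include hL hβ hβL in
theorem one_add_inv_le :
    1 + 1 / (1 / τ ^ 5 * β * (L / u ^ 2) / 2) ≤ 13 / 6 * (τ ^ 5 * u ^ 2 / (β * L)) := by
  have hu := h.pos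
  have hτ := h.pos'
  have h1 := h.half_mul_pos hL hβ
  have h2 := h.half_mul_le (L := L) hβL
  have e : 13 / 6 * (τ ^ 5 * u ^ 2 / (β * L)) =
      13 / 12 * (1 / (1 / τ ^ 5 * β * (L / u ^ 2) / 2)) := by field_simp; norm_num
  rw [e]
  have h3 : 12 ≤ 1 / (1 / τ ^ 5 * β * (L / u ^ 2) / 2) := by
    rw [le_div_iff₀ h1]; linarith
  linarith

include hL hl hlL hβ hβL ha₄ in
-- With e = 2t, the product (1 + t)(1 - 2t) is at most 1 - t. The gain t times the weight pays for
-- the maximizer error of the primal descent, and the weight itself decreases from u to τ.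
theorem coef_yGap :
    2 * (1 / τ ^ 5) * (a₄ / τ ^ 4) * l ^ 2 +
      8 * (a₄ / τ ^ 4) * L ^ 2 / (β * (L / τ ^ 2)) *
        ((1 + 1 / τ ^ 5 * β * (L / u ^ 2) / 2) * (1 - 1 / τ ^ 5 * β * (L / u ^ 2))) ≤
      8 * (a₄ / u ^ 4) * L ^ 2 / (β * (L / u ^ 2)) := by
  have hu := h.pos
  have hτ := h.pos'
  have ht := h.half_mul_pos hL hβ
  have ht' := h.half_mul_le (L := L) hβL
  set t := 1 / τ ^ 5 * β * (L / u ^ 2) / 2 with htdef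
  have e1 : 1 / τ ^ 5 * β * (L / u ^ 2) = 2 * t := by rw [htdef]; ring
  have e2 : 8 * (a₄ / τ ^ 4) * L ^ 2 / (β * (L / τ ^ 2)) = 8 * a₄ * L / (β * τ ^ 2) := by
    field_simp
  have e3 : 8 * (a₄ / u ^ 4) * L ^ 2 / (β * (L / u ^ 2)) = 8 * a₄ * L / (β * u ^ 2) := by
    field_simp
  rw [e1, e2, e3]
  have h1 : 8 * a₄ * L / (β * τ ^ 2) ≤ 8 * a₄ * L / (β * u ^ 2) := by
    have := h.le
    gcongr
  have h2 : (1 + t) * (1 - 2 * t) ≤ 1 - t := by nlinarith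
  have h3 := mul_le_mul_of_nonneg_left h2 (show 0 ≤ 8 * a₄ * L / (β * τ ^ 2) by positivity)
  have h4 : 2 * (1 / τ ^ 5) * (a₄ / τ ^ 4) * l ^ 2 ≤ 8 * a₄ * L / (β * τ ^ 2) * t := by
    have e4 : 8 * a₄ * L / (β * τ ^ 2) * t = 4 * a₄ * L ^ 2 / (τ ^ 7 * u ^ 2) := by
      rw [htdef]; field_simp; norm_num
    have e5 : 2 * (1 / τ ^ 5) * (a₄ / τ ^ 4) * l ^ 2 = 2 * a₄ * l ^ 2 / (τ ^ 7 * τ ^ 2) := by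
      field_simp
    rw [e4, e5]
    have := h.le
    have h5 : l ^ 2 ≤ L ^ 2 := by gcongr; linarith
    gcongr
    linarith
  linarith

include hL hl hlL hβ hβL ha₄ in
-- In units of 1/(a₄ τ), the four costs are at most 1/32, 1/32, 1/16 and 1/4, against the available
-- 3/4.
theorem coef_xStep {a₁ a₂ b d₁ : ℝ} (hb : 0 < b) (ha₄L : a₄ * L ≤ 1 / 8)
    (ha₄β : a₄ ^ 2 ≤ β ^ 2 / 320) (ha₁ : a₁ ≤ b / (32 * a₄ * L ^ 2))
    (ha₂ : a₂ ≤ b / (32 * a₄ * L ^ 2)) (hd₁ : d₁ ≤ 1 / 8) :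
    (1 / τ ^ 5) ^ 2 * (l + l ^ 2 / (L / u ^ 2)) / 2 +
      8 * (a₄ / τ ^ 4) * L ^ 2 / (β * (L / τ ^ 2)) *
        ((1 + 1 / (1 / τ ^ 5 * β * (L / u ^ 2) / 2)) *
          (2 * (l / (L / τ ^ 2)) ^ 2 * (1 / τ ^ 5) ^ 2)) +
      (a₁ * τ ^ 3 + a₂ * τ ^ 3) * (1 / b * (16 * l ^ 2 * (1 / τ ^ 5) ^ 2)) +
      d₁ * (1 / τ ^ 5) * (a₄ / τ ^ 4) * (2 / (a₄ / τ ^ 4) ^ 2) ≤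
      3 * (1 / τ ^ 5) / (4 * (a₄ / τ ^ 4)) := by
  have hu := h.pos
  have hτ := h.pos'
  have h1τ := h.one_le'
  have huτ : u ^ 2 ≤ τ ^ 2 := by have := h.le; gcongr
  have hl2 : l ^ 2 ≤ L ^ 2 / 16 := by nlinarith
  have p1 : (1 / τ ^ 5) ^ 2 * (l + l ^ 2 / (L / u ^ 2)) / 2 ≤ 1 / 32 * (1 / (a₄ * τ)) := by
    have q1 : l + l ^ 2 / (L / u ^ 2) ≤ L / 2 * τ ^ 2 := by
      have q2 : l ^ 2 / (L / u ^ 2) ≤ L / 16 * τ ^ 2 := by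
        have q3 : l ^ 2 / (L / u ^ 2) = l ^ 2 * u ^ 2 / L := by field_simp
        rw [q3, div_le_iff₀ hL]
        calc l ^ 2 * u ^ 2 ≤ L ^ 2 / 16 * τ ^ 2 := by gcongr
          _ = _ := by ring
      have q4 : 1 ≤ τ ^ 2 := one_le_pow₀ h1τ
      nlinarith
    calc (1 / τ ^ 5) ^ 2 * (l + l ^ 2 / (L / u ^ 2)) / 2 ≤
          (1 / τ ^ 5) ^ 2 * (L / 2 * τ ^ 2) / 2 := by gcongr
      _ = L / 4 * (1 / τ ^ 8) := by field_simp; norm_num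
      _ ≤ L / 4 * (1 / τ ^ 1) := by
          gcongr
          norm_num
      _ = (a₄ * L) / 4 * (1 / (a₄ * τ)) := by field_simp
      _ ≤ (1 / 8) / 4 * (1 / (a₄ * τ)) := by gcongr
      _ = _ := by ring
  have p2 : 8 * (a₄ / τ ^ 4) * L ^ 2 / (β * (L / τ ^ 2)) *
        ((1 + 1 / (1 / τ ^ 5 * β * (L / u ^ 2) / 2)) *
          (2 * (l / (L / τ ^ 2)) ^ 2 * (1 / τ ^ 5) ^ 2)) ≤ 1 / 32 * (1 / (a₄ * τ)) := by
    calc _ ≤ 8 * (a₄ / τ ^ 4) * L ^ 2 / (β * (L / τ ^ 2)) *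
        ((13 / 6 * (τ ^ 5 * u ^ 2 / (β * L))) *
          (2 * (l / (L / τ ^ 2)) ^ 2 * (1 / τ ^ 5) ^ 2)) := by
          gcongr
          exact h.one_add_inv_le hL hβ hβL
      _ = 104 / 3 * (a₄ * l ^ 2 * u ^ 2 / (β ^ 2 * L ^ 2 * τ ^ 3)) := by field_simp; ring
      _ ≤ 104 / 3 * (a₄ * (L ^ 2 / 16) * τ ^ 2 / (β ^ 2 * L ^ 2 * τ ^ 3)) := by gcongr
      _ = 104 / 48 * (a₄ ^ 2 / β ^ 2) * (1 / (a₄ * τ)) := by field_simp; norm_num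
      _ ≤ 104 / 48 * (1 / 320) * (1 / (a₄ * τ)) := by
          have hq : a₄ ^ 2 / β ^ 2 ≤ 1 / 320 := by
            rw [div_le_iff₀ (by positivity)]
            linarith
          exact mul_le_mul_of_nonneg_right (mul_le_mul_of_nonneg_left hq (by norm_num))
            (by positivity)
      _ ≤ _ := by gcongr; norm_num
  have p3 : (a₁ * τ ^ 3 + a₂ * τ ^ 3) * (1 / b * (16 * l ^ 2 * (1 / τ ^ 5) ^ 2)) ≤
      1 / 16 * (1 / (a₄ * τ)) := by
    calc _ ≤ (b / (32 * a₄ * L ^ 2) * τ ^ 3 + b / (32 * a₄ * L ^ 2) * τ ^ 3) *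
          (1 / b * (16 * (L ^ 2 / 16) * (1 / τ ^ 5) ^ 2)) := by gcongr
      _ = 1 / 16 * (1 / (a₄ * τ ^ 7)) := by field_simp; norm_num
      _ ≤ 1 / 16 * (1 / (a₄ * τ ^ 1)) := by
          gcongr
          norm_num
      _ = _ := by rw [pow_one]
  have p4 : d₁ * (1 / τ ^ 5) * (a₄ / τ ^ 4) * (2 / (a₄ / τ ^ 4) ^ 2) ≤ 1 / 4 * (1 / (a₄ * τ)) := by
    calc _ = 2 * d₁ * (1 / (a₄ * τ)) := by field_simp
      _ ≤ _ := by gcongr; linarith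
  have p5 : 3 * (1 / τ ^ 5) / (4 * (a₄ / τ ^ 4)) = 3 / 4 * (1 / (a₄ * τ)) := by field_simp
  rw [p5]
  have p6 : 0 ≤ 1 / (a₄ * τ) := by positivity
  linarith

include hL hl hlL hβ ha₄ in
-- In units of a₄ L/(β τ^7), the costs are at most 1 and 2, against at least 28/3.
theorem coef_yStep {a₁ a₂ b d₁ : ℝ} (hb : 0 < b)
    (ha₁ : a₁ ≤ b * a₄ / (2 * L * β)) (ha₂ : a₂ ≤ b * a₄ / (2 * L * β)) (hd₁ : d₁ ≤ L * β) :
    (a₁ * τ ^ 3 + a₂ * τ ^ 3) * (1 / b * (16 * l ^ 2 * (1 / τ ^ 5) ^ 2)) +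
      d₁ * (1 / τ ^ 5) * (a₄ / τ ^ 4) * (2 / β ^ 2) ≤
      8 * (a₄ / τ ^ 4) * L ^ 2 / (β * (L / τ ^ 2)) *
        ((1 + 1 / τ ^ 5 * β * (L / u ^ 2) / 2) * (7 / 6 * (1 / τ ^ 5))) := by
  have hu := h.pos
  have hτ := h.pos'
  have h1τ := h.one_le'
  have ht := h.half_mul_pos hL hβ
  have hl2 : l ^ 2 ≤ L ^ 2 / 16 := by nlinarith
  have p3 : (a₁ * τ ^ 3 + a₂ * τ ^ 3) * (1 / b * (16 * l ^ 2 * (1 / τ ^ 5) ^ 2)) ≤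
      a₄ * L / (β * τ ^ 7) := by
    calc _ ≤ (b * a₄ / (2 * L * β) * τ ^ 3 + b * a₄ / (2 * L * β) * τ ^ 3) *
          (1 / b * (16 * (L ^ 2 / 16) * (1 / τ ^ 5) ^ 2)) := by gcongr
      _ = _ := by field_simp; norm_num
  have p4 : d₁ * (1 / τ ^ 5) * (a₄ / τ ^ 4) * (2 / β ^ 2) ≤ 2 * (a₄ * L / (β * τ ^ 7)) := by
    calc _ ≤ L * β * (1 / τ ^ 5) * (a₄ / τ ^ 4) * (2 / β ^ 2) := by gcongr
      _ = 2 * (a₄ * L / (β * τ ^ 9)) := by field_simp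
      _ ≤ _ := by
          gcongr
          norm_num
  have p5 : 28 / 3 * (a₄ * L / (β * τ ^ 7)) ≤ 8 * (a₄ / τ ^ 4) * L ^ 2 / (β * (L / τ ^ 2)) *
        ((1 + 1 / τ ^ 5 * β * (L / u ^ 2) / 2) * (7 / 6 * (1 / τ ^ 5))) := by
    calc _ = 8 * (a₄ / τ ^ 4) * L ^ 2 / (β * (L / τ ^ 2)) *
        ((1 + 0) * (7 / 6 * (1 / τ ^ 5))) := by field_simp; norm_num
      _ ≤ _ := by gcongr
  have p6 : 0 ≤ a₄ * L / (β * τ ^ 7) := by positivity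
  linarith

include ha₄ in
-- The damping a₁ a₅/τ^9 pays for the growth of `D1` and for at most 9/4 of a₄/τ^9; the condition on
-- a₅ reserves 4.
theorem coef_vErr {a₁ a₅ d₁ : ℝ} (ha₁ : 0 < a₁) (ha₅ : 4 * a₄ / a₁ + 12 / 13 ≤ a₅)
    (hγ : a₅ / τ ^ 12 ≤ 1) (hd₁ : d₁ ≤ 1 / 8) :
    2 * (1 / τ ^ 5) * (a₄ / τ ^ 4) + a₁ * τ ^ 3 * (1 - a₅ / τ ^ 12) ^ 2 +
      d₁ * (1 / τ ^ 5) * (a₄ / τ ^ 4) * 2 ≤ a₁ * u ^ 3 := by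
  have hτ := h.pos'
  have h5 : 0 < a₅ := lt_of_lt_of_le (by positivity) ha₅
  have h1 : (1 - a₅ / τ ^ 12) ^ 2 ≤ 1 - a₅ / τ ^ 12 := by
    have : 0 ≤ a₅ / τ ^ 12 := by positivity
    nlinarith
  have h2 : a₁ * τ ^ 3 * (1 - a₅ / τ ^ 12) ^ 2 ≤ a₁ * τ ^ 3 - a₁ * a₅ * (1 / τ ^ 9) := by
    calc _ ≤ a₁ * τ ^ 3 * (1 - a₅ / τ ^ 12) := by gcongr
      _ = _ := by field_simp
  have h3 : a₁ * τ ^ 3 ≤ a₁ * u ^ 3 + 12 / 13 * a₁ * (1 / τ ^ 9) := by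
    have := mul_le_mul_of_nonneg_left h.cube_sub_cube_le ha₁.le
    have e : a₁ * (12 / 13 / τ ^ 9) = 12 / 13 * a₁ * (1 / τ ^ 9) := by ring
    linarith
  have h4 : (4 * a₄ + 12 / 13 * a₁) * (1 / τ ^ 9) ≤ a₁ * a₅ * (1 / τ ^ 9) := by
    gcongr
    calc 4 * a₄ + 12 / 13 * a₁ = a₁ * (4 * a₄ / a₁ + 12 / 13) := by field_simp
      _ ≤ _ := by gcongr
  have e1 : 2 * (1 / τ ^ 5) * (a₄ / τ ^ 4) = 2 * (a₄ * (1 / τ ^ 9)) := by field_simp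
  have e2 : d₁ * (1 / τ ^ 5) * (a₄ / τ ^ 4) * 2 = 2 * d₁ * (a₄ * (1 / τ ^ 9)) := by field_simp
  have h6 : 2 * d₁ * (a₄ * (1 / τ ^ 9)) ≤ 1 / 4 * (a₄ * (1 / τ ^ 9)) := by gcongr; linarith
  have h7 : 0 ≤ a₄ * (1 / τ ^ 9) := by positivity
  rw [e1, e2]
  linarith

include hL hβ hβL ha₄ in
-- As for `v`, but in powers τ^{-5}: the error of `w` also enters the tracking of the maximizer,
-- with coefficient at most 26/3 of a₄/τ^5. The condition on a₆ reserves 80.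
theorem coef_wErr {a₂ a₆ d₁ : ℝ} (ha₂ : 0 < a₂) (ha₆ : 80 * a₄ / a₂ + 12 / 13 ≤ a₆)
    (hθ : a₆ / τ ^ 8 ≤ 1) (hd₁ : d₁ ≤ 1 / 8) :
    8 * (a₄ / τ ^ 4) * L ^ 2 / (β * (L / τ ^ 2)) *
        ((1 + 1 / τ ^ 5 * β * (L / u ^ 2) / 2) * (1 / τ ^ 5 * β / (L / u ^ 2))) +
      a₂ * τ ^ 3 * (1 - a₆ / τ ^ 8) ^ 2 + d₁ * (1 / τ ^ 5) * (a₄ / τ ^ 4) * 2 ≤ a₂ * u ^ 3 := by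
  have hu := h.pos
  have hτ := h.pos'
  have h1τ := h.one_le'
  have huτ : u ^ 2 ≤ τ ^ 2 := by have := h.le; gcongr
  have ht' := h.half_mul_le (L := L) hβL
  have h5 : 0 < a₆ := lt_of_lt_of_le (by positivity) ha₆
  have h95 : 1 / τ ^ 9 ≤ 1 / τ ^ 5 := by
    gcongr
    norm_num
  have h1 : (1 - a₆ / τ ^ 8) ^ 2 ≤ 1 - a₆ / τ ^ 8 := by
    have : 0 ≤ a₆ / τ ^ 8 := by positivity
    nlinarith
  have h2 : a₂ * τ ^ 3 * (1 - a₆ / τ ^ 8) ^ 2 ≤ a₂ * τ ^ 3 - a₂ * a₆ * (1 / τ ^ 5) := by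
    calc _ ≤ a₂ * τ ^ 3 * (1 - a₆ / τ ^ 8) := by gcongr
      _ = _ := by field_simp
  have h3 : a₂ * τ ^ 3 ≤ a₂ * u ^ 3 + 12 / 13 * a₂ * (1 / τ ^ 5) := by
    have := mul_le_mul_of_nonneg_left h.cube_sub_cube_le ha₂.le
    have e : a₂ * (12 / 13 / τ ^ 9) = 12 / 13 * a₂ * (1 / τ ^ 9) := by ring
    have := mul_le_mul_of_nonneg_left h95 (show 0 ≤ 12 / 13 * a₂ by positivity)
    linarith
  have h4 : (80 * a₄ + 12 / 13 * a₂) * (1 / τ ^ 5) ≤ a₂ * a₆ * (1 / τ ^ 5) := by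
    gcongr
    calc 80 * a₄ + 12 / 13 * a₂ = a₂ * (80 * a₄ / a₂ + 12 / 13) := by field_simp
      _ ≤ _ := by gcongr
  have h6 : d₁ * (1 / τ ^ 5) * (a₄ / τ ^ 4) * 2 ≤ 1 / 4 * (a₄ * (1 / τ ^ 5)) := by
    calc d₁ * (1 / τ ^ 5) * (a₄ / τ ^ 4) * 2 ≤ 1 / 8 * (1 / τ ^ 5) * (a₄ / τ ^ 4) * 2 := by gcongr
      _ = 1 / 4 * (a₄ * (1 / τ ^ 9)) := by field_simp; norm_num
      _ ≤ _ := by gcongr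
  have h7 : 0 ≤ a₄ * (1 / τ ^ 5) := by positivity
  have h8 : 8 * (a₄ / τ ^ 4) * L ^ 2 / (β * (L / τ ^ 2)) *
        ((1 + 1 / τ ^ 5 * β * (L / u ^ 2) / 2) * (1 / τ ^ 5 * β / (L / u ^ 2))) ≤
      26 / 3 * (a₄ * (1 / τ ^ 5)) := by
    calc _ ≤ 8 * (a₄ / τ ^ 4) * L ^ 2 / (β * (L / τ ^ 2)) *
        ((1 + 1 / 12) * (1 / τ ^ 5 * β / (L / u ^ 2))) := by gcongr
      _ = 26 / 3 * (a₄ * (u ^ 2 / τ ^ 7)) := by field_simp; norm_num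
      _ ≤ 26 / 3 * (a₄ * (τ ^ 2 / τ ^ 7)) := by gcongr
      _ = _ := by field_simp
  linarith

include hL hβ hβL ha₄ in
-- The squared relative change of ρ would not telescope. One of its two factors, together with 1 +
-- 1/t, is bounded by `inv_sq_sub_le`, so that a single difference of ρ remains.
theorem drift_le :
    8 * (a₄ / τ ^ 4) * L ^ 2 / (β * (L / τ ^ 2)) *
        ((1 + 1 / (1 / τ ^ 5 * β * (L / u ^ 2) / 2)) *
          (2 * ((L / u ^ 2 - L / τ ^ 2) / (L / τ ^ 2)) ^ 2)) ≤
      35 * (a₄ / β ^ 2) * ((L / u ^ 2 - L / τ ^ 2) / L) := by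
  have hu := h.pos
  have hτ := h.pos'
  have h1τ := h.one_le'
  have h1 := h.inv_sq_sub_le
  set Δ := 1 / u ^ 2 - 1 / τ ^ 2 with hΔ
  have hΔ0 : 0 ≤ Δ := by
    have := h.le
    have : 1 / τ ^ 2 ≤ 1 / u ^ 2 := by gcongr
    linarith
  have e : L / u ^ 2 - L / τ ^ 2 = L * Δ := by rw [hΔ]; ring
  rw [e]
  have h2 : τ ^ 7 * u ^ 2 * Δ ≤ 1 := by
    calc τ ^ 7 * u ^ 2 * Δ ≤ τ ^ 7 * u ^ 2 * (1 / (u ^ 2 * τ ^ 13)) := by gcongr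
      _ = 1 / τ ^ 6 := by field_simp
      _ ≤ 1 := by
        rw [div_le_one (by positivity)]
        exact one_le_pow₀ h1τ
  calc _ ≤ 8 * (a₄ / τ ^ 4) * L ^ 2 / (β * (L / τ ^ 2)) *
        ((13 / 6 * (τ ^ 5 * u ^ 2 / (β * L))) * (2 * (L * Δ / (L / τ ^ 2)) ^ 2)) := by
        gcongr
        exact h.one_add_inv_le hL hβ hβL
    _ = 104 / 3 * (a₄ / β ^ 2) * Δ * (τ ^ 7 * u ^ 2 * Δ) := by field_simp; ring
    _ ≤ 104 / 3 * (a₄ / β ^ 2) * Δ * 1 := by gcongr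
    _ ≤ 35 * (a₄ / β ^ 2) * (L * Δ / L) := by
        rw [mul_one, mul_div_cancel_left₀ _ hL.ne']
        gcongr
        norm_num

theorem noise_le {a₁ a₂ a₅ a₆ b δ : ℝ} (ha₁ : 0 < a₁) (hb : 0 < b) :
    a₁ * τ ^ 3 * (1 / b * (2 * (a₅ / τ ^ 12) ^ 2 * δ ^ 2)) +
      a₂ * τ ^ 3 * (1 / b * (2 * (a₆ / τ ^ 8) ^ 2 * δ ^ 2)) ≤
      2 * δ ^ 2 * (a₅ ^ 2 * a₁ + a₆ ^ 2 * a₂) / b * (1 / τ ^ 13) := by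
  have hτ := h.pos'
  have h1τ := h.one_le'
  have e1 : a₁ * τ ^ 3 * (1 / b * (2 * (a₅ / τ ^ 12) ^ 2 * δ ^ 2)) =
      2 * δ ^ 2 * a₅ ^ 2 * a₁ / b * (1 / τ ^ 21) := by field_simp
  have e2 : a₂ * τ ^ 3 * (1 / b * (2 * (a₆ / τ ^ 8) ^ 2 * δ ^ 2)) =
      2 * δ ^ 2 * a₆ ^ 2 * a₂ / b * (1 / τ ^ 13) := by field_simp
  have h1 : 2 * δ ^ 2 * a₅ ^ 2 * a₁ / b * (1 / τ ^ 21) ≤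
      2 * δ ^ 2 * a₅ ^ 2 * a₁ / b * (1 / τ ^ 13) := by
    gcongr
    norm_num
  have e3 : 2 * δ ^ 2 * (a₅ ^ 2 * a₁ + a₆ ^ 2 * a₂) / b * (1 / τ ^ 13) =
    2 * δ ^ 2 * a₅ ^ 2 * a₁ / b * (1 / τ ^ 13) + 2 * δ ^ 2 * a₆ ^ 2 * a₂ / b * (1 / τ ^ 13) := by
    ring
  rw [e1, e2, e3]
  linarith

end ConsecutiveRoots

namespace Params

variable {p : Params}

/-- Amounts to 2^{2/13} ≤ 4/3; it yields l ≤ L/4, hence the factor 1/16 gained on l² in the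
coefficient estimates. -/
theorem ρ_one_ge (hL : 0 ≤ p.L) : 3 / 4 * p.L ≤ p.ρ 1 := by
  have h1 : (((1 : ℕ) : ℝ) + 1) ^ ((2 : ℝ) / 13) ≤ 4 / 3 := by
    have h2 : ((4 : ℝ) / 3) = (((4 : ℝ) / 3) ^ (13 : ℕ)) ^ ((1 : ℝ) / 13) := by
      rw [← Real.rpow_natCast, ← Real.rpow_mul (by norm_num)]
      norm_num
    have h3 : (((1 : ℕ) : ℝ) + 1) ^ ((2 : ℝ) / 13) = ((((1 : ℕ) : ℝ) + 1) ^ (2 : ℕ)) ^ ((1 : ℝ) / 13) := by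
      rw [← Real.rpow_natCast, ← Real.rpow_mul (by positivity)]
      norm_num
    rw [h2, h3]
    gcongr
    norm_num
  unfold ρ
  rw [le_div_iff₀ (by positivity)]
  calc 3 / 4 * p.L * (((1 : ℕ) : ℝ) + 1) ^ ((2 : ℝ) / 13) ≤ 3 / 4 * p.L * (4 / 3) := by gcongr
    _ = p.L := by ring

theorem Valid.l_le (h : p.Valid) : p.l ≤ p.L / 4 := by
  have h1 := ρ_one_ge h.L_pos.le
  have h2 := h.L_eq
  linarith

theorem Valid.β_mul_L_le (h : p.Valid) : p.β * p.L ≤ 1 / 6 := by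
  have h1 := h.L_pos
  have h2 := mul_le_mul_of_nonneg_right h.β_le h1.le
  refine h2.trans_eq ?_
  field_simp

theorem Valid.a₄_mul_L_le (h : p.Valid) : p.a₄ * p.L ≤ 1 / 8 := by
  have h1 := h.L_pos
  have h2 := mul_le_mul_of_nonneg_right (h.a₄_le.trans (min_le_left _ _)) h1.le
  refine h2.trans_eq ?_
  field_simp

theorem Valid.sq_a₄_le (h : p.Valid) : p.a₄ ^ 2 ≤ p.β ^ 2 / 320 := by
  have h1 := h.a₄_le.trans (min_le_right _ _)
  have h2 := h.a₄_pos
  have h3 : p.a₄ ^ 2 ≤ (p.β / (8 * √5)) ^ 2 := by gcongr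
  rw [div_pow, mul_pow, Real.sq_sqrt (by norm_num)] at h3
  norm_num at h3 ⊢
  exact h3

variable (p) in
theorem exists_consecutiveRoots (n : ℕ) : ∃ u τ : ℝ, ConsecutiveRoots u τ ∧ τ ^ 13 = n + 3 ∧
    p.η (n + 1) = 1 / τ ^ 5 ∧ p.α (n + 1) = p.a₄ / τ ^ 4 ∧ p.α n = p.a₄ / u ^ 4 ∧
    p.ρ (n + 1) = p.L / u ^ 2 ∧ p.ρ (n + 2) = p.L / τ ^ 2 ∧ p.γ (n + 1) = p.a₅ / τ ^ 12 ∧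
    p.θ (n + 1) = p.a₆ / τ ^ 8 ∧ p.D1 (n + 1) = p.a₁ * τ ^ 3 ∧ p.D1 n = p.a₁ * u ^ 3 ∧
    p.D2 (n + 1) = p.a₂ * τ ^ 3 ∧ p.D2 n = p.a₂ * u ^ 3 := by
  have key (s : ℝ) (hs : 0 ≤ s) (j : ℕ) := rpow_div_thirteen hs j
  have e13 (s : ℝ) (hs : 0 ≤ s) : (s ^ ((1 : ℝ) / 13)) ^ 13 = s := by
    rw [← rpow_div_thirteen hs 13]; norm_num
  have s0 : (0 : ℝ) ≤ (n : ℝ) + 2 := by positivity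
  have s1 : (0 : ℝ) ≤ ((n + 1 : ℕ) : ℝ) + 2 := by positivity
  have e1 : ((n + 1 : ℕ) : ℝ) + 1 = (n : ℝ) + 2 := by push_cast; ring
  have e2 : ((n + 2 : ℕ) : ℝ) + 1 = ((n + 1 : ℕ) : ℝ) + 2 := by push_cast; ring
  refine ⟨((n : ℝ) + 2) ^ ((1 : ℝ) / 13), (((n + 1 : ℕ) : ℝ) + 2) ^ ((1 : ℝ) / 13), ⟨?_, ?_, ?_⟩, ?_,
    ?_, ?_, ?_, ?_, ?_, ?_, ?_, ?_, ?_, ?_, ?_⟩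
  · exact Real.one_le_rpow (by linarith [(Nat.cast_nonneg n : (0 : ℝ) ≤ n)]) (by norm_num)
  · gcongr; linarith
  · rw [e13 _ s0, e13 _ s1]; push_cast; ring
  · rw [e13 _ s1]; push_cast; ring
  · unfold η; rw [← key _ s1 5]; norm_num
  · unfold α; rw [← key _ s1 4]; norm_num
  · unfold α; rw [← key _ s0 4]; norm_num
  · unfold ρ; rw [e1, ← key _ s0 2]; norm_num
  · unfold ρ; rw [e2, ← key _ s1 2]; norm_num
  · unfold γ; rw [← key _ s1 12]; norm_num
  · unfold θ; rw [← key _ s1 8]; norm_num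
  · unfold D1; rw [← key _ s1 3]; norm_num
  · unfold D1; rw [← key _ s0 3]; norm_num
  · unfold D2; rw [← key _ s1 3]; norm_num
  · unfold D2; rw [← key _ s0 3]; norm_num

end Params

/-! ### The Lyapunov inequality. -/

/-- Bookkeeping only: the four recursions are added with weights 1, P', Q', R', and the hypotheses
`kG` to `kW` compare the coefficients of each nonnegative quantity. -/
theorem lyapunov_combine {F F' X Y V V' W W' G G' A₁ A₂ A₃ A₄ A₅ t e B₁ B₂ B₃ B₄ T c₁ c₂ β n₁ n₂ s
    P P' Q Q' R R' d r₁ r₂ drift noise : ℝ} (hX : 0 ≤ X) (hY : 0 ≤ Y) (hV : 0 ≤ V) (hW : 0 ≤ W)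
    (hG : 0 ≤ G) (hP' : 0 ≤ P') (hQ' : 0 ≤ Q') (hR' : 0 ≤ R')
    (hF : F' ≤ F - (A₁ - A₂) * X + A₃ * V + A₄ * G + A₅)
    (hG' : G' ≤ (1 + t) * ((1 - e) * G - B₁ * Y + B₂ * W) + T * (B₃ * X + B₄))
    (hV' : V' ≤ c₁ * V + β * (n₁ + s * (X + Y))) (hW' : W' ≤ c₂ * W + β * (n₂ + s * (X + Y)))
    (kG : A₄ + Q' * ((1 + t) * (1 - e)) ≤ Q)
    (kX : A₂ + Q' * (T * B₃) + (P' + R') * (β * s) + d * r₁ ≤ A₁)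
    (kY : (P' + R') * (β * s) + d * r₂ ≤ Q' * ((1 + t) * B₁))
    (kV : A₃ + P' * c₁ + d * 2 ≤ P)
    (kW : Q' * ((1 + t) * B₂) + R' * c₂ + d * 2 ≤ R)
    (kd : Q' * (T * B₄) ≤ drift) (kn : P' * (β * n₁) + R' * (β * n₂) ≤ noise) :
    F' + P' * V' + Q' * G' + R' * W' ≤ F + P * V + Q * G + R * W
      - d * (r₁ * X + 2 * V + r₂ * Y + 2 * W) + A₅ + drift + noise := by
  have h1 := mul_le_mul_of_nonneg_left hV' hP'
  have h2 := mul_le_mul_of_nonneg_left hG' hQ'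
  have h3 := mul_le_mul_of_nonneg_left hW' hR'
  have h4 := mul_le_mul_of_nonneg_right kG hG
  have h5 := mul_le_mul_of_nonneg_right kX hX
  have h6 := mul_le_mul_of_nonneg_right kY hY
  have h7 := mul_le_mul_of_nonneg_right kV hV
  have h8 := mul_le_mul_of_nonneg_right kW hW
  linarith

/-- The Lyapunov function of the method. -/
def lyapunov {dx dy : ℕ} {Ξ Ω : Type*} [MeasurableSpace Ξ] [MeasurableSpace Ω]
    (P : MinimaxProblem dx dy Ξ) (p : Params) (μ : Measure Ω) (x : ℕ → Ω → Vec dx)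
    (y : ℕ → Ω → Vec dy) (v : ℕ → Ω → Vec dx) (w : ℕ → Ω → Vec dy) (n : ℕ) : ℝ :=
  primal P p μ x (n + 1) + p.D1 n * vErr P μ x y v (n + 1)
    + 8 * p.α n * p.L ^ 2 / (p.β * p.ρ (n + 1)) * yGap P p μ x y (n + 1)
    + p.D2 n * wErr P p μ x y w (n + 1)

/-- Bound for the expected squared norm of the regularized stationarity gap. -/
def gapBound {dx dy : ℕ} {Ξ Ω : Type*} [MeasurableSpace Ξ] [MeasurableSpace Ω]
    (P : MinimaxProblem dx dy Ξ) (p : Params) (μ : Measure Ω) (x : ℕ → Ω → Vec dx)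
    (y : ℕ → Ω → Vec dy) (v : ℕ → Ω → Vec dx) (w : ℕ → Ω → Vec dy) (k : ℕ) : ℝ :=
  2 / p.α k ^ 2 * xStep P p μ x v k + 2 * vErr P μ x y v k
    + 2 / p.β ^ 2 * yStep P p μ y w k + 2 * wErr P p μ x y w k

namespace IsAdmissibleRun

variable {dx dy : ℕ} {Ξ Ω : Type*} [MeasurableSpace Ξ] {P : MinimaxProblem dx dy Ξ} {p : Params}
  [MeasurableSpace Ω] {μ : Measure Ω} {ζ : ℕ → Fin p.b → Ω → Ξ} {x₁ : Vec dx} {y₁ : Vec dy}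
  {x : ℕ → Ω → Vec dx} {y : ℕ → Ω → Vec dy} {v : ℕ → Ω → Vec dx} {w : ℕ → Ω → Vec dy}
  (R : IsAdmissibleRun P p μ ζ x₁ y₁ x y v w)
include R

theorem lyapunov_succ_le [IsProbabilityMeasure μ] (n : ℕ) :
    lyapunov P p μ x y v w (n + 1) ≤ lyapunov P p μ x y v w n
      - p.d₁ * p.η (n + 1) * p.α (n + 1) * gapBound P p μ x y v w (n + 1)
      + (p.ρ (n + 1) - p.ρ (n + 2)) / 2 * P.σy ^ 2
      + 35 * (p.a₄ / p.β ^ 2) * ((p.ρ (n + 1) - p.ρ (n + 2)) / p.L) * P.σy ^ 2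
      + 2 * p.δ ^ 2 * (p.a₅ ^ 2 * p.a₁ + p.a₆ ^ 2 * p.a₂) / p.b * (1 / ((n : ℝ) + 3)) := by
  have hk : 1 ≤ n + 1 := by omega
  have hV := R.valid
  obtain ⟨u, τ, h, h13, e1, e2, e3, e4, e5, e6, e7, e8, e9, e10, e11⟩ := p.exists_consecutiveRoots n
  have hL := hV.L_pos
  have hl := hV.l_pos.le
  have hβ := hV.β_pos
  have hb : (0 : ℝ) < p.b := by exact_mod_cast hV.b_pos
  have ha₄ := hV.a₄_pos
  have ha₁ := hV.a₁_pos
  have ha₂ := hV.a₂_pos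
  have hu := h.pos
  have hτ := h.pos'
  have hγ := hV.γ_le (n + 1) hk
  have hθ := hV.θ_le (n + 1) hk
  have hd8 := hV.d₁_le.trans ((min_le_left _ _).trans (min_le_left _ _))
  have hdL := hV.d₁_le.trans ((min_le_left _ _).trans (min_le_right _ _))
  have ht := h.half_mul_pos hL hβ
  have q1 := R.primal_succ_le hk
  -- Half of the contraction is kept and the other half is spent on the displacement of the
  -- maximizer.
  have q2 := R.yGap_succ_le hk (t := p.η (n + 1) * p.β * p.ρ (n + 1) / 2)
    (by rw [e1, e4]; exact ht)
  have q3 := R.vErr_succ_le hk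
  have q4 := R.wErr_succ_le hk
  unfold lyapunov gapBound
  rw [← h13]
  rw [show n + 1 + 1 = n + 2 from rfl] at *
  rw [e1, e2, e4, e5] at *
  rw [e6] at q3 hγ
  rw [e7] at q4 hθ
  rw [e3, e8, e9, e10, e11]
  refine lyapunov_combine (integral_nonneg fun _ => by positivity)
    (integral_nonneg fun _ => by positivity) (integral_nonneg fun _ => by positivity)
    (integral_nonneg fun _ => by positivity) (integral_nonneg fun _ => by positivity)
    (by positivity) (by positivity) (by positivity) q1 q2 q3 q4
    (h.coef_yGap hL hl hV.l_le hβ hV.β_mul_L_le ha₄)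
    (h.coef_xStep hL hl hV.l_le hβ hV.β_mul_L_le ha₄ hb hV.a₄_mul_L_le hV.sq_a₄_le
      (hV.a₁_le.trans (min_le_left _ _)) (hV.a₂_le.trans (min_le_left _ _)) hd8)
    (h.coef_yStep hL hl hV.l_le hβ ha₄ hb
      (hV.a₁_le.trans (min_le_right _ _)) (hV.a₂_le.trans (min_le_right _ _)) hdL)
    (h.coef_vErr ha₄ ha₁ hV.a₅_ge hγ hd8)
    (h.coef_wErr hL hβ hV.β_mul_L_le ha₄ ha₂ hV.a₆_ge hθ hd8) ?_
    (h.noise_le ha₁ hb)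
  have hd := mul_le_mul_of_nonneg_right (h.drift_le hL hβ hV.β_mul_L_le ha₄) (sq_nonneg P.σy)
  refine le_trans (le_of_eq ?_) hd
  ring

end IsAdmissibleRun

theorem sum_one_div_le_log (N : ℕ) : ∑ n ∈ Finset.range N, 1 / ((n : ℝ) + 3) ≤ Real.log ((N : ℝ) + 2) := by
  induction N with
  | zero => simp; positivity
  | succ N ih =>
    rw [Finset.sum_range_succ]
    have h1 := Real.one_sub_inv_le_log_of_pos (x := ((N : ℝ) + 3) / (N + 2)) (by positivity)
    rw [Real.log_div (by positivity) (by positivity)] at h1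
    have e : 1 - (((N : ℝ) + 3) / (N + 2))⁻¹ = 1 / ((N : ℝ) + 3) := by field_simp; ring
    have e2 : ((N + 1 : ℕ) : ℝ) + 2 = N + 3 := by push_cast; ring
    rw [e2]
    linarith

theorem σy_nonneg {dx dy : ℕ} {Ξ : Type*} [MeasurableSpace Ξ] (P : MinimaxProblem dx dy Ξ) :
    0 ≤ P.σy := Real.sSup_nonneg (by rintro _ ⟨y, -, rfl⟩; positivity)

/-! ### Summation and comparison with the constants `C1` and `C2`. -/

namespace Params

variable {p : Params}

/-- The coefficient of E‖y*‖² in `potentialS` is bounded uniformly in the iteration, so this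
negative term cannot drive the potential to -∞. -/
theorem Valid.drift_coef (h : p.Valid) (n : ℕ) :
    0 ≤ 40 * p.α (n + 1) * p.L ^ 2 * (p.ρ (n + 1) - p.ρ (n + 2))
        / (p.η (n + 1) * p.β ^ 2 * p.ρ (n + 2) ^ 3) ∧
    40 * p.α (n + 1) * p.L ^ 2 * (p.ρ (n + 1) - p.ρ (n + 2))
        / (p.η (n + 1) * p.β ^ 2 * p.ρ (n + 2) ^ 3) ≤ 40 * p.a₄ / p.β ^ 2 := by
  obtain ⟨u, τ, hr, h13, e1, e2, e3, e4, e5, -⟩ := p.exists_consecutiveRoots n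
  have hL := h.L_pos
  have hβ := h.β_pos
  have ha₄ := h.a₄_pos
  have hu := hr.pos
  have hτ := hr.pos'
  constructor
  · have h1 := sub_nonneg.2 (h.ρ_succ_le (n + 1))
    have h2 := h.α_pos (n + 1)
    have h3 := η_pos (p := p) (n + 1)
    have h4 := h.ρ_pos (n + 2)
    positivity
  · rw [e1, e2, e4, e5]
    have e : 40 * (p.a₄ / τ ^ 4) * p.L ^ 2 * (p.L / u ^ 2 - p.L / τ ^ 2) /
        (1 / τ ^ 5 * p.β ^ 2 * (p.L / τ ^ 2) ^ 3) =
        40 * p.a₄ / p.β ^ 2 * (τ ^ 7 * (1 / u ^ 2 - 1 / τ ^ 2)) := by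
      field_simp
    rw [e]
    refine mul_le_of_le_one_right (by positivity) ?_
    calc τ ^ 7 * (1 / u ^ 2 - 1 / τ ^ 2) ≤ τ ^ 7 * (1 / (u ^ 2 * τ ^ 13)) := by
          gcongr; exact hr.inv_sq_sub_le
      _ = 1 / (u ^ 2 * τ ^ 6) := by field_simp
      _ ≤ 1 := by
        rw [div_le_one (by positivity)]
        exact one_le_mul_of_one_le_of_one_le (one_le_pow₀ hr.one_le) (one_le_pow₀ hr.one_le')

/-- The last term of `C1` has ρ₁ where the potential has ρ₁ - ρ₂. The part with ρ₂ equals 40 a₄/(β²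
η₁), and 1/η₁ ≥ 3/2. -/
theorem Valid.drift_slack (h : p.Valid) :
    40 * p.α 1 * p.L ^ 2 * (p.ρ 1 - p.ρ 2) / (p.η 1 * p.β ^ 2 * p.ρ 2 ^ 3) + 60 * p.a₄ / p.β ^ 2 ≤
      40 * p.α 1 * p.L ^ 2 * p.ρ 1 / (p.η 1 * p.β ^ 2 * p.ρ 2 ^ 3) := by
  obtain ⟨u, τ, hr, h13, e1, e2, e3, e4, e5, -⟩ := p.exists_consecutiveRoots 0
  have h1 := η_le (p := p) (k := 1) le_rfl
  have hL := h.L_pos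
  have hβ := h.β_pos
  have ha₄ := h.a₄_pos
  have hτ := hr.pos'
  simp only [zero_add] at e1 e2 e5
  have h2 : 3 / 2 ≤ τ ^ 5 := by
    rw [e1, div_le_iff₀ (by positivity)] at h1
    linarith
  have e : 40 * p.α 1 * p.L ^ 2 * p.ρ 2 / (p.η 1 * p.β ^ 2 * p.ρ 2 ^ 3) =
      40 * p.a₄ / p.β ^ 2 * τ ^ 5 := by
    rw [e1, e2, e5]
    field_simp
  have h3 : 40 * p.a₄ / p.β ^ 2 * (3 / 2) ≤ 40 * p.a₄ / p.β ^ 2 * τ ^ 5 := by gcongr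
  have e' : 40 * p.α 1 * p.L ^ 2 * (p.ρ 1 - p.ρ 2) / (p.η 1 * p.β ^ 2 * p.ρ 2 ^ 3) =
      40 * p.α 1 * p.L ^ 2 * p.ρ 1 / (p.η 1 * p.β ^ 2 * p.ρ 2 ^ 3) -
      40 * p.α 1 * p.L ^ 2 * p.ρ 2 / (p.η 1 * p.β ^ 2 * p.ρ 2 ^ 3) := by ring
  rw [e', e]
  have : 60 * p.a₄ / p.β ^ 2 = 40 * p.a₄ / p.β ^ 2 * (3 / 2) := by ring
  linarith

/-- In the roots this product is a₂ L² (τ/u)³ / u, and (τ/u)^13 = 1 + u^{-13} decreases with u. -/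
theorem Valid.D2_mul_sq_ρ_le (h : p.Valid) (n : ℕ) :
    p.D2 (n + 1) * p.ρ (n + 1) ^ 2 ≤ p.D2 1 * p.ρ 1 ^ 2 := by
  obtain ⟨u, τ, hr, -, -, -, -, e4, -, -, -, -, -, e9, -⟩ := p.exists_consecutiveRoots n
  obtain ⟨u', τ', hr', -, -, -, -, e4', -, -, -, -, -, e9', -⟩ := p.exists_consecutiveRoots 0
  simp only [zero_add] at e4' e9'
  have hL := h.L_pos
  have ha₂ := h.a₂_pos
  have hu := hr.pos
  have hτ := hr.pos'
  have hu' := hr'.pos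
  have hτ' := hr'.pos'
  have h1 : u' ≤ u := by
    have h2 := h.ρ_antitone (show 1 ≤ n + 1 by omega)
    rw [e4, e4', div_le_div_iff_of_pos_left hL (by positivity) (by positivity)] at h2
    exact (pow_le_pow_iff_left₀ hu'.le hu.le two_ne_zero).1 h2
  have h2 : τ / u ≤ τ' / u' := by
    refine (pow_le_pow_iff_left₀ (by positivity) (by positivity) (n := 13) (by norm_num)).1 ?_
    rw [div_pow, div_pow, hr.pow_eq, hr'.pow_eq, div_le_div_iff₀ (by positivity) (by positivity)]
    have : u' ^ 13 ≤ u ^ 13 := by gcongr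
    linarith
  rw [e4, e4', e9, e9']
  calc p.a₂ * τ ^ 3 * (p.L / u ^ 2) ^ 2 = p.a₂ * p.L ^ 2 * ((τ / u) ^ 3 * (1 / u)) := by field_simp
    _ ≤ p.a₂ * p.L ^ 2 * ((τ' / u') ^ 3 * (1 / u')) := by gcongr
    _ = _ := by field_simp

theorem Valid.ρ_zero_eq : p.ρ 0 = p.L := by simp [ρ]

theorem Valid.ρ_one_le (h : p.Valid) : p.ρ 1 ≤ p.L := by
  rw [← Valid.ρ_zero_eq]; exact h.ρ_succ_le 0

end Params

namespace IsAdmissibleRun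

variable {dx dy : ℕ} {Ξ Ω : Type*} [MeasurableSpace Ξ] {P : MinimaxProblem dx dy Ξ} {p : Params}
  [MeasurableSpace Ω] {μ : Measure Ω} {ζ : ℕ → Fin p.b → Ω → Ξ} {x₁ : Vec dx} {y₁ : Vec dy}
  {x : ℕ → Ω → Vec dx} {y : ℕ → Ω → Vec dy} {v : ℕ → Ω → Vec dx} {w : ℕ → Ω → Vec dy}
  (R : IsAdmissibleRun P p μ ζ x₁ y₁ x y v w)
include R

theorem potentialF_eq_lyapunov (n : ℕ) :
    potentialF P p μ v w n (x (n + 1)) (y (n + 1)) = lyapunov P p μ x y v w n := by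
  have hmem := R.mem_feasible (n + 1) (by omega)
  have e1 : ∀ ω, ‖gradX (P.gk p (n + 1)) (x (n + 1) ω) (y (n + 1) ω) - v (n + 1) ω‖ ^ 2 =
      ‖v (n + 1) ω - gradX P.g (x (n + 1) ω) (y (n + 1) ω)‖ ^ 2 := fun ω => by
    rw [norm_sub_rev, MinimaxProblem.gk, gradX_regularize]
  have e2 : ∀ ω, ‖gradY (P.gk p (n + 1)) (x (n + 1) ω) (y (n + 1) ω) - w (n + 1) ω‖ ^ 2 =
      ‖w (n + 1) ω - (gradY P.g (x (n + 1) ω) (y (n + 1) ω) - p.ρ (n + 1) • y (n + 1) ω)‖ ^ 2 :=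
    fun ω => by
      rw [norm_sub_rev, MinimaxProblem.gk, R.regular.gradY_gk (hmem ω).1 (hmem ω).2]
  unfold potentialF lyapunov
  simp only [e1, e2]
  rfl

theorem integral_sq_norm_ystar_le [IsProbabilityMeasure μ] (n : ℕ) {ξ : Ω → Vec dx}
    (hX : ∀ ω, ξ ω ∈ P.X) : ∫ ω, ‖P.ystar p n (ξ ω)‖ ^ 2 ∂μ ≤ P.σy ^ 2 := by
  have h := integral_mono_of_nonneg (μ := μ) (f := fun ω => ‖P.ystar p n (ξ ω)‖ ^ 2)
    (g := fun _ => P.σy ^ 2) (Eventually.of_forall fun ω => by positivity) (integrable_const _)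
    (Eventually.of_forall fun ω => by
      have := norm_le_σy R.standard.Y_compact
        (R.regular.argmaxY_spec (ρ := p.ρ n) (hX ω)).1
      exact pow_le_pow_left₀ (norm_nonneg _) this 2)
  simpa using h

/-- The infimum of an unbounded set of reals is 0 by convention; boundedness is what makes `Slow` a
lower bound for the potential along the run. -/
theorem bddBelow_potentialS [IsProbabilityMeasure μ] :
    BddBelow {s | ∃ (k : ℕ) (ξ : Ω → Vec dx) (υ : Ω → Vec dy), Measurable ξ ∧ Measurable υ ∧
      (∀ ω, ξ ω ∈ P.X) ∧ (∀ ω, υ ω ∈ P.Y) ∧ s = potentialS P p μ v w k ξ υ} := by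
  have hV := R.valid
  have hρ0 := hV.ρ_pos 0
  obtain ⟨C, hC⟩ := R.standard.X_compact.exists_bound_of_continuousOn
    (R.regular.continuousOn_maxY hρ0)
  refine ⟨-C - 40 * p.a₄ / p.β ^ 2 * P.σy ^ 2, ?_⟩
  rintro _ ⟨k, ξ, υ, hξ, -, hX, -, rfl⟩
  have hL := hV.L_pos
  have hβ := hV.β_pos
  have hα := hV.α_pos k
  have hρ := hV.ρ_pos (k + 1)
  have ha₁ := hV.a₁_pos
  have ha₂ := hV.a₂_pos
  have hD1 : 0 ≤ p.D1 k := by unfold Params.D1; positivity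
  have hD2 : 0 ≤ p.D2 k := by unfold Params.D2; positivity
  have hD2' : 0 ≤ p.D2 (k + 1) := by unfold Params.D2; positivity
  have h1 : -C ≤ ∫ ω, P.Φ p (k + 1) (ξ ω) ∂μ := by
    -- One bound serves all k: since ρ_{k+1} ≤ ρ_0, testing with the maximizer for ρ_0 gives Φ_{k+1}
    -- ≥ Φ_0, which is continuous on the compact set `X`.
    have h2 : ∀ ω, -C ≤ P.maxY (p.ρ (k + 1)) (ξ ω) := fun ω => by
      refine (neg_le_of_abs_le (hC _ (hX ω))).trans ?_
      rw [R.regular.maxY_eq (hX ω)]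
      refine le_trans ?_ (R.regular.le_maxY (ρ := p.ρ (k + 1)) (hX ω)
        (R.regular.argmaxY_spec (ρ := p.ρ 0) (hX ω)).1)
      have := hV.ρ_antitone (Nat.zero_le (k + 1))
      unfold regularize
      gcongr
    have h3 := integral_mono (integrable_const (μ := μ) (-C)) (R.integrable_maxY (k + 1) hξ hX) h2
    rw [integral_const, probReal_univ, one_smul] at h3
    exact h3
  obtain ⟨h4, h5⟩ := hV.drift_coef k
  have h6 := mul_le_mul h5 (R.integral_sq_norm_ystar_le (k + 1) hX)
    (integral_nonneg fun ω => by positivity) (h4.trans h5)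
  have i1 : 0 ≤ p.D1 k * ∫ ω, ‖gradX (P.gk p (k + 1)) (ξ ω) (υ ω) - v (k + 1) ω‖ ^ 2 ∂μ :=
    mul_nonneg hD1 (integral_nonneg fun ω => by positivity)
  have i2 : 0 ≤ p.D2 k * ∫ ω, ‖gradY (P.gk p (k + 1)) (ξ ω) (υ ω) - w (k + 1) ω‖ ^ 2 ∂μ :=
    mul_nonneg hD2 (integral_nonneg fun ω => by positivity)
  have i3 : 0 ≤ 8 * p.α k * p.L ^ 2 / (p.β * p.ρ (k + 1)) *
      ∫ ω, ‖υ ω - P.ystar p (k + 1) (ξ ω)‖ ^ 2 ∂μ :=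
    mul_nonneg (by positivity) (integral_nonneg fun ω => by positivity)
  have i4 : 0 ≤ 4 * p.D2 (k + 1) * p.ρ (k + 1) ^ 2 * P.σy ^ 2 / p.b := by positivity
  unfold potentialS potentialF
  linarith

/-- `drift_slack` frees 60 a₄ σ_y²/β² inside `C1`. The telescoped displacement of the maximizer uses
35, and the remaining 25 is kept for the early iterations. The second summand of `C2` is spare. -/
theorem sum_gapBound_le [IsProbabilityMeasure μ] (N : ℕ) :
    ∑ n ∈ Finset.range N, p.d₁ * p.η (n + 1) * p.α (n + 1) * gapBound P p μ x y v w (n + 1)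
      + 25 * (p.a₄ / p.β ^ 2) * P.σy ^ 2 ≤
      C1 P p μ x y v w + C2 P p * Real.log ((N : ℝ) + 2) := by
  have hV := R.valid
  have hL := hV.L_pos
  have hb : (0 : ℝ) < p.b := by exact_mod_cast hV.b_pos
  have ha₁ := hV.a₁_pos
  have ha₂ := hV.a₂_pos
  have ha₄ := hV.a₄_pos
  have hβ := hV.β_pos
  have h1 : ∑ n ∈ Finset.range N, p.d₁ * p.η (n + 1) * p.α (n + 1) * gapBound P p μ x y v w (n + 1)
      ≤ lyapunov P p μ x y v w 0 - lyapunov P p μ x y v w N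
        + (p.ρ 1 - p.ρ (N + 1)) / 2 * P.σy ^ 2
        + 35 * (p.a₄ / p.β ^ 2) * ((p.ρ 1 - p.ρ (N + 1)) / p.L) * P.σy ^ 2
        + 2 * p.δ ^ 2 * (p.a₅ ^ 2 * p.a₁ + p.a₆ ^ 2 * p.a₂) / p.b *
          ∑ n ∈ Finset.range N, 1 / ((n : ℝ) + 3) := by
    induction N with
    | zero => simp
    | succ N ih =>
      rw [Finset.sum_range_succ, Finset.sum_range_succ, mul_add]
      have h2 := R.lyapunov_succ_le N
      have e : 35 * (p.a₄ / p.β ^ 2) * ((p.ρ 1 - p.ρ (N + 1 + 1)) / p.L) * P.σy ^ 2 =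
        35 * (p.a₄ / p.β ^ 2) * ((p.ρ 1 - p.ρ (N + 1)) / p.L) * P.σy ^ 2 +
        35 * (p.a₄ / p.β ^ 2) * ((p.ρ (N + 1) - p.ρ (N + 2)) / p.L) * P.σy ^ 2 := by ring
      rw [e]
      linarith
  have hlog : 0 ≤ Real.log ((N : ℝ) + 2) :=
    Real.log_nonneg (by linarith [(Nat.cast_nonneg N : (0 : ℝ) ≤ N)])
  have h2 : 2 * p.δ ^ 2 * (p.a₅ ^ 2 * p.a₁ + p.a₆ ^ 2 * p.a₂) / p.b *
      ∑ n ∈ Finset.range N, 1 / ((n : ℝ) + 3) ≤ C2 P p * Real.log ((N : ℝ) + 2) := by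
    unfold C2
    have h3 := mul_le_mul_of_nonneg_left (sum_one_div_le_log N)
      (show 0 ≤ 2 * p.δ ^ 2 * (p.a₅ ^ 2 * p.a₁ + p.a₆ ^ 2 * p.a₂) / p.b by positivity)
    have h4 : 0 ≤ 12 * p.a₂ * p.L ^ 2 * P.σy ^ 2 / (13 * p.b) * Real.log ((N : ℝ) + 2) := by
      positivity
    linarith
  have h3 : Slow P p μ v w ≤ potentialS P p μ v w N (x (N + 1)) (y (N + 1)) := by
    obtain ⟨mx, my, -, -⟩ := R.measurable_iterates' (N + 1) (by omega)
    have hmem := R.mem_feasible (N + 1) (by omega)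
    exact csInf_le R.bddBelow_potentialS
      ⟨N, _, _, mx, my, fun ω => (hmem ω).1, fun ω => (hmem ω).2, rfl⟩
  have h4 : (p.ρ 1 - p.ρ (N + 1)) / 2 * P.σy ^ 2 ≤ p.ρ 1 / 2 * P.σy ^ 2 := by
    have := (hV.ρ_pos (N + 1)).le
    gcongr
    linarith
  have h5 : 35 * (p.a₄ / p.β ^ 2) * ((p.ρ 1 - p.ρ (N + 1)) / p.L) * P.σy ^ 2 ≤
      35 * (p.a₄ / p.β ^ 2) * 1 * P.σy ^ 2 := by
    gcongr
    rw [div_le_one hL]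
    linarith [hV.ρ_one_le, hV.ρ_pos (N + 1)]
  obtain ⟨k1, -⟩ := hV.drift_coef 0
  obtain ⟨k2, -⟩ := hV.drift_coef N
  have hx (n : ℕ) : ∀ ω, x (n + 1) ω ∈ P.X := fun ω => (R.mem_feasible (n + 1) (by omega) ω).1
  have h6 := mul_le_mul_of_nonneg_left (R.integral_sq_norm_ystar_le (0 + 1) (hx 0)) k1
  have h7 := mul_nonneg k2 (integral_nonneg (μ := μ)
    (f := fun ω => ‖P.ystar p (N + 1) (x (N + 1) ω)‖ ^ 2) fun ω => by positivity)
  have h8 := mul_le_mul_of_nonneg_right hV.drift_slack (sq_nonneg P.σy)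
  have h9 : 4 * p.D2 (N + 1) * p.ρ (N + 1) ^ 2 * P.σy ^ 2 / p.b ≤
      4 * p.D2 1 * p.ρ 1 ^ 2 * P.σy ^ 2 / p.b := by
    have := hV.D2_mul_sq_ρ_le N
    calc _ = 4 * (p.D2 (N + 1) * p.ρ (N + 1) ^ 2) * P.σy ^ 2 / p.b := by ring
      _ ≤ 4 * (p.D2 1 * p.ρ 1 ^ 2) * P.σy ^ 2 / p.b := by gcongr
      _ = _ := by ring
  unfold potentialS at h3
  rw [R.potentialF_eq_lyapunov] at h3
  unfold C1 potentialS
  have e0 := R.potentialF_eq_lyapunov 0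
  simp only [zero_add] at e0 h6 ⊢
  rw [e0]
  have e5 : 60 * p.a₄ / p.β ^ 2 * P.σy ^ 2 = 60 * (p.a₄ / p.β ^ 2 * P.σy ^ 2) := by ring
  linarith

end IsAdmissibleRun

/-! ### Sums of the weights k^{-9/13}. -/

theorem rpow_succ_sub_le {s : ℝ} (hs : 0 < s) :
    13 / 4 * ((s + 1) ^ ((4 : ℝ) / 13) - s ^ ((4 : ℝ) / 13)) ≤ 1 / s ^ ((9 : ℝ) / 13) := by
  have h1 := rpow_one_add_le_one_add_mul_self (s := 1 / s) (p := (4 : ℝ) / 13)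
    (by have : 0 < 1 / s := by positivity
        linarith) (by norm_num) (by norm_num)
  have h2 : s + 1 = s * (1 + 1 / s) := by field_simp
  have h3 : s ^ ((4 : ℝ) / 13) * (1 / s) = 1 / s ^ ((9 : ℝ) / 13) := by
    rw [eq_div_iff (by positivity), mul_right_comm, ← Real.rpow_add hs]
    norm_num
    field_simp
  rw [h2, Real.mul_rpow hs.le (by positivity), ← h3]
  have h4 := mul_le_mul_of_nonneg_left h1 (show 0 ≤ s ^ ((4 : ℝ) / 13) by positivity)
  linarith

theorem le_rpow_succ_sub {s : ℝ} (hs : 0 < s) :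
    1 / (s + 1) ^ ((9 : ℝ) / 13) ≤ 13 / 4 * ((s + 1) ^ ((4 : ℝ) / 13) - s ^ ((4 : ℝ) / 13)) := by
  have h1 := rpow_one_add_le_one_add_mul_self (s := -(1 / (s + 1))) (p := (4 : ℝ) / 13)
    (by rw [neg_le_neg_iff, div_le_one (by positivity)]; linarith) (by norm_num) (by norm_num)
  have h2 : s = (s + 1) * (1 + -(1 / (s + 1))) := by field_simp; ring
  have h5 : 0 ≤ 1 + -(1 / (s + 1)) := by
    rw [le_add_neg_iff_add_le, zero_add, div_le_one (by positivity)]; linarith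
  have h3 : (s + 1) ^ ((4 : ℝ) / 13) * (1 / (s + 1)) = 1 / (s + 1) ^ ((9 : ℝ) / 13) := by
    rw [eq_div_iff (by positivity), mul_right_comm, ← Real.rpow_add (by positivity)]
    norm_num
    field_simp
  have h6 : s ^ ((4 : ℝ) / 13) = (s + 1) ^ ((4 : ℝ) / 13) * (1 + -(1 / (s + 1))) ^ ((4 : ℝ) / 13) := by
    rw [← Real.mul_rpow (by positivity) h5, ← h2]
  rw [h6, ← h3]
  have h4 := mul_le_mul_of_nonneg_left h1 (show 0 ≤ (s + 1) ^ ((4 : ℝ) / 13) by positivity)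
  linarith

theorem sum_weights_le (N : ℕ) :
    ∑ n ∈ Finset.range N, 1 / ((n : ℝ) + 3) ^ ((9 : ℝ) / 13) ≤
      13 / 4 * ((N : ℝ) + 2) ^ ((4 : ℝ) / 13) := by
  induction N with
  | zero => simp; positivity
  | succ N ih =>
    rw [Finset.sum_range_succ]
    have h := le_rpow_succ_sub (s := (N : ℝ) + 2) (by positivity)
    have e : (N : ℝ) + 2 + 1 = N + 3 := by ring
    have e' : ((N + 1 : ℕ) : ℝ) + 2 = N + 3 := by push_cast; ring
    rw [e] at h
    rw [e']
    linarith

theorem le_sum_weights (N : ℕ) :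
    13 / 4 * (((N : ℝ) + 3) ^ ((4 : ℝ) / 13) - 3 ^ ((4 : ℝ) / 13)) ≤
      ∑ n ∈ Finset.range N, 1 / ((n : ℝ) + 3) ^ ((9 : ℝ) / 13) := by
  induction N with
  | zero => simp
  | succ N ih =>
    rw [Finset.sum_range_succ]
    have h := rpow_succ_sub_le (s := (N : ℝ) + 3) (by positivity)
    have e' : ((N + 1 : ℕ) : ℝ) + 3 = N + 3 + 1 := by push_cast; ring
    rw [e']
    linarith

/-- T - 1 iterations are available while the bound is stated for T. The missing weight is at most
the first one, so doubling the sum covers it; this uses up the factor between ε²/2 and ε²/4. -/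
theorem le_two_mul_sum_weights {N : ℕ} (hN : 1 ≤ N) :
    13 / 4 * (((N : ℝ) + 4) ^ ((4 : ℝ) / 13) - 3 ^ ((4 : ℝ) / 13)) ≤
      2 * ∑ n ∈ Finset.range N, 1 / ((n : ℝ) + 3) ^ ((9 : ℝ) / 13) := by
  have h1 := le_sum_weights (N + 1)
  rw [Finset.sum_range_succ] at h1
  have e' : ((N + 1 : ℕ) : ℝ) + 3 = N + 4 := by push_cast; ring
  rw [e'] at h1
  have h2 := Finset.single_le_sum (f := fun n : ℕ => 1 / ((n : ℝ) + 3) ^ ((9 : ℝ) / 13))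
    (fun i _ => by positivity) (Finset.mem_range.2 (show 0 < N by omega))
  have h3 : 1 / ((N : ℝ) + 3) ^ ((9 : ℝ) / 13) ≤ 1 / (((0 : ℕ) : ℝ) + 3) ^ ((9 : ℝ) / 13) := by
    gcongr
    exact Nat.zero_le N
  linarith

theorem Params.η_mul_α (p : Params) (n : ℕ) :
    p.η (n + 1) * p.α (n + 1) = p.a₄ * (1 / ((n : ℝ) + 3) ^ ((9 : ℝ) / 13)) := by
  have e : ((n + 1 : ℕ) : ℝ) + 2 = n + 3 := by push_cast; ring
  have h : ((n : ℝ) + 3) ^ ((9 : ℝ) / 13) = ((n : ℝ) + 3) ^ ((5 : ℝ) / 13) * ((n : ℝ) + 3) ^ ((4 : ℝ) / 13) := by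
    rw [← Real.rpow_add (by positivity)]; norm_num
  unfold η α
  rw [e, h]
  field_simp

theorem gapBound_nonneg {dx dy : ℕ} {Ξ Ω : Type*} [MeasurableSpace Ξ] [MeasurableSpace Ω]
    (P : MinimaxProblem dx dy Ξ) (p : Params) (μ : Measure Ω) (x : ℕ → Ω → Vec dx)
    (y : ℕ → Ω → Vec dy) (v : ℕ → Ω → Vec dx) (w : ℕ → Ω → Vec dy) (k : ℕ) : 0 ≤ gapBound P p μ x y v w k := by
  have h1 : 0 ≤ xStep P p μ x v k := integral_nonneg fun _ => by positivity
  have h2 : 0 ≤ vErr P μ x y v k := integral_nonneg fun _ => by positivity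
  have h3 : 0 ≤ yStep P p μ y w k := integral_nonneg fun _ => by positivity
  have h4 : 0 ≤ wErr P p μ x y w k := integral_nonneg fun _ => by positivity
  unfold gapBound
  positivity

/-! ### The count of non-stationary iterations. -/

namespace IsAdmissibleRun

variable {dx dy : ℕ} {Ξ Ω : Type*} [MeasurableSpace Ξ] {P : MinimaxProblem dx dy Ξ} {p : Params}
  [MeasurableSpace Ω] {μ : Measure Ω} {ζ : ℕ → Fin p.b → Ω → Ξ} {x₁ : Vec dx} {y₁ : Vec dy}
  {x : ℕ → Ω → Vec dx} {y : ℕ → Ω → Vec dy} {v : ℕ → Ω → Vec dx} {w : ℕ → Ω → Vec dy}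
  (R : IsAdmissibleRun P p μ ζ x₁ y₁ x y v w)
include R

/-- Once ρ_k σ_y ≤ ε/4, a non-stationary iterate has `gapBound` at least (3ε/4)² > ε²/2 and lowers
the sum. If the last index still has a larger bias, then k^{2/13} ε is of order L σ_y, and dropping
`gapBound` from the whole sum is affordable. -/
theorem sum_weights_mul_sub_le [IsProbabilityMeasure μ] {ε : ℝ} (hε : 0 < ε) (N : ℕ)
    (h : ∀ n < N, n + 1 ∉ stationaryIterations P p μ x y ε) :
    ∑ n ∈ Finset.range N, 1 / ((n : ℝ) + 3) ^ ((9 : ℝ) / 13) *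
      (ε ^ 2 / 2 - gapBound P p μ x y v w (n + 1)) ≤ 52 * p.L ^ 2 * P.σy ^ 2 := by
  have hL := R.valid.L_pos
  have hσ := σy_nonneg P
  induction N with
  | zero => simp; positivity
  | succ N ih =>
    by_cases hs : p.ρ (N + 1) * P.σy ≤ ε / 4
    · rw [Finset.sum_range_succ]
      have h1 := ih fun n hn => h n (by omega)
      obtain ⟨h2, h3⟩ := R.gap_le (k := N + 1) (by omega)
      have h4 : ε < ∫ ω, ‖P.gap (p.α (N + 1)) p.β (x (N + 1) ω) (y (N + 1) ω)‖ ∂μ := by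
        by_contra! hc
        exact h N (by omega) ⟨by omega, h2, hc⟩
      have h5 : 3 / 4 * ε ≤ √(gapBound P p μ x y v w (N + 1)) := by
        have h3' : _ ≤ √(gapBound P p μ x y v w (N + 1)) + _ := h3
        linarith
      have h6 : (3 / 4 * ε) ^ 2 ≤ gapBound P p μ x y v w (N + 1) :=
        (Real.le_sqrt (by positivity) (gapBound_nonneg ..)).1 h5
      have h7 : ε ^ 2 / 2 - gapBound P p μ x y v w (N + 1) ≤ 0 := by nlinarith
      have h8 := mul_nonpos_of_nonneg_of_nonpos
        (show 0 ≤ 1 / ((N : ℝ) + 3) ^ ((9 : ℝ) / 13) by positivity) h7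
      linarith
    · push Not at hs
      calc _ ≤ ∑ n ∈ Finset.range (N + 1), 1 / ((n : ℝ) + 3) ^ ((9 : ℝ) / 13) * (ε ^ 2 / 2) := by
            gcongr with n
            linarith [gapBound_nonneg P p μ x y v w (n + 1)]
        _ = (∑ n ∈ Finset.range (N + 1), 1 / ((n : ℝ) + 3) ^ ((9 : ℝ) / 13)) * (ε ^ 2 / 2) := by
            rw [Finset.sum_mul]
        _ ≤ 13 / 4 * (((N + 1 : ℕ) : ℝ) + 2) ^ ((4 : ℝ) / 13) * (ε ^ 2 / 2) := by
            gcongr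
            exact sum_weights_le (N + 1)
        _ ≤ 13 / 4 * (2 * (((N : ℝ) + 2) ^ ((2 : ℝ) / 13)) ^ 2) * (ε ^ 2 / 2) := by
            gcongr
            calc (((N + 1 : ℕ) : ℝ) + 2) ^ ((4 : ℝ) / 13) ≤ (2 * ((N : ℝ) + 2)) ^ ((4 : ℝ) / 13) := by
                  gcongr
                  push_cast
                  linarith [(Nat.cast_nonneg N : (0 : ℝ) ≤ N)]
              _ = 2 ^ ((4 : ℝ) / 13) * (((N : ℝ) + 2) ^ ((2 : ℝ) / 13)) ^ 2 := by
                  rw [Real.mul_rpow (by norm_num) (by positivity), ← Real.rpow_natCast,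
                    ← Real.rpow_mul (by positivity)]
                  norm_num
              _ ≤ 2 ^ (1 : ℝ) * (((N : ℝ) + 2) ^ ((2 : ℝ) / 13)) ^ 2 := by
                  gcongr <;> norm_num
              _ = _ := by rw [Real.rpow_one]
        _ = 13 / 4 * (((N : ℝ) + 2) ^ ((2 : ℝ) / 13) * ε) ^ 2 := by ring
        _ ≤ 13 / 4 * (4 * (p.L * P.σy)) ^ 2 := by
            refine mul_le_mul_of_nonneg_left (pow_le_pow_left₀ (by positivity) ?_ 2) (by norm_num)
            have e : ((N + 1 : ℕ) : ℝ) + 1 = N + 2 := by push_cast; ring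
            unfold Params.ρ at hs
            rw [e, div_mul_eq_mul_div, lt_div_iff₀ (by positivity)] at hs
            linarith
        _ = _ := by ring

/-- While no iterate is `ε`-stationary, the number of iterations satisfies the stated bound. -/
theorem rate_of_forall_notMem [IsProbabilityMeasure μ] {ε : ℝ} (hε : 0 < ε) {T : ℕ} (hT : 1 < T)
    (h : ∀ k, 1 ≤ k → k < T → k ∉ stationaryIterations P p μ x y ε) :
    ε ^ 2 / 4 * (p.d₁ * p.a₄ * (13 / 4 * ((T : ℝ) + 3) ^ ((4 : ℝ) / 13)
      - 13 * (3 : ℝ) ^ ((4 : ℝ) / 13) / 4)) ≤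
      C1 P p μ x y v w + C2 P p * Real.log ((T : ℝ) + 2) := by
  obtain ⟨N, rfl⟩ : ∃ N, T = N + 1 := ⟨T - 1, by omega⟩
  have hV := R.valid
  have hL := hV.L_pos
  have hb : (0 : ℝ) < p.b := by exact_mod_cast hV.b_pos
  have ha₁ := hV.a₁_pos
  have ha₂ := hV.a₂_pos
  have ha₄ := hV.a₄_pos
  have hβ := hV.β_pos
  have hd := hV.d₁_pos
  have hd8 := hV.d₁_le.trans ((min_le_left _ _).trans (min_le_left _ _))
  have h1 := R.sum_weights_mul_sub_le hε N fun n hn => h (n + 1) (by omega) (by omega)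
  have h2 := R.sum_gapBound_le N
  have h3 := le_two_mul_sum_weights (N := N) (by omega)
  set w' : ℕ → ℝ := fun n => 1 / ((n : ℝ) + 3) ^ ((9 : ℝ) / 13) with hw'
  have e1 : ∑ n ∈ Finset.range N, p.d₁ * p.η (n + 1) * p.α (n + 1) *
      gapBound P p μ x y v w (n + 1) =
      p.d₁ * p.a₄ * ∑ n ∈ Finset.range N, w' n * gapBound P p μ x y v w (n + 1) := by
    rw [Finset.mul_sum]
    refine Finset.sum_congr rfl fun n _ => ?_
    rw [mul_assoc p.d₁, p.η_mul_α n]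
    ring
  have e2 : ∑ n ∈ Finset.range N, w' n * (ε ^ 2 / 2 - gapBound P p μ x y v w (n + 1)) =
      (ε ^ 2 / 2) * ∑ n ∈ Finset.range N, w' n
        - ∑ n ∈ Finset.range N, w' n * gapBound P p μ x y v w (n + 1) := by
    rw [Finset.mul_sum, ← Finset.sum_sub_distrib]
    exact Finset.sum_congr rfl fun n _ => by ring
  rw [e1] at h2
  rw [e2] at h1
  have h4 := mul_le_mul_of_nonneg_left h1 (show 0 ≤ p.d₁ * p.a₄ by positivity)
  -- The cost of the early iterations fits into the reserve: d₁ ≤ 1/8 and βL ≤ 1 turn 52 into 13/2,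
  -- below 25.
  have h5 : p.d₁ * p.a₄ * (52 * p.L ^ 2 * P.σy ^ 2) ≤ 25 * (p.a₄ / p.β ^ 2) * P.σy ^ 2 := by
    have k1 : p.L ^ 2 ≤ 1 / p.β ^ 2 := by
      rw [le_div_iff₀ (by positivity), ← mul_pow]
      have k2 := hV.β_mul_L_le
      have k3 : 0 < p.L * p.β := by positivity
      nlinarith
    calc p.d₁ * p.a₄ * (52 * p.L ^ 2 * P.σy ^ 2) ≤
          1 / 8 * p.a₄ * (52 * (1 / p.β ^ 2) * P.σy ^ 2) := by gcongr
      _ = 13 / 2 * (p.a₄ / p.β ^ 2) * P.σy ^ 2 := by ring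
      _ ≤ _ := by gcongr; norm_num
  have hC2 : 0 ≤ C2 P p := by unfold C2; positivity
  have h6 : C2 P p * Real.log ((N : ℝ) + 2) ≤ C2 P p * Real.log (((N + 1 : ℕ) : ℝ) + 2) := by
    gcongr
    linarith
  have e3 : ((N + 1 : ℕ) : ℝ) + 3 = N + 4 := by push_cast; ring
  have h7 := mul_le_mul_of_nonneg_left h3 (show 0 ≤ ε ^ 2 / 4 * (p.d₁ * p.a₄) by positivity)
  rw [e3]
  linarith

end IsAdmissibleRun

/-- `13/4 ((T+3)^{4/13} - 3^{4/13})` grows faster than `log (T+2)`. -/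
theorem exists_log_lt_rpow (A B : ℝ) {c : ℝ} (hc : 0 < c) : ∃ T : ℕ, 1 < T ∧
    A + B * Real.log ((T : ℝ) + 2) < c * (13 / 4 * ((T : ℝ) + 3) ^ ((4 : ℝ) / 13)
      - 13 * (3 : ℝ) ^ ((4 : ℝ) / 13) / 4) := by
  have h1 : Tendsto (fun T : ℕ => (T : ℝ) + 3) atTop atTop :=
    tendsto_atTop_add_const_right _ _ tendsto_natCast_atTop_atTop
  have h2 := ((isLittleO_log_rpow_atTop (r := (4 : ℝ) / 13) (by norm_num)).comp_tendsto h1).bound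
    (show 0 < c / (|B| + 1) by positivity)
  have h3 := ((tendsto_rpow_atTop (y := (4 : ℝ) / 13) (by norm_num)).comp h1).eventually_gt_atTop
    ((A + c * (13 * (3 : ℝ) ^ ((4 : ℝ) / 13) / 4)) / (9 / 4 * c))
  obtain ⟨T, hT, h2, h3⟩ := ((eventually_gt_atTop 1).and (h2.and h3)).exists
  refine ⟨T, hT, ?_⟩
  simp only [Function.comp_apply, Real.norm_eq_abs] at h2 h3
  rw [div_lt_iff₀ (by positivity)] at h3
  have h0 : (0 : ℝ) ≤ T := Nat.cast_nonneg T
  have h4 : 0 ≤ Real.log ((T : ℝ) + 2) := Real.log_nonneg (by linarith)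
  have h5 : Real.log ((T : ℝ) + 2) ≤ Real.log ((T : ℝ) + 3) :=
    Real.log_le_log (by linarith) (by linarith)
  rw [abs_of_nonneg (h4.trans h5),
    abs_of_nonneg (show 0 ≤ ((T : ℝ) + 3) ^ ((4 : ℝ) / 13) by positivity), div_mul_eq_mul_div,
    le_div_iff₀ (by positivity)] at h2
  have h6 : B * Real.log ((T : ℝ) + 2) ≤ |B| * Real.log ((T : ℝ) + 3) :=
    mul_le_mul (le_abs_self B) h5 h4 (abs_nonneg B)
  have h7 := h4.trans h5
  linarith

/-! ### Solving for the number of iterations. -/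

theorem rpow_neg_thirteen_halves {ε : ℝ} (hε : 0 < ε) :
    ε ^ (-(13 : ℝ) / 2) = ((1 / ε ^ 2) ^ ((13 : ℝ) / 4)) := by
  rw [one_div, ← Real.rpow_natCast, ← Real.rpow_neg hε.le, ← Real.rpow_mul hε.le]
  norm_num

theorem one_le_two_mul_log_one_div {ε : ℝ} (hε : 0 < ε) (hε' : ε ≤ 1 / 2) :
    1 ≤ 2 * Real.log (1 / ε) := by
  have h1 : Real.log 2 ≤ Real.log (1 / ε) := by
    apply Real.log_le_log (by norm_num)
    rw [le_div_iff₀ hε]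
    linarith
  linarith [Real.log_two_gt_d9]

/-- Solving `z^{4/13} ≤ c ε⁻² log z` for `z`. -/
theorem le_of_rpow_le_log {c : ℝ} (hc : 0 < c) : ∃ K : ℝ, 0 ≤ K ∧ ∀ ε : ℝ, 0 < ε → ε ≤ 1 / 2 →
    ∀ z : ℝ, 1 ≤ z → z ^ ((4 : ℝ) / 13) ≤ c * (1 / ε ^ 2) * Real.log z →
      z ≤ K * ε ^ (-(13 : ℝ) / 2) * Real.log (1 / ε) ^ ((13 : ℝ) / 4) := by
  set c₂ := 13 / 2 * (2 * |Real.log (c * (13 / 2))| + 2) with hc₂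
  have hc₂pos : 0 < c₂ := by positivity
  refine ⟨(c * c₂) ^ ((13 : ℝ) / 4), by positivity, fun ε hε hε' z hz h => ?_⟩
  have hz0 : 0 < z := by linarith
  have hl := one_le_two_mul_log_one_div hε hε'
  -- A first, crude pass: log z ≤ (13/2) z^{2/13} gives a polynomial bound on z in 1/ε, hence log z
  -- = O(log(1/ε)). The second pass inserts this into the hypothesis.
  have h1 : Real.log z ≤ c₂ * Real.log (1 / ε) := by
    have h2 := Real.log_le_rpow_div hz0.le (show (0 : ℝ) < 2 / 13 by norm_num)
    have h3 : z ^ ((4 : ℝ) / 13) = z ^ ((2 : ℝ) / 13) * z ^ ((2 : ℝ) / 13) := by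
      rw [← Real.rpow_add hz0]; norm_num
    have h4 : z ^ ((2 : ℝ) / 13) * z ^ ((2 : ℝ) / 13) ≤
        (c * (13 / 2) * (1 / ε) ^ 2) * z ^ ((2 : ℝ) / 13) := by
      rw [← h3]
      refine h.trans ?_
      have h5 := mul_le_mul_of_nonneg_left h2 (show 0 ≤ c * (1 / ε ^ 2) by positivity)
      refine h5.trans_eq ?_
      rw [one_div_pow]
      ring
    have h5 := le_of_mul_le_mul_right h4 (by positivity)
    have h6 := Real.log_le_log (by positivity) h5
    rw [Real.log_rpow hz0, Real.log_mul (by positivity) (by positivity), Real.log_pow] at h6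
    have h7 := le_abs_self (Real.log (c * (13 / 2)))
    have h8 := mul_le_mul_of_nonneg_left hl (abs_nonneg (Real.log (c * (13 / 2))))
    push_cast at h6
    rw [hc₂]
    linarith
  have h2 : z ^ ((4 : ℝ) / 13) ≤ c * c₂ * (1 / ε ^ 2) * Real.log (1 / ε) := by
    have := mul_le_mul_of_nonneg_left h1 (show 0 ≤ c * (1 / ε ^ 2) by positivity)
    linarith
  have h3 := Real.rpow_le_rpow (by positivity) h2 (show (0 : ℝ) ≤ 13 / 4 by norm_num)
  rw [← Real.rpow_mul hz0.le, Real.mul_rpow (by positivity) (by linarith),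
    Real.mul_rpow (by positivity) (by positivity)] at h3
  rw [rpow_neg_thirteen_halves hε]
  norm_num at h3 ⊢
  exact h3

/-- The constant is chosen before ε, n and t, for all real parameters; the sign conditions come
after the quantifier so that choice yields a total function. -/
theorem exists_rate_constant (s C₁ C₂ d : ℝ) : ∃ K : ℝ, 0 ≤ s → 0 < d →
    ∀ ε : ℝ, 0 < ε → ε ≤ 1 / 2 → ∀ (n : ℕ) (t : ℝ), 1 ≤ n →
      t ≤ max (n : ℝ) ((2 * s / ε) ^ ((13 : ℝ) / 2) - 1) →
      (1 < n → ε ^ 2 / 4 * (d * (13 / 4 * ((n : ℝ) + 3) ^ ((4 : ℝ) / 13)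
        - 13 * (3 : ℝ) ^ ((4 : ℝ) / 13) / 4)) ≤ C₁ + C₂ * Real.log ((n : ℝ) + 2)) →
      t ≤ K * ε ^ (-(13 : ℝ) / 2) * Real.log (1 / ε) ^ ((13 : ℝ) / 4) := by
  by_cases hd : 0 < d
  swap
  · exact ⟨0, fun _ h => absurd h hd⟩
  by_cases hs : 0 ≤ s
  swap
  · exact ⟨0, fun h => absurd h hs⟩
  -- 16/13 is 4/(13/4), from dividing by ε²/4 and by 13/4; the summand 2 absorbs 3^{4/13} ≤ 2, since
  -- log(n + 2) ≥ 1 for n ≥ 2.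
  obtain ⟨K, hK, hKz⟩ := le_of_rpow_le_log (c := 16 / 13 * ((|C₁| + |C₂|) / d) + 2) (by positivity)
  refine ⟨K + (1 + (2 * s) ^ ((13 : ℝ) / 2)) * 2 ^ ((13 : ℝ) / 4), fun _ _ ε hε hε' n t hn ht hrate => ?_⟩
  have hl := one_le_two_mul_log_one_div hε hε'
  have hl0 : 0 < Real.log (1 / ε) := by linarith
  set E := ε ^ (-(13 : ℝ) / 2) with hE
  set l := Real.log (1 / ε) ^ ((13 : ℝ) / 4) with hl'
  have hE1 : 1 ≤ E := Real.one_le_rpow_of_pos_of_le_one_of_nonpos hε (by linarith) (by norm_num)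
  have hl1 : 1 ≤ 2 ^ ((13 : ℝ) / 4) * l := by
    rw [hl', ← Real.mul_rpow (by norm_num) hl0.le]
    exact Real.one_le_rpow hl (by norm_num)
  have hl'0 : 0 < l := by positivity
  have e : (K + (1 + (2 * s) ^ ((13 : ℝ) / 2)) * 2 ^ ((13 : ℝ) / 4)) * E * l =
      K * E * l + E * (2 ^ ((13 : ℝ) / 4) * l) +
        (2 * s) ^ ((13 : ℝ) / 2) * E * (2 ^ ((13 : ℝ) / 4) * l) := by ring
  have h1 : 0 ≤ K * E * l := by positivity
  have h2 : 1 ≤ E * (2 ^ ((13 : ℝ) / 4) * l) := one_le_mul_of_one_le_of_one_le hE1 hl1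
  have h3 : (2 * s / ε) ^ ((13 : ℝ) / 2) ≤
      (2 * s) ^ ((13 : ℝ) / 2) * E * (2 ^ ((13 : ℝ) / 4) * l) := by
    have e3 : (2 * s / ε) ^ ((13 : ℝ) / 2) = (2 * s) ^ ((13 : ℝ) / 2) * E := by
      rw [hE, neg_div, Real.rpow_neg hε.le, Real.div_rpow (by positivity) hε.le]
      rfl
    rw [e3]
    exact le_mul_of_one_le_right (by positivity) hl1
  have h30 : 0 ≤ (2 * s / ε) ^ ((13 : ℝ) / 2) := by positivity
  refine ht.trans (max_le ?_ (by rw [e]; linarith))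
  rcases Nat.lt_or_ge 1 n with h1n | h1n
  · have h4 := hKz ε hε hε' ((n : ℝ) + 2) (by linarith [(Nat.cast_nonneg n : (0 : ℝ) ≤ n)]) ?_
    · have h4' : (n : ℝ) + 2 ≤ K * E * l := h4
      have h5 : 0 ≤ (2 * s) ^ ((13 : ℝ) / 2) * E * (2 ^ ((13 : ℝ) / 4) * l) := by positivity
      rw [e]; linarith
    have h5 := hrate h1n
    have hlog : 1 ≤ Real.log ((n : ℝ) + 2) := by
      have h6 : (4 : ℝ) ≤ n + 2 := by
        have : (2 : ℝ) ≤ n := by exact_mod_cast h1n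
        linarith
      have h7 := Real.log_le_log (by norm_num) h6
      have h8 : Real.log 4 = 2 * Real.log 2 := by
        rw [show (4 : ℝ) = 2 ^ 2 by norm_num, Real.log_pow]; norm_num
      linarith [Real.log_two_gt_d9]
    set lg := Real.log ((n : ℝ) + 2) with hlam
    have h6 : C₁ + C₂ * lg ≤ (|C₁| + |C₂|) * lg := by
      have k1 : C₁ ≤ |C₁| * lg := (le_abs_self C₁).trans (le_mul_of_one_le_right (abs_nonneg _) hlog)
      have k2 : C₂ * lg ≤ |C₂| * lg := by gcongr; exact le_abs_self C₂
      linarith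
    have h7 : ((n : ℝ) + 2) ^ ((4 : ℝ) / 13) ≤ ((n : ℝ) + 3) ^ ((4 : ℝ) / 13) := by
      gcongr; norm_num
    have h8 : (3 : ℝ) ^ ((4 : ℝ) / 13) ≤ 2 := by
      calc (3 : ℝ) ^ ((4 : ℝ) / 13) ≤ 4 ^ ((1 : ℝ) / 2) := by
            apply (Real.rpow_le_rpow (by norm_num) (show (3 : ℝ) ≤ 4 by norm_num) (by norm_num)).trans
            exact Real.rpow_le_rpow_of_exponent_le (by norm_num) (by norm_num)
        _ = 2 := by
            rw [show (4 : ℝ) = 2 ^ (2 : ℝ) by norm_num, ← Real.rpow_mul (by norm_num)]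
            norm_num
    have h9 : (13 / 4 * ((n : ℝ) + 3) ^ ((4 : ℝ) / 13) - 13 * (3 : ℝ) ^ ((4 : ℝ) / 13) / 4) ≤
        4 * ((|C₁| + |C₂|) / d) * (1 / ε ^ 2) * lg := by
      have k1 := h5.trans h6
      have e9 : 4 * ((|C₁| + |C₂|) / d) * (1 / ε ^ 2) * lg =
          ((|C₁| + |C₂|) * lg) / (ε ^ 2 / 4 * d) := by field_simp
      rw [e9, le_div_iff₀ (by positivity)]
      linarith
    have h10 : 2 ≤ 2 * (1 / ε ^ 2) * lg := by
      have k1 : 1 ≤ 1 / ε ^ 2 := by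
        rw [le_div_iff₀ (by positivity)]
        nlinarith
      nlinarith [one_le_mul_of_one_le_of_one_le k1 hlog]
    linarith
  · have : n = 1 := le_antisymm h1n hn
    subst this
    rw [e]
    push_cast
    have h31 := h30.trans h3
    linarith

/-! ### Finiteness of T(ε) and the complexity bound. -/

namespace IsAdmissibleRun

variable {dx dy : ℕ} {Ξ Ω : Type*} [MeasurableSpace Ξ] {P : MinimaxProblem dx dy Ξ} {p : Params}
  [MeasurableSpace Ω] {μ : Measure Ω} {ζ : ℕ → Fin p.b → Ω → Ξ} {x₁ : Vec dx} {y₁ : Vec dy}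
  {x : ℕ → Ω → Vec dx} {y : ℕ → Ω → Vec dy} {v : ℕ → Ω → Vec dx} {w : ℕ → Ω → Vec dy}
  (R : IsAdmissibleRun P p μ ζ x₁ y₁ x y v w)
include R

/-- Without stationary iterations the rate inequality would hold for every T, although its left side
grows like T^{4/13} and its right side only logarithmically. -/
theorem stationaryIterations_nonempty [IsProbabilityMeasure μ] {ε : ℝ} (hε : 0 < ε) :
    (stationaryIterations P p μ x y ε).Nonempty := by
  by_contra hne
  rw [Set.not_nonempty_iff_eq_empty] at hne
  have hd := R.valid.d₁_pos
  have ha₄ := R.valid.a₄_pos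
  obtain ⟨T, hT, h⟩ := exists_log_lt_rpow (C1 P p μ x y v w) (C2 P p)
    (show 0 < ε ^ 2 / 4 * (p.d₁ * p.a₄) by positivity)
  have := R.rate_of_forall_notMem hε hT (fun k _ _ => by simp [hne])
  linarith

theorem exists_complexity_bound [IsProbabilityMeasure μ] {ε : ℝ} (hε : 0 < ε) :
    ∃ Ttilde : ℕ, 1 ≤ Ttilde ∧
      (T P p μ x y ε : ℝ) ≤ max (Ttilde : ℝ) ((2 * p.L * P.σy / ε) ^ ((13 : ℝ) / 2) - 1) ∧
      (1 < Ttilde → ε ^ 2 / 4 * (p.d₁ * p.a₄ * (13 / 4 * ((Ttilde : ℝ) + 3) ^ ((4 : ℝ) / 13)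
        - 13 * (3 : ℝ) ^ ((4 : ℝ) / 13) / 4)) ≤
        C1 P p μ x y v w + C2 P p * Real.log ((Ttilde : ℝ) + 2)) := by
  have h1 : 1 ≤ T P p μ x y ε := (Nat.sInf_mem (R.stationaryIterations_nonempty hε)).1
  -- The witness is T(ε) itself: every earlier iteration fails to be stationary, so the rate
  -- inequality applies to it.
  exact ⟨T P p μ x y ε, h1, le_max_left _ _, fun hT =>
    R.rate_of_forall_notMem hε hT fun k _ hk => Nat.notMem_of_lt_sInf hk⟩

end IsAdmissibleRun
end Formda

/-- `K` is one function, fixed before the problem, so the constant of the rate depends only on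
`L σ_y`, `C₁`, `C₂` and `d₁ a₄`. -/
theorem mainTheorem1 :
    ∃ K : ℝ → ℝ → ℝ → ℝ → ℝ,
      ∀ (dx dy : ℕ) (Ξ : Type*) (Ω : Type*) [MeasurableSpace Ξ] [MeasurableSpace Ω]
        (P : Formda.MinimaxProblem dx dy Ξ) (p : Formda.Params)
        (μ : MeasureTheory.Measure Ω) [MeasureTheory.IsProbabilityMeasure μ]
        (ζ : ℕ → Fin p.b → Ω → Ξ) (x₁ : Formda.Vec dx) (y₁ : Formda.Vec dy)
        (x : ℕ → Ω → Formda.Vec dx) (y : ℕ → Ω → Formda.Vec dy)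
        (v : ℕ → Ω → Formda.Vec dx) (w : ℕ → Ω → Formda.Vec dy),
        p.Valid → P.IsStandard → P.LipschitzGradients p.l → P.BoundedVariance p.δ →
        Formda.IsSampling P μ ζ → x₁ ∈ P.X → y₁ ∈ P.Y →
        Formda.IsRun P p ζ x₁ y₁ x y v w →
        (∀ ε : ℝ, 0 < ε →
          (Formda.stationaryIterations P p μ x y ε).Nonempty ∧
          ∃ Ttilde : ℕ, 1 ≤ Ttilde ∧
            (Formda.T P p μ x y ε : ℝ) ≤
              max (Ttilde : ℝ) ((2 * p.L * P.σy / ε) ^ ((13 : ℝ) / 2) - 1) ∧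
            (1 < Ttilde →
              ε ^ 2 / 4 ≤
                (Formda.C1 P p μ x y v w + Formda.C2 P p * Real.log ((Ttilde : ℝ) + 2)) /
                  (p.d₁ * p.a₄ * (13 / 4 * ((Ttilde : ℝ) + 3) ^ ((4 : ℝ) / 13)
                    - 13 * (3 : ℝ) ^ ((4 : ℝ) / 13) / 4)))) ∧
        (∀ ε : ℝ, 0 < ε → ε ≤ 1 / 2 →
          (Formda.T P p μ x y ε : ℝ) ≤
            K (p.L * P.σy) (Formda.C1 P p μ x y v w) (Formda.C2 P p) (p.d₁ * p.a₄)
              * ε ^ (-(13 : ℝ) / 2) * Real.log (1 / ε) ^ ((13 : ℝ) / 4)) := by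
  -- `K` becomes a function of four real numbers, fixed before any problem is introduced.
  choose K hK using Formda.exists_rate_constant
  refine ⟨K, ?_⟩
  intro dx dy Ξ Ω _ _ P p μ _ ζ x₁ y₁ x y v w hV hS hL hB hζ hx₁ hy₁ hR
  have R : Formda.IsAdmissibleRun P p μ ζ x₁ y₁ x y v w := ⟨hV, hS, hL, hB, hζ, hx₁, hy₁, hR⟩
  have hd := mul_pos hV.d₁_pos hV.a₄_pos
  refine ⟨fun ε hε => ⟨R.stationaryIterations_nonempty hε, ?_⟩, fun ε hε hε' => ?_⟩
  · obtain ⟨n, hn, hT, hrate⟩ := R.exists_complexity_bound hε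
    refine ⟨n, hn, hT, fun h1n => ?_⟩
    have hpos : (3 : ℝ) ^ ((4 : ℝ) / 13) < ((n : ℝ) + 3) ^ ((4 : ℝ) / 13) := by
      have : (0 : ℝ) < n := by exact_mod_cast (show 0 < n by omega)
      gcongr
      linarith
    rw [le_div_iff₀ (mul_pos hd (by linarith))]
    exact hrate h1n
  · obtain ⟨n, hn, hT, hrate⟩ := R.exists_complexity_bound hε
    refine hK _ _ _ _ (mul_nonneg hV.L_pos.le (Formda.σy_nonneg P)) hd ε hε hε' n _ hn ?_ hrate
    rwa [← mul_assoc]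

end
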